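/- **Setting.** For $r>1$ let $D_r\subset\mathbb R^2$ be the open disk of radius $r$ centred at the origin, $\Omega=D_r$, $A=D_1$ and $B=D_r\setminus\overline D_1$. Let $p=2$ and $1<q<\infty$. For densities $Q_B$ on $B\times[0,\infty)$ and $Q_A$ on $A\times[0,\infty)$ consider: - (A1) $Q_B,Q_A$ are Carathéodory functions; - (A2) for a.e. $x$, $E\mapsto Q_B(x,E)$ and $E\mapsto Q_A(x,E)$ are $C^1$ and strictly convex on $[0,\infty)$, positive for $E>0$, and vanish at $E=0$; - (A3) there are constants $0<\underline Q\le\overline Q$ and $E_0>0$ with $\underline Q[(E/E_0)^p-1]\le Q_B(x,E)\le\overline Q[(E/E_0)^p+1]$ for a.e. $x\in B$ and all $E\ge0$, and the same for $Q_A$ on $A$ with $q$ in place of $p$; - (A4) there is a function $\beta$ with $\lim_{E\to+\infty}Q_B(x,E)/E^p=\beta(x)$ for a.e. $x\in B$. For $\Psi:[0,\infty)\to[0,\infty)$ put $Q_B(x,E)=\Psi(E)$, $Q_A(x,E)=E^q$, $\gamma=7+12/r^2$, and for $\lambda>0$ $$\mathbb G^\lambda(v)=\frac1{\lambda^2}\Big(\int_{D_r\setminus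 \overline D_1}\Psi(\lambda|\nabla v|)\,dx+\int_{D_1}\lambda^q|\nabla v|^q\,dx\Big)\in[0,+\infty].$$ Let $v^\lambda$ denote a minimizer of $\mathbb G^\lambda$ among $v\in W^{1,2}(D_r)\cup W^{1,q}(D_r)$ with $v=\gamma x_1$ on $\partial D_r$, i.e. $v-\gamma x_1\in W^{1,2}_0(D_r)\cup W^{1,q}_0(D_r)$. **Statement.** There are $r_0\ge10$ and functions $\ell_1,\ell_2:\mathbb R\to[0,\infty)$ with $\ell_1(r)<\ell_2(r)$ for all $r\ge r_0$ such that, for every $L>1$, there exist two strictly increasing sequences $\lambda'_n\uparrow+\infty$, $\lambda''_n\uparrow+\infty$ of positive numbers, geometric with a common ratio, and a strictly convex $\Psi:[0,\infty)\to[0,\infty)$, with the following properties. 1. For all $n$: $L\lambda''_n<\lambda'_n$, $L\lambda'_n<\lambda''_{n+1}$, $\Psi(E)=2E^2$ on $[\lambda'_n,L\lambda'_n]$ and $\Psi(E)=3E^2$ on $[\lambda''_n,L\lambda''_n]$; in particular $\Psi(E)/E^2$ has no limit as $E\to+\infty$. 2. For all $q\in(1,\infty)$ and $r>1$, the densities $Q_B,Q_A$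 satisfy (A1), (A2), (A3), but (A4) fails. 3. If $L>10$, then for all $q\in(1,\infty)$ and all $r\ge r_0$: for every $\lambda>0$ the minimizer $v^\lambda$ exists and is unique (a.e. in $D_r$); the energies along the two sequences converge to different limits, $$\lim_{n\to\infty}\mathbb G^{\lambda'_n}(v^{\lambda'_n})\le\ell_1(r)<\ell_2(r)\le\lim_{n\to\infty}\mathbb G^{\lambda''_n}(v^{\lambda''_n})<+\infty,$$ so that $\lim_{\lambda\to+\infty}\mathbb G^\lambda(v^\lambda)$ does not exist; and if $q\ne2$, then $v^\lambda\in W^{1,2}(D_r\setminus\overline D_1)$ for every $\lambda>0$, but $v^\lambda$ does not converge weakly in $W^{1,2}(D_r\setminus\overline D_1)$, as $\lambda\to+\infty$, to any function. Hence the conclusion that $v^\lambda$ converges weakly in $W^{1,p}(B)$ (for $q<p$), or in $W^{1,p}(\Omega)$ (for $p<q$), to the minimizer of a limiting $\beta$-weighted $p$-Dirichlet energy fails when (A4) is dropped. -/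

import Mathlib

open Set Filter Topology MeasureTheory
open scoped NNReal ENNReal

namespace LargeData

/-- The Euclidean space of dimension `d`. -/
abbrev Euc (d : ℕ) : Type := EuclideanSpace ℝ (Fin d)

/-! ### Sobolev spaces -/

/-- `g` is the weak gradient of `v` in the open set `Ω`. -/
def HasWeakGrad {d : ℕ} (Ω : Set (Euc d)) (v : Euc d → ℝ) (g : Euc d → Euc d) : Prop :=
  LocallyIntegrableOn v Ω ∧ LocallyIntegrableOn g Ω ∧
    ∀ φ : Euc d → ℝ, ContDiff ℝ (⊤ : ℕ∞) φ → HasCompactSupport φ → tsupport φ ⊆ Ω →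
      ∫ x in Ω, v x • gradient φ x = - ∫ x in Ω, φ x • g x

open Classical in
/-- The weak gradient of `v` in `Ω` (unique up to null sets); zero if there is none. -/
noncomputable def weakGrad {d : ℕ} (Ω : Set (Euc d)) (v : Euc d → ℝ) : Euc d → Euc d :=
  if h : ∃ g, HasWeakGrad Ω v g then h.choose else 0

/-- `v ∈ W^{1,p}(Ω)`. -/
def MemW {d : ℕ} (p : ℝ) (Ω : Set (Euc d)) (v : Euc d → ℝ) : Prop :=
  MemLp v (ENNReal.ofReal p) (volume.restrict Ω) ∧
    ∃ g, HasWeakGrad Ω v g ∧ MemLp g (ENNReal.ofReal p) (volume.restrict Ω)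

/-- `v ∈ W^{1,p}_0(Ω)`, the closure of the compactly supported `C^1` functions on `Ω` in the
`W^{1,p}` norm. -/
def MemW0 {d : ℕ} (p : ℝ) (Ω : Set (Euc d)) (v : Euc d → ℝ) : Prop :=
  MemW p Ω v ∧
    ∃ φ : ℕ → Euc d → ℝ,
      (∀ n, ContDiff ℝ 1 (φ n) ∧ HasCompactSupport (φ n) ∧ tsupport (φ n) ⊆ Ω) ∧
      Tendsto (fun n => eLpNorm (fun x => φ n x - v x) (ENNReal.ofReal p) (volume.restrict Ω))
        atTop (𝓝 0) ∧
      Tendsto (fun n => eLpNorm (fun x => gradient (φ n) x - weakGrad Ω v x) (ENNReal.ofReal p)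
        (volume.restrict Ω)) atTop (𝓝 0)

/-- `v^λ ⇀ u` in `W^{1,p}(U)` as `λ → +∞`, for `1 < p < ∞` : the functions and their weak
gradients converge weakly in `L^p(U)`. -/
def WeaklyConvergesW {d : ℕ} (p : ℝ) (U : Set (Euc d)) (v : ℝ → Euc d → ℝ) (u : Euc d → ℝ) :
    Prop :=
  (∀ᶠ lam in atTop, MemW p U (v lam)) ∧ MemW p U u ∧
    (∀ g : Euc d → ℝ, MemLp g (ENNReal.ofReal (p / (p - 1))) (volume.restrict U) →
      Tendsto (fun lam => ∫ x in U, v lam x * g x) atTop (𝓝 (∫ x in U, u x * g x))) ∧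
    (∀ h : Euc d → Euc d, MemLp h (ENNReal.ofReal (p / (p - 1))) (volume.restrict U) →
      Tendsto (fun lam => ∫ x in U, inner ℝ (weakGrad U (v lam) x) (h x)) atTop
        (𝓝 (∫ x in U, inner ℝ (weakGrad U u x) (h x))))

/-! ### Energy densities: Carathéodory, convexity, growth and asymptotic conditions.
The outer region is `B = Ω \ closure A`. -/

/-- `Q` is a Carathéodory function on `D × [0, ∞)`. -/
def IsCaratheodory {d : ℕ} (D : Set (Euc d)) (Q : Euc d → ℝ → ℝ) : Prop :=
  (∀ E : ℝ, 0 ≤ E → AEMeasurable (fun x => Q x E) (volume.restrict D)) ∧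
    ∀ᵐ x ∂(volume.restrict D), ContinuousOn (Q x) (Ici 0)

/-- (A1) -/
def CondA1 {d : ℕ} (Ω A : Set (Euc d)) (QB QA : Euc d → ℝ → ℝ) : Prop :=
  IsCaratheodory (Ω \ closure A) QB ∧ IsCaratheodory A QA

/-- For a.e. `x ∈ D`, `E ↦ Q x E` is positive, `C^1`, strictly convex on `[0, ∞)` and vanishes
at `0`. -/
def IsRegularDensity {d : ℕ} (D : Set (Euc d)) (Q : Euc d → ℝ → ℝ) : Prop :=
  ∀ᵐ x ∂(volume.restrict D), (∀ E : ℝ, 0 < E → 0 < Q x E) ∧ ContDiffOn ℝ 1 (Q x) (Ici 0) ∧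
    StrictConvexOn ℝ (Ici 0) (Q x) ∧ Q x 0 = 0

/-- (A2) -/
def CondA2 {d : ℕ} (Ω A : Set (Euc d)) (QB QA : Euc d → ℝ → ℝ) : Prop :=
  IsRegularDensity (Ω \ closure A) QB ∧ IsRegularDensity A QA

/-- (A3) -/
def CondA3 {d : ℕ} (p q : ℝ) (Ω A : Set (Euc d)) (QB QA : Euc d → ℝ → ℝ) : Prop :=
  ∃ Qlow Qup E₀ : ℝ, 0 < Qlow ∧ Qlow ≤ Qup ∧ 0 < E₀ ∧
    (∀ᵐ x ∂(volume.restrict (Ω \ closure A)), ∀ E : ℝ, 0 ≤ E →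
      Qlow * ((E / E₀) ^ p - 1) ≤ QB x E ∧ QB x E ≤ Qup * ((E / E₀) ^ p + 1)) ∧
    (∀ᵐ x ∂(volume.restrict A), ∀ E : ℝ, 0 ≤ E →
      Qlow * ((E / E₀) ^ q - 1) ≤ QA x E ∧ QA x E ≤ Qup * ((E / E₀) ^ q + 1))

/-- (A4) -/
def CondA4 {d : ℕ} (p : ℝ) (Ω A : Set (Euc d)) (QB : Euc d → ℝ → ℝ) : Prop :=
  ∃ β : Euc d → ℝ, ∀ᵐ x ∂(volume.restrict (Ω \ closure A)),
    Tendsto (fun E : ℝ => QB x E / E ^ p) atTop (𝓝 (β x))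

/-! ### The normalized problem -/

/-- `v ∈ W^{1,p}(Ω) ∪ W^{1,q}(Ω)` with `v = f` on `∂Ω`, that is,
`v - f ∈ W^{1,p}_0(Ω) ∪ W^{1,q}_0(Ω)`. -/
def Admissible {d : ℕ} (p q : ℝ) (Ω : Set (Euc d)) (f v : Euc d → ℝ) : Prop :=
  (MemW p Ω v ∨ MemW q Ω v) ∧
    (MemW0 p Ω (fun x => v x - f x) ∨ MemW0 q Ω (fun x => v x - f x))

/-- The normalized energy
`G^λ(v) = λ^{-p} (∫_B Q_B(x, λ|∇v|) dx + ∫_A Q_A(x, λ|∇v|) dx) ∈ [0, ∞]`. -/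
noncomputable def normEnergy {d : ℕ} (p : ℝ) (Ω A : Set (Euc d)) (QB QA : Euc d → ℝ → ℝ)
    (lam : ℝ) (v : Euc d → ℝ) : ℝ≥0∞ :=
  ENNReal.ofReal (1 / lam ^ p) *
    ((∫⁻ x in Ω \ closure A, ENNReal.ofReal (QB x (lam * ‖weakGrad Ω v x‖))) +
      ∫⁻ x in A, ENNReal.ofReal (QA x (lam * ‖weakGrad Ω v x‖)))

/-- `v` is a solution `v^λ` of the normalized minimum problem with boundary data `f`. -/
def IsNormSolution {d : ℕ} (p q : ℝ) (Ω A : Set (Euc d)) (QB QA : Euc d → ℝ → ℝ)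
    (f : Euc d → ℝ) (lam : ℝ) (v : Euc d → ℝ) : Prop :=
  Admissible p q Ω f v ∧
    ∀ w, Admissible p q Ω f w → normEnergy p Ω A QB QA lam v ≤ normEnergy p Ω A QB QA lam w

/-! ### The two-dimensional configuration -/

/-- The open disk `D_r` centred at the origin of the plane. -/
abbrev disk (r : ℝ) : Set (Euc 2) := Metric.ball 0 r

/-- The outer region: the annulus `D_r \ closure D_1`. -/
abbrev annulus (r : ℝ) : Set (Euc 2) := disk r \ closure (disk 1)

/-- The density `Q_B(x, E) = Ψ(E)` of the outer region. -/
def outerDensity (Ψ : ℝ → ℝ) : Euc 2 → ℝ → ℝ := fun _ E => Ψ E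

/-- The density `Q_A(x, E) = E^q` of the inner region. -/
noncomputable def innerDensity (q : ℝ) : Euc 2 → ℝ → ℝ := fun _ E => E ^ q

/-- The boundary data `γ x₁` with `γ = 7 + 12 / r²`. -/
noncomputable def bdryData (r : ℝ) : Euc 2 → ℝ := fun x => (7 + 12 / r ^ 2) * x 0

/-- `G^λ` for the two-dimensional configuration, with `p = 2`. -/
noncomputable def energy2 (q r : ℝ) (Ψ : ℝ → ℝ) (lam : ℝ) (v : Euc 2 → ℝ) : ℝ≥0∞ :=
  normEnergy 2 (disk r) (disk 1) (outerDensity Ψ) (innerDensity q) lam v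

/-- `v` is the solution `v^λ` for the two-dimensional configuration, with `p = 2`. -/
def IsSolution2 (q r : ℝ) (Ψ : ℝ → ℝ) (lam : ℝ) (v : Euc 2 → ℝ) : Prop :=
  IsNormSolution 2 q (disk r) (disk 1) (outerDensity Ψ) (innerDensity q) (bdryData r) lam v

end LargeData

open LargeData

/-! The density is `Ψ(E) = E² h(log E)` with `h` smooth, of period `T`, with values in `[2, 3]`,
equal to `3` and to `2` on two windows of length `T/3` per period, and with `|h'|, |h''| ≤ 1/2`.
Then `Ψ'' = 2h + 3h' + h'' ≥ 2` away from `0`, so `Ψ` is strongly convex although `Ψ(E)/E²`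
oscillates for ever. With `t = log λ` the normalized energy is `∫_B |∇v|² h(t + log |∇v|) + κ ∫_A
|∇v|^q`, where `κ = λ^(q-2)`: scaling `λ` only translates the profile and changes the weight `κ`.
Strong convexity on `B` and uniform convexity of `|·|^q` on `A` make minimizing sequences Cauchy,
which gives existence and uniqueness (`exists_isGradMinimizer`, `IsGradMinimizer.unique`).

Energies. Along `λ = exp (t + n T)` the outer density does not depend on `n` and `κ` is monotone, so
the minimal energies are monotone and converge (`exists_tendsto_energy2`). The boundary slope is
close to `7` for large `r`, and the harmonic fields used for comparison have norm in `(1, 10)` at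
distance at least `10` from the origin; if `t` is the start of a plateau `c` longer than `log 10`,
the density at these fields is exactly `c |ξ|²`. On the plateau `2` the harmonic competitor that is
constant on `A` costs at most `2.3 γ² π r²` (`gradEnergy_compGrad_le`). On the plateau `3` a
divergence free field that vanishes on `A` calibrates the lower bound `2.5 γ² π r²`, whatever
happens in `A` (`le_gradEnergy`).

Weak convergence. Suppose the gradients converge weakly on `B` to `g`. Every `t` is reached by `λ =
exp (t + n T)`, so lower semicontinuity bounds the `t`-energy of `g` by that of any competitor with
asymptotically negligible energy in `A`, for all `t` at once (`IsWeakFamily.integral_dens_le`). For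
`q < 2` the weight `κ` tends to `0` and the relevant competitor is a multiple of `x₀ (1 + 1/|x|²)`
(free inner boundary); for `q > 2` it tends to infinity and the competitor is a multiple of `x₀ (1 -
1/|x|²)` (constant on `A`). Since `h(t) + h(t + T/2) = 5`, adding the inequalities for `0` and `T/2`
compares Dirichlet energies and forces `g` to be that harmonic field
(`IsWeakFamily.ae_eq_compGrad`). Then the harmonic field solves the Euler-Lagrange equation of every
`t`, so `k(t + log |g|)`, with `k = 2h + h'`, is constant along its flow lines
(`fderiv_fluxCoef_eq_zero`). But `|g|` varies along the axis and `t` is arbitrary, so `k` would be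
constant, while it equals `6` and `4` on the plateaus. -/

namespace LargeData

/-! ### Convergence in `L^p` on finite measure spaces -/

section LpConvergence

variable {α E F G : Type*} [MeasurableSpace α] {μ : Measure α}
  [NormedAddCommGroup E] [NormedAddCommGroup F] [NormedAddCommGroup G]

/-- On a finite measure space, convergence to zero in `L^p` implies convergence to zero in `L^q`
for `q ≤ p`. -/
theorem tendsto_eLpNorm_zero_mono [IsFiniteMeasure μ] {ι : Type*} {l : Filter ι} {p q : ℝ≥0∞}
    (hqp : q ≤ p) {f : ι → α → E} (hf : ∀ n, AEStronglyMeasurable (f n) μ)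
    (h : Tendsto (fun n => eLpNorm (f n) p μ) l (𝓝 0)) :
    Tendsto (fun n => eLpNorm (f n) q μ) l (𝓝 0) := by
  by_cases hq0 : q = 0
  · simpa [hq0] using tendsto_const_nhds
  have hexp : 0 ≤ 1 / q.toReal - 1 / p.toReal := by
    by_cases hpt : p = ⊤
    · simp [hpt]
    have hqt : q ≠ ⊤ := ne_top_of_le_ne_top hpt hqp
    have : q.toReal ≤ p.toReal := (ENNReal.toReal_le_toReal hqt hpt).2 hqp
    have hq : 0 < q.toReal := ENNReal.toReal_pos hq0 hqt
    rw [sub_nonneg]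
    exact one_div_le_one_div_of_le hq this
  have hC : μ univ ^ (1 / q.toReal - 1 / p.toReal) ≠ ⊤ :=
    ENNReal.rpow_ne_top_of_nonneg hexp (measure_ne_top μ univ)
  have h2 := ENNReal.Tendsto.mul_const h (Or.inr hC)
  rw [zero_mul] at h2
  exact tendsto_of_tendsto_of_tendsto_of_le_of_le tendsto_const_nhds h2 (fun _ => zero_le)
    (fun n => eLpNorm_le_eLpNorm_mul_rpow_measure_univ hqp (hf n))

/-- A Cauchy sequence in `L^p` converges in `L^p`. -/
theorem exists_tendsto_eLpNorm_of_cauchy [CompleteSpace E] {p : ℝ≥0∞} (hp : 1 ≤ p)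
    {f : ℕ → α → E} (hf : ∀ n, MemLp (f n) p μ)
    (h : ∀ ε : ℝ≥0∞, 0 < ε → ∃ N, ∀ n ≥ N, ∀ k ≥ N, eLpNorm (f n - f k) p μ ≤ ε) :
    ∃ g, MemLp g p μ ∧ Tendsto (fun n => eLpNorm (f n - g) p μ) atTop (𝓝 0) := by
  have : Fact (1 ≤ p) := ⟨hp⟩
  have hc : CauchySeq (fun n => (hf n).toLp (f n)) := by
    rw [EMetric.cauchySeq_iff]
    intro ε hε
    obtain ⟨ε', h0, h1⟩ := exists_between hε
    obtain ⟨N, hN⟩ := h ε' h0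
    refine ⟨N, fun n hn k hk => lt_of_le_of_lt ?_ h1⟩
    rw [Lp.edist_toLp_toLp]
    exact hN n hn k hk
  obtain ⟨g, hg⟩ := cauchySeq_tendsto_of_complete hc
  refine ⟨g, Lp.memLp g, ?_⟩
  rw [Lp.tendsto_Lp_iff_tendsto_eLpNorm'] at hg
  refine hg.congr fun n => eLpNorm_congr_ae ?_
  filter_upwards [(hf n).coeFn_toLp] with x hx
  simp [hx]

theorem eLpNorm_cauchy_of_tendsto {p : ℝ≥0∞} (hp : 1 ≤ p)
    {f : ℕ → α → E} {g : α → E} (hf : ∀ n, AEStronglyMeasurable (f n) μ)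
    (hg : AEStronglyMeasurable g μ)
    (h : Tendsto (fun n => eLpNorm (f n - g) p μ) atTop (𝓝 0)) (ε : ℝ≥0∞) (hε : 0 < ε) :
    ∃ N, ∀ n ≥ N, ∀ k ≥ N, eLpNorm (f n - f k) p μ ≤ ε := by
  have hε2 : 0 < ε / 2 := ENNReal.half_pos hε.ne'
  obtain ⟨N, hN⟩ := eventually_atTop.1 ((ENNReal.tendsto_nhds_zero.1 h) (ε / 2) hε2)
  refine ⟨N, fun n hn k hk => ?_⟩
  have : f n - f k = (f n - g) - (f k - g) := by abel
  rw [this]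
  refine (eLpNorm_sub_le ((hf n).sub hg) ((hf k).sub hg) hp).trans ?_
  exact (add_le_add (hN n hn) (hN k hk)).trans (ENNReal.add_halves ε).le

/-- Pairing with a bounded function is continuous for `L^p` convergence on a finite measure
space. -/
theorem tendsto_integral_bilin [NormedSpace ℝ E] [NormedSpace ℝ F] [NormedSpace ℝ G]
    [IsFiniteMeasure μ] {p : ℝ≥0∞} (hp : 1 ≤ p) (B : E →L[ℝ] F →L[ℝ] G)
    {h : α → E} (hh : AEStronglyMeasurable h μ) {C : ℝ} (hC : ∀ᵐ x ∂μ, ‖h x‖ ≤ C)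
    {ι : Type*} {l : Filter ι} {f : ι → α → F} {g : α → F}
    (hf : ∀ n, MemLp (f n) p μ) (hg : MemLp g p μ)
    (hfg : Tendsto (fun n => eLpNorm (f n - g) p μ) l (𝓝 0)) :
    Tendsto (fun n => ∫ x, B (h x) (f n x) ∂μ) l (𝓝 (∫ x, B (h x) (g x) ∂μ)) := by
  have key : ∀ u : α → F, AEStronglyMeasurable u μ →
      eLpNorm (fun x => B (h x) (u x)) 1 μ ≤ ENNReal.ofReal (‖B‖ * |C|) * eLpNorm u 1 μ := by
    intro u hu
    apply eLpNorm_le_mul_eLpNorm_of_ae_le_mul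
    filter_upwards [hC] with x hx
    calc ‖B (h x) (u x)‖ ≤ ‖B‖ * ‖h x‖ * ‖u x‖ := B.le_opNorm₂ _ _
      _ ≤ ‖B‖ * |C| * ‖u x‖ := by gcongr; exact hx.trans (le_abs_self C)
  have hmeas : ∀ u : α → F, AEStronglyMeasurable u μ →
      AEStronglyMeasurable (fun x => B (h x) (u x)) μ := fun u hu =>
    B.aestronglyMeasurable_comp₂ hh hu
  have hint : ∀ u : α → F, MemLp u p μ → Integrable (fun x => B (h x) (u x)) μ := by
    intro u hu
    rw [← memLp_one_iff_integrable]
    refine ⟨hmeas u hu.1, (key u hu.1).trans_lt ?_⟩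
    exact ENNReal.mul_lt_top ENNReal.ofReal_lt_top (hu.mono_exponent hp).2
  refine tendsto_integral_of_L1' _ (hint g hg).1 (Eventually.of_forall fun n => hint _ (hf n)) ?_
  have h1 := tendsto_eLpNorm_zero_mono hp (fun n => (hf n).1.sub hg.1) hfg
  have h2 := ENNReal.Tendsto.const_mul (a := ENNReal.ofReal (‖B‖ * |C|)) h1
    (Or.inr ENNReal.ofReal_ne_top)
  rw [mul_zero] at h2
  refine tendsto_of_tendsto_of_tendsto_of_le_of_le tendsto_const_nhds h2 (fun _ => zero_le)
    fun n => ?_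
  have := key (f n - g) ((hf n).1.sub hg.1)
  refine le_trans (le_of_eq ?_) this
  congr 1
  ext x
  simp

end LpConvergence

/-! ### Weak gradients and test functions -/

section WeakGradient

variable {d : ℕ} {Ω U : Set (Euc d)}

theorem inner_gradient (φ : Euc d → ℝ) (x v : Euc d) :
    inner ℝ (gradient φ x) v = fderiv ℝ φ x v := by
  simp [gradient]

theorem norm_gradient (φ : Euc d → ℝ) (x : Euc d) : ‖gradient φ x‖ = ‖fderiv ℝ φ x‖ := by
  simp [gradient]

theorem continuous_gradient {φ : Euc d → ℝ} (h : ContDiff ℝ 1 φ) : Continuous (gradient φ) :=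
  (LinearIsometryEquiv.continuous _).comp (h.continuous_fderiv one_ne_zero)

theorem gradient_eq_zero_of_notMem {φ : Euc d → ℝ} {x : Euc d} (h : x ∉ tsupport φ) :
    gradient φ x = 0 := by
  have : fderiv ℝ φ x = 0 := by
    by_contra hne
    exact h (support_fderiv_subset ℝ hne)
  simp [gradient, this]

theorem hasCompactSupport_gradient {φ : Euc d → ℝ} (h : HasCompactSupport φ) :
    HasCompactSupport (gradient φ) :=
  HasCompactSupport.intro h fun _ hx => gradient_eq_zero_of_notMem hx

theorem gradient_add' {φ ψ : Euc d → ℝ} {x : Euc d} (h : DifferentiableAt ℝ φ x)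
    (h' : DifferentiableAt ℝ ψ x) :
    gradient (fun x => φ x + ψ x) x = gradient φ x + gradient ψ x := by
  simp [gradient, fderiv_fun_add h h']

theorem gradient_const_mul' {φ : Euc d → ℝ} {x : Euc d} (c : ℝ) (h : DifferentiableAt ℝ φ x) :
    gradient (fun x => c * φ x) x = c • gradient φ x := by
  simp [gradient, fderiv_const_mul h]

/-- `φ` is a compactly supported `C^1` function on `Ω`. -/
def IsTest (Ω : Set (Euc d)) (φ : Euc d → ℝ) : Prop :=
  ContDiff ℝ 1 φ ∧ HasCompactSupport φ ∧ tsupport φ ⊆ Ω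

theorem IsTest.gradient_eq_zero {φ : Euc d → ℝ} (h : IsTest Ω φ) {x : Euc d} (hx : x ∉ Ω) :
    gradient φ x = 0 :=
  gradient_eq_zero_of_notMem fun h' => hx (h.2.2 h')

theorem IsTest.bounded {φ : Euc d → ℝ} (h : IsTest Ω φ) : ∃ C, ∀ x, ‖φ x‖ ≤ C :=
  h.1.continuous.bounded_above_of_compact_support h.2.1

theorem IsTest.gradient_bounded {φ : Euc d → ℝ} (h : IsTest Ω φ) :
    ∃ C, ∀ x, ‖gradient φ x‖ ≤ C :=
  (continuous_gradient h.1).bounded_above_of_compact_support (hasCompactSupport_gradient h.2.1)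

theorem IsTest.add {φ ψ : Euc d → ℝ} (h : IsTest Ω φ) (h' : IsTest Ω ψ) :
    IsTest Ω (fun x => φ x + ψ x) :=
  ⟨h.1.add h'.1, h.2.1.add h'.2.1, (tsupport_add φ ψ).trans (union_subset h.2.2 h'.2.2)⟩

theorem IsTest.const_mul {φ : Euc d → ℝ} (h : IsTest Ω φ) (c : ℝ) :
    IsTest Ω (fun x => c * φ x) :=
  ⟨contDiff_const.mul h.1, h.2.1.mul_left, (tsupport_mul_subset_right).trans h.2.2⟩

theorem IsTest.memLp {φ : Euc d → ℝ} (h : IsTest Ω φ) (p : ℝ≥0∞) :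
    MemLp φ p (volume.restrict Ω) :=
  (h.1.continuous.memLp_of_hasCompactSupport h.2.1).restrict Ω

theorem IsTest.memLp_gradient {φ : Euc d → ℝ} (h : IsTest Ω φ) (p : ℝ≥0∞) :
    MemLp (gradient φ) p (volume.restrict Ω) :=
  ((continuous_gradient h.1).memLp_of_hasCompactSupport
    (hasCompactSupport_gradient h.2.1)).restrict Ω

theorem integrable_smul_of_locallyIntegrableOn {E : Type*} [NormedAddCommGroup E]
    [NormedSpace ℝ E] {φ : Euc d → ℝ} {g : Euc d → E} (hφ : Continuous φ)
    (hc : HasCompactSupport φ) (hs : tsupport φ ⊆ Ω) (hg : LocallyIntegrableOn g Ω) :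
    Integrable (fun x => φ x • g x) := by
  have h1 : IntegrableOn g (tsupport φ) := hg.integrableOn_compact_subset hs hc
  have h2 : IntegrableOn (fun x => φ x • g x) (tsupport φ) :=
    h1.continuousOn_smul hφ.continuousOn hc
  refine (integrableOn_iff_integrable_of_support_subset ?_).1 h2
  intro x hx
  apply subset_tsupport
  intro h0
  simp [h0] at hx

theorem setIntegral_smul_eq {E : Type*} [NormedAddCommGroup E] [NormedSpace ℝ E]
    {φ : Euc d → ℝ} (hs : tsupport φ ⊆ Ω) (g : Euc d → E) :
    ∫ x in Ω, φ x • g x = ∫ x, φ x • g x := by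
  apply setIntegral_eq_integral_of_forall_compl_eq_zero
  intro x hx
  rw [image_eq_zero_of_notMem_tsupport fun h' => hx (hs h'), zero_smul]

theorem HasWeakGrad.unique (hΩ : IsOpen Ω) {v : Euc d → ℝ} {g g' : Euc d → Euc d}
    (h : HasWeakGrad Ω v g) (h' : HasWeakGrad Ω v g') : g =ᵐ[volume.restrict Ω] g' := by
  have key : ∀ᵐ x ∂volume, x ∈ Ω → (g - g') x = 0 := by
    refine hΩ.ae_eq_zero_of_integral_contDiff_smul_eq_zero (h.2.1.sub h'.2.1) ?_
    intro φ hφ hc hs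
    have e := (h.2.2 φ hφ hc hs).symm.trans (h'.2.2 φ hφ hc hs)
    rw [neg_inj, setIntegral_smul_eq hs, setIntegral_smul_eq hs] at e
    simp only [Pi.sub_apply, smul_sub]
    rw [integral_sub (integrable_smul_of_locallyIntegrableOn hφ.continuous hc hs h.2.1)
      (integrable_smul_of_locallyIntegrableOn hφ.continuous hc hs h'.2.1), e, sub_self]
  rw [← ae_restrict_iff' hΩ.measurableSet] at key
  filter_upwards [key] with x hx
  exact sub_eq_zero.1 hx

theorem HasWeakGrad.weakGrad {v : Euc d → ℝ} {g : Euc d → Euc d} (h : HasWeakGrad Ω v g) :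
    HasWeakGrad Ω v (weakGrad Ω v) := by
  have hex : ∃ g, HasWeakGrad Ω v g := ⟨g, h⟩
  unfold LargeData.weakGrad
  rw [dif_pos hex]
  exact hex.choose_spec

theorem HasWeakGrad.weakGrad_ae_eq (hΩ : IsOpen Ω) {v : Euc d → ℝ} {g : Euc d → Euc d}
    (h : HasWeakGrad Ω v g) : LargeData.weakGrad Ω v =ᵐ[volume.restrict Ω] g :=
  h.weakGrad.unique hΩ h

theorem HasWeakGrad.restrict {v : Euc d → ℝ} {g : Euc d → Euc d} (h : HasWeakGrad Ω v g)
    (hU : U ⊆ Ω) : HasWeakGrad U v g := by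
  refine ⟨h.1.mono_set hU, h.2.1.mono_set hU, fun φ hφ hc hs => ?_⟩
  have e := h.2.2 φ hφ hc (hs.trans hU)
  rw [setIntegral_smul_eq (hs.trans hU)] at e
  rw [setIntegral_smul_eq hs, ← e]
  have hz : ∀ V : Set (Euc d), tsupport φ ⊆ V →
      ∫ x in V, v x • gradient φ x = ∫ x, v x • gradient φ x := fun V hV => by
    apply setIntegral_eq_integral_of_forall_compl_eq_zero
    intro x hx
    rw [gradient_eq_zero_of_notMem fun h' => hx (hV h'), smul_zero]
  rw [hz _ hs, hz _ (hs.trans hU)]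

/-- A `C^1` function has its gradient as weak gradient. -/
theorem hasWeakGrad_gradient {φ : Euc d → ℝ} (hφ : ContDiff ℝ 1 φ) :
    HasWeakGrad Ω φ (gradient φ) := by
  refine ⟨hφ.continuous.locallyIntegrable.locallyIntegrableOn Ω,
    (continuous_gradient hφ).locallyIntegrable.locallyIntegrableOn Ω, fun η hη hc hs => ?_⟩
  have hη1 : ContDiff ℝ 1 η := hη.of_le (by exact_mod_cast le_top)
  rw [setIntegral_smul_eq hs]
  have hz : ∫ x in Ω, φ x • gradient η x = ∫ x, φ x • gradient η x := by
    apply setIntegral_eq_integral_of_forall_compl_eq_zero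
    intro x hx
    rw [gradient_eq_zero_of_notMem fun h' => hx (hs h'), smul_zero]
  rw [hz]
  have i1 : Integrable (fun x => φ x • gradient η x) :=
    (hφ.continuous.smul (continuous_gradient hη1)).integrable_of_hasCompactSupport
      (hasCompactSupport_gradient hc).smul_left
  have i2 : Integrable (fun x => η x • gradient φ x) :=
    (hη.continuous.smul (continuous_gradient hφ)).integrable_of_hasCompactSupport hc.smul_right
  refine ext_inner_left ℝ fun w => ?_
  rw [← integral_inner i1, inner_neg_right, ← integral_inner i2]
  have hin : ∀ (f : Euc d → ℝ) x, inner ℝ w (gradient f x) = fderiv ℝ f x w := fun f x => by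
    rw [real_inner_comm, inner_gradient]
  simp only [inner_smul_right, hin]
  have := integral_mul_fderiv_eq_neg_fderiv_mul_of_integrable (μ := volume) (f := φ) (g := η)
    (v := w) ?_ ?_ ?_ (fun x _ => hφ.differentiable one_ne_zero x)
    (fun x _ => hη1.differentiable one_ne_zero x)
  · rw [this]
    congr 1
    exact integral_congr_ae (Eventually.of_forall fun x => mul_comm _ _)
  · simpa [inner_smul_right, hin, mul_comm] using Integrable.const_inner (𝕜 := ℝ) w i2
  · simpa [inner_smul_right, hin] using Integrable.const_inner (𝕜 := ℝ) w i1
  · exact (hφ.continuous.mul hη.continuous).integrable_of_hasCompactSupport hc.mul_left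

theorem HasWeakGrad.add {v w : Euc d → ℝ} {g k : Euc d → Euc d} (h : HasWeakGrad Ω v g)
    (h' : HasWeakGrad Ω w k) : HasWeakGrad Ω (fun x => v x + w x) (fun x => g x + k x) := by
  refine ⟨h.1.add h'.1, h.2.1.add h'.2.1, fun φ hφ hc hs => ?_⟩
  have hφ1 : ContDiff ℝ 1 φ := hφ.of_le (by exact_mod_cast le_top)
  have hI : ∀ u : Euc d → ℝ, LocallyIntegrableOn u Ω →
      Integrable (fun x => u x • gradient φ x) := by
    intro u hu
    have h1 : IntegrableOn u (tsupport φ) := hu.integrableOn_compact_subset hs hc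
    have h2 : IntegrableOn (fun x => u x • gradient φ x) (tsupport φ) :=
      h1.smul_continuousOn (continuous_gradient hφ1).continuousOn hc
    refine (integrableOn_iff_integrable_of_support_subset ?_).1 h2
    intro x hx
    by_contra h0
    simp [gradient_eq_zero_of_notMem h0] at hx
  simp only [add_smul, smul_add]
  rw [integral_add (hI v h.1).integrableOn (hI w h'.1).integrableOn, integral_add
    (integrable_smul_of_locallyIntegrableOn hφ.continuous hc hs h.2.1).integrableOn
    (integrable_smul_of_locallyIntegrableOn hφ.continuous hc hs h'.2.1).integrableOn,
    h.2.2 φ hφ hc hs, h'.2.2 φ hφ hc hs, neg_add]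

/-- The weak gradient is a closed operator for `L^p` convergence. -/
theorem hasWeakGrad_of_tendsto [IsFiniteMeasure (volume.restrict Ω)] {p : ℝ≥0∞} (hp : 1 ≤ p)
    {v : ℕ → Euc d → ℝ} {u : Euc d → ℝ} {g : ℕ → Euc d → Euc d} {G : Euc d → Euc d}
    (hv : ∀ n, MemLp (v n) p (volume.restrict Ω)) (hu : MemLp u p (volume.restrict Ω))
    (hg : ∀ n, MemLp (g n) p (volume.restrict Ω)) (hG : MemLp G p (volume.restrict Ω))
    (h : ∀ n, HasWeakGrad Ω (v n) (g n))
    (hvu : Tendsto (fun n => eLpNorm (v n - u) p (volume.restrict Ω)) atTop (𝓝 0))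
    (hgG : Tendsto (fun n => eLpNorm (g n - G) p (volume.restrict Ω)) atTop (𝓝 0)) :
    HasWeakGrad Ω u G := by
  have hloc : ∀ {E : Type} [NormedAddCommGroup E] {f : Euc d → E},
      MemLp f p (volume.restrict Ω) → LocallyIntegrableOn f Ω := by
    intro E _ f hf
    exact IntegrableOn.locallyIntegrableOn (hf.integrable hp)
  refine ⟨hloc hu, hloc hG, fun φ hφ hc hs => ?_⟩
  have hφ1 : IsTest Ω φ := ⟨hφ.of_le (by exact_mod_cast le_top), hc, hs⟩
  obtain ⟨C, hC⟩ := hφ1.bounded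
  obtain ⟨C', hC'⟩ := hφ1.gradient_bounded
  have t1 := tendsto_integral_bilin hp (ContinuousLinearMap.lsmul ℝ ℝ (E := Euc d)).flip
    (hφ1.memLp_gradient 1).1 (Eventually.of_forall hC') hv hu hvu
  have t2 := tendsto_integral_bilin hp (ContinuousLinearMap.lsmul ℝ ℝ (E := Euc d))
    (hφ1.memLp 1).1 (Eventually.of_forall hC) hg hG hgG
  simp only [ContinuousLinearMap.flip_apply, ContinuousLinearMap.lsmul_apply] at t1 t2
  refine tendsto_nhds_unique t1 ?_
  refine t2.neg.congr fun n => ((h n).2.2 φ hφ hc hs).symm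

end WeakGradient

/-! ### The space `W^{1,p}_0` with an explicit gradient field -/

section W0

variable {d : ℕ} {Ω U : Set (Euc d)} {p : ℝ≥0∞}

/-- `u` belongs to the closure of the compactly supported `C^1` functions on `Ω` in the `W^{1,p}`
norm, and `G` is its gradient. -/
def IsW0 (p : ℝ≥0∞) (Ω : Set (Euc d)) (u : Euc d → ℝ) (G : Euc d → Euc d) : Prop :=
  MemLp u p (volume.restrict Ω) ∧ MemLp G p (volume.restrict Ω) ∧
    ∃ φ : ℕ → Euc d → ℝ, (∀ n, IsTest Ω (φ n)) ∧
      Tendsto (fun n => eLpNorm (φ n - u) p (volume.restrict Ω)) atTop (𝓝 0) ∧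
      Tendsto (fun n => eLpNorm (gradient (φ n) - G) p (volume.restrict Ω)) atTop (𝓝 0)

theorem IsW0.hasWeakGrad [IsFiniteMeasure (volume.restrict Ω)] (hp : 1 ≤ p)
    {u : Euc d → ℝ} {G : Euc d → Euc d} (h : IsW0 p Ω u G) : HasWeakGrad Ω u G := by
  obtain ⟨hu, hG, φ, hφ, h1, h2⟩ := h
  exact hasWeakGrad_of_tendsto hp (fun n => (hφ n).memLp p) hu (fun n => (hφ n).memLp_gradient p)
    hG (fun n => hasWeakGrad_gradient (hφ n).1) h1 h2

theorem IsW0.congr_grad {u : Euc d → ℝ} {G G' : Euc d → Euc d} (h : IsW0 p Ω u G)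
    (hG : G =ᵐ[volume.restrict Ω] G') : IsW0 p Ω u G' := by
  obtain ⟨hu, hG1, φ, hφ, h1, h2⟩ := h
  refine ⟨hu, hG1.ae_eq hG, φ, hφ, h1, h2.congr fun n => eLpNorm_congr_ae ?_⟩
  filter_upwards [hG] with x hx
  simp [hx]

theorem isW0_of_isTest {φ : Euc d → ℝ} (h : IsTest Ω φ) : IsW0 p Ω φ (gradient φ) := by
  refine ⟨h.memLp p, h.memLp_gradient p, fun _ => φ, fun _ => h, ?_, ?_⟩ <;> simp

theorem IsW0.add (hp : 1 ≤ p) {u v : Euc d → ℝ} {G H : Euc d → Euc d} (h : IsW0 p Ω u G)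
    (h' : IsW0 p Ω v H) : IsW0 p Ω (fun x => u x + v x) (fun x => G x + H x) := by
  obtain ⟨hu, hG, φ, hφ, h1, h2⟩ := h
  obtain ⟨hv, hH, ψ, hψ, h3, h4⟩ := h'
  refine ⟨hu.add hv, hG.add hH, fun n x => φ n x + ψ n x, fun n => (hφ n).add (hψ n), ?_, ?_⟩
  · have := h1.add h3
    rw [add_zero] at this
    refine tendsto_of_tendsto_of_tendsto_of_le_of_le tendsto_const_nhds this (fun _ => zero_le)
      fun n => ?_
    refine le_trans (le_of_eq ?_) (eLpNorm_add_le (((hφ n).memLp p).1.sub hu.1)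
      (((hψ n).memLp p).1.sub hv.1) hp)
    congr 1
    ext x
    simp only [Pi.sub_apply, Pi.add_apply]
    ring
  · have := h2.add h4
    rw [add_zero] at this
    refine tendsto_of_tendsto_of_tendsto_of_le_of_le tendsto_const_nhds this (fun _ => zero_le)
      fun n => ?_
    refine le_trans (le_of_eq ?_) (eLpNorm_add_le (((hφ n).memLp_gradient p).1.sub hG.1)
      (((hψ n).memLp_gradient p).1.sub hH.1) hp)
    congr 1
    ext1 x
    simp only [Pi.sub_apply, Pi.add_apply]
    rw [gradient_add' ((hφ n).1.differentiable one_ne_zero x)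
      ((hψ n).1.differentiable one_ne_zero x)]
    abel

theorem IsW0.const_mul (c : ℝ) {u : Euc d → ℝ} {G : Euc d → Euc d} (h : IsW0 p Ω u G) :
    IsW0 p Ω (fun x => c * u x) (fun x => c • G x) := by
  obtain ⟨hu, hG, φ, hφ, h1, h2⟩ := h
  refine ⟨hu.const_mul c, hG.const_smul c, fun n x => c * φ n x, fun n => (hφ n).const_mul c,
    ?_, ?_⟩
  · have := ENNReal.Tendsto.const_mul (a := ‖c‖ₑ) h1 (Or.inr enorm_ne_top)
    rw [mul_zero] at this
    refine this.congr fun n => ?_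
    rw [← eLpNorm_const_smul]
    congr 1
    ext x
    simp [mul_sub]
  · have := ENNReal.Tendsto.const_mul (a := ‖c‖ₑ) h2 (Or.inr enorm_ne_top)
    rw [mul_zero] at this
    refine this.congr fun n => ?_
    rw [← eLpNorm_const_smul]
    congr 1
    ext1 x
    simp only [Pi.smul_apply, Pi.sub_apply]
    rw [gradient_const_mul' c ((hφ n).1.differentiable one_ne_zero x), smul_sub]

theorem IsW0.sub (hp : 1 ≤ p) {u v : Euc d → ℝ} {G H : Euc d → Euc d} (h : IsW0 p Ω u G)
    (h' : IsW0 p Ω v H) : IsW0 p Ω (fun x => u x - v x) (fun x => G x - H x) := by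
  have := h.add hp (h'.const_mul (-1))
  simpa only [neg_mul, one_mul, neg_smul, one_smul, ← sub_eq_add_neg] using this

theorem IsW0.mono_exponent [IsFiniteMeasure (volume.restrict Ω)] {q : ℝ≥0∞} (hqp : q ≤ p)
    {u : Euc d → ℝ} {G : Euc d → Euc d} (h : IsW0 p Ω u G) : IsW0 q Ω u G := by
  obtain ⟨hu, hG, φ, hφ, h1, h2⟩ := h
  exact ⟨hu.mono_exponent hqp, hG.mono_exponent hqp, φ, hφ,
    tendsto_eLpNorm_zero_mono hqp (fun n => ((hφ n).memLp p).1.sub hu.1) h1,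
    tendsto_eLpNorm_zero_mono hqp (fun n => ((hφ n).memLp_gradient p).1.sub hG.1) h2⟩

/-- The space is closed under `W^{1,p}` convergence. -/
theorem isW0_of_tendsto (hp : 1 ≤ p) {v : ℕ → Euc d → ℝ} {g : ℕ → Euc d → Euc d}
    {u : Euc d → ℝ} {G : Euc d → Euc d} (h : ∀ n, IsW0 p Ω (v n) (g n))
    (hu : MemLp u p (volume.restrict Ω)) (hG : MemLp G p (volume.restrict Ω))
    (hvu : Tendsto (fun n => eLpNorm (v n - u) p (volume.restrict Ω)) atTop (𝓝 0))
    (hgG : Tendsto (fun n => eLpNorm (g n - G) p (volume.restrict Ω)) atTop (𝓝 0)) :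
    IsW0 p Ω u G := by
  have hch : ∀ n : ℕ, ∃ φ, IsTest Ω φ ∧
      eLpNorm (φ - v n) p (volume.restrict Ω) ≤ ENNReal.ofReal (1 / (n + 1)) ∧
      eLpNorm (gradient φ - g n) p (volume.restrict Ω) ≤ ENNReal.ofReal (1 / (n + 1)) := by
    intro n
    obtain ⟨-, -, φ, hφ, h1, h2⟩ := h n
    have hpos : 0 < ENNReal.ofReal (1 / ((n : ℝ) + 1)) := ENNReal.ofReal_pos.2 (by positivity)
    obtain ⟨k, hk1, hk2⟩ := ((ENNReal.tendsto_nhds_zero.1 h1 _ hpos).and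
      (ENNReal.tendsto_nhds_zero.1 h2 _ hpos)).exists
    exact ⟨φ k, hφ k, hk1, hk2⟩
  choose φ hφ h1 h2 using hch
  have h0 : Tendsto (fun n : ℕ => ENNReal.ofReal (1 / ((n : ℝ) + 1))) atTop (𝓝 0) := by
    simpa using ENNReal.tendsto_ofReal tendsto_one_div_add_atTop_nhds_zero_nat
  refine ⟨hu, hG, φ, hφ, ?_, ?_⟩
  · have := h0.add hvu
    rw [add_zero] at this
    refine tendsto_of_tendsto_of_tendsto_of_le_of_le tendsto_const_nhds this (fun _ => zero_le)
      fun n => ?_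
    have e : φ n - u = (φ n - v n) + (v n - u) := by abel
    rw [e]
    exact (eLpNorm_add_le (((hφ n).memLp p).1.sub (h n).1.1) ((h n).1.1.sub hu.1) hp).trans
      (add_le_add (h1 n) le_rfl)
  · have := h0.add hgG
    rw [add_zero] at this
    refine tendsto_of_tendsto_of_tendsto_of_le_of_le tendsto_const_nhds this (fun _ => zero_le)
      fun n => ?_
    have e : gradient (φ n) - G = (gradient (φ n) - g n) + (g n - G) := by abel
    rw [e]
    exact (eLpNorm_add_le (((hφ n).memLp_gradient p).1.sub (h n).2.1.1)
      ((h n).2.1.1.sub hG.1) hp).trans (add_le_add (h2 n) le_rfl)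

/-- A bounded field orthogonal to the gradients of test functions is orthogonal to the gradients
of all functions of the closure. -/
theorem IsW0.integral_inner_eq_zero [IsFiniteMeasure (volume.restrict Ω)] (hp : 1 ≤ p)
    {F : Euc d → Euc d} (hF : AEStronglyMeasurable F (volume.restrict Ω)) {C : ℝ}
    (hC : ∀ᵐ x ∂(volume.restrict Ω), ‖F x‖ ≤ C)
    (hdiv : ∀ φ, IsTest Ω φ → ∫ x in Ω, inner ℝ (F x) (gradient φ x) = 0)
    {u : Euc d → ℝ} {G : Euc d → Euc d} (h : IsW0 p Ω u G) :
    ∫ x in Ω, inner ℝ (F x) (G x) = 0 := by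
  obtain ⟨hu, hG, φ, hφ, h1, h2⟩ := h
  have t := tendsto_integral_bilin hp (innerSL ℝ (E := Euc d)) hF hC
    (fun n => (hφ n).memLp_gradient p) hG h2
  refine tendsto_nhds_unique t ?_
  exact tendsto_const_nhds.congr fun n => (hdiv _ (hφ n)).symm

theorem IsW0.memW0 [IsFiniteMeasure (volume.restrict Ω)] (hΩ : IsOpen Ω) {p : ℝ} (hp : 1 ≤ p)
    {u : Euc d → ℝ} {G : Euc d → Euc d} (h : IsW0 (ENNReal.ofReal p) Ω u G) : MemW0 p Ω u := by
  have hp' : 1 ≤ ENNReal.ofReal p := by simpa using ENNReal.ofReal_le_ofReal hp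
  have hw := h.hasWeakGrad hp'
  obtain ⟨hu, hG, φ, hφ, h1, h2⟩ := h.congr_grad (hw.weakGrad_ae_eq hΩ).symm
  exact ⟨⟨hu, _, hw.weakGrad, hG⟩, φ, hφ, h1, h2⟩

theorem MemW.memLp_weakGrad (hΩ : IsOpen Ω) {p : ℝ} {u : Euc d → ℝ} (h : MemW p Ω u) :
    MemLp (weakGrad Ω u) (ENNReal.ofReal p) (volume.restrict Ω) := by
  obtain ⟨-, g, hg, hgp⟩ := h
  exact hgp.ae_eq (hg.weakGrad_ae_eq hΩ).symm

theorem MemW0.isW0 (hΩ : IsOpen Ω) {p : ℝ} {u : Euc d → ℝ} (h : MemW0 p Ω u) :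
    IsW0 (ENNReal.ofReal p) Ω u (weakGrad Ω u) := by
  obtain ⟨hw, φ, hφ, h1, h2⟩ := h
  exact ⟨hw.1, hw.memLp_weakGrad hΩ, φ, hφ, h1, h2⟩

end W0

/-! ### Sobolev and Poincaré inequalities in the plane -/

section Poincare

variable {Ω : Set (Euc 2)}

/-- The Sobolev inequality in the plane, `‖u‖_2 ≤ C ‖∇u‖_1`. -/
theorem exists_eLpNorm_two_le (hb : Bornology.IsBounded Ω) :
    ∃ C : ℝ≥0, ∀ φ, IsTest Ω φ →
      eLpNorm φ 2 (volume.restrict Ω) ≤ C * eLpNorm (gradient φ) 1 (volume.restrict Ω) := by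
  refine ⟨eLpNormLESNormFDerivOfLeConst ℝ volume Ω 1 2, fun φ hφ => ?_⟩
  have h := eLpNorm_le_eLpNorm_fderiv_of_le (volume : Measure (Euc 2)) hφ.1 (s := Ω)
    ((subset_tsupport φ).trans hφ.2.2) (p := 1) (q := 2) le_rfl (by simp) (by simp; norm_num) hb
  have e1 : eLpNorm φ 2 (volume.restrict Ω) = eLpNorm φ 2 volume :=
    eLpNorm_restrict_eq_of_support_subset ((subset_tsupport φ).trans hφ.2.2)
  have e2 : eLpNorm (gradient φ) 1 (volume.restrict Ω) = eLpNorm (gradient φ) 1 volume := by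
    apply eLpNorm_restrict_eq_of_support_subset
    intro x hx
    by_contra h'
    exact hx (hφ.gradient_eq_zero h')
  have e3 : eLpNorm (gradient φ) 1 volume = eLpNorm (fderiv ℝ φ) 1 volume :=
    eLpNorm_congr_norm_ae (Eventually.of_forall fun x => norm_gradient φ x)
  rw [e1, e2, e3]
  simpa using h

/-- The inequality for test functions passes to the limit by Fatou along an almost everywhere
convergent subsequence. The function gains integrability up to the exponent `2` even when `p < 2`,
which later puts the minimizers in `L^2` of the annulus. -/
theorem IsW0.exists_eLpNorm_two_le [IsFiniteMeasure (volume.restrict Ω)]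
    (hb : Bornology.IsBounded Ω) {p : ℝ≥0∞} (hp : 1 ≤ p) :
    ∃ C : ℝ≥0, ∀ u G, IsW0 p Ω u G →
      eLpNorm u 2 (volume.restrict Ω) ≤ C * eLpNorm G 1 (volume.restrict Ω) := by
  obtain ⟨C, hC⟩ := LargeData.exists_eLpNorm_two_le hb
  refine ⟨C, fun u G h => ?_⟩
  obtain ⟨hu, hG, φ, hφ, h1, h2⟩ := h
  have hm := tendstoInMeasure_of_tendsto_eLpNorm (zero_lt_one.trans_le hp).ne'
    (fun n => ((hφ n).memLp p).1) hu.1 h1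
  obtain ⟨ns, hns, hae⟩ := hm.exists_seq_tendsto_ae
  have h3 := tendsto_eLpNorm_zero_mono hp
    (fun n => ((hφ n).memLp_gradient p).1.sub hG.1) h2
  have h4 : Tendsto (fun n => (C : ℝ≥0∞) * (eLpNorm G 1 (volume.restrict Ω) +
      eLpNorm (gradient (φ (ns n)) - G) 1 (volume.restrict Ω))) atTop
      (𝓝 (C * eLpNorm G 1 (volume.restrict Ω))) := by
    have := ENNReal.Tendsto.const_mul (a := (C : ℝ≥0∞))
      (((h3.comp hns.tendsto_atTop).const_add (eLpNorm G 1 (volume.restrict Ω))))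
      (Or.inr ENNReal.coe_ne_top)
    simpa using this
  calc eLpNorm u 2 (volume.restrict Ω)
      ≤ liminf (fun n => eLpNorm (φ (ns n)) 2 (volume.restrict Ω)) atTop :=
        Lp.eLpNorm_lim_le_liminf_eLpNorm (fun n => ((hφ (ns n)).memLp 2).1) u hae
    _ ≤ liminf (fun n => (C : ℝ≥0∞) * (eLpNorm G 1 (volume.restrict Ω) +
      eLpNorm (gradient (φ (ns n)) - G) 1 (volume.restrict Ω))) atTop := by
        refine liminf_le_liminf (Eventually.of_forall fun n => ?_)
        refine (hC _ (hφ (ns n))).trans ?_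
        gcongr
        have e : gradient (φ (ns n)) = G + (gradient (φ (ns n)) - G) := by abel
        conv_lhs => rw [e]
        exact eLpNorm_add_le hG.1 (((hφ (ns n)).memLp_gradient p).1.sub hG.1) le_rfl
    _ = C * eLpNorm G 1 (volume.restrict Ω) := h4.liminf_eq

/-- The Poincaré inequality for `1 ≤ p ≤ 2`. -/
theorem IsW0.exists_poincare [IsFiniteMeasure (volume.restrict Ω)]
    (hb : Bornology.IsBounded Ω) {p : ℝ≥0∞} (hp : 1 ≤ p) (hp2 : p ≤ 2) :
    ∃ C : ℝ≥0, ∀ u G, IsW0 p Ω u G →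
      eLpNorm u p (volume.restrict Ω) ≤ C * eLpNorm G p (volume.restrict Ω) := by
  have hpt : p ≠ ⊤ := ne_top_of_le_ne_top (by simp) hp2
  have hp0 : 0 < p.toReal := ENNReal.toReal_pos (zero_lt_one.trans_le hp).ne' hpt
  have hp1 : 1 ≤ p.toReal := by
    simpa using (ENNReal.toReal_le_toReal ENNReal.one_ne_top hpt).2 hp
  have hp2' : p.toReal ≤ 2 := by
    simpa using (ENNReal.toReal_le_toReal hpt (by simp)).2 hp2
  obtain ⟨C, hC⟩ := IsW0.exists_eLpNorm_two_le hb hp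
  set c1 : ℝ≥0∞ := (volume.restrict Ω) univ ^ (1 / p.toReal - 1 / (2 : ℝ≥0∞).toReal) with hc1
  set c2 : ℝ≥0∞ := (volume.restrict Ω) univ ^ (1 / (1 : ℝ≥0∞).toReal - 1 / p.toReal) with hc2
  have h1 : c1 ≠ ⊤ := by
    refine ENNReal.rpow_ne_top_of_nonneg ?_ (measure_ne_top _ _)
    rw [sub_nonneg]
    simpa using one_div_le_one_div_of_le hp0 hp2'
  have h2 : c2 ≠ ⊤ := by
    refine ENNReal.rpow_ne_top_of_nonneg ?_ (measure_ne_top _ _)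
    rw [sub_nonneg]
    simpa using one_div_le_one_div_of_le zero_lt_one hp1
  refine ⟨(C * c2 * c1).toNNReal, fun u G h => ?_⟩
  rw [ENNReal.coe_toNNReal (ENNReal.mul_ne_top (ENNReal.mul_ne_top ENNReal.coe_ne_top h2) h1)]
  calc eLpNorm u p (volume.restrict Ω) ≤ eLpNorm u 2 (volume.restrict Ω) * c1 :=
        eLpNorm_le_eLpNorm_mul_rpow_measure_univ hp2 h.1.1
    _ ≤ C * (eLpNorm G p (volume.restrict Ω) * c2) * c1 := by
        gcongr
        refine (hC u G h).trans ?_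
        gcongr
        exact eLpNorm_le_eLpNorm_mul_rpow_measure_univ hp h.2.1.1
    _ = C * c2 * c1 * eLpNorm G p (volume.restrict Ω) := by ring

/-- If the gradients converge in `L^p`, so do the functions. -/
theorem IsW0.exists_limit [IsFiniteMeasure (volume.restrict Ω)]
    (hb : Bornology.IsBounded Ω) {p : ℝ≥0∞} (hp : 1 ≤ p) (hp2 : p ≤ 2)
    {v : ℕ → Euc 2 → ℝ} {g : ℕ → Euc 2 → Euc 2} {G : Euc 2 → Euc 2}
    (h : ∀ n, IsW0 p Ω (v n) (g n)) (hG : MemLp G p (volume.restrict Ω))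
    (hgG : Tendsto (fun n => eLpNorm (g n - G) p (volume.restrict Ω)) atTop (𝓝 0)) :
    ∃ u, IsW0 p Ω u G := by
  obtain ⟨C, hC⟩ := IsW0.exists_poincare hb hp hp2
  obtain ⟨u, hu, hvu⟩ := exists_tendsto_eLpNorm_of_cauchy hp (fun n => (h n).1) (fun ε hε => by
    have hpos : 0 < ε / (C + 1) := ENNReal.div_pos hε.ne' (by simp)
    obtain ⟨N, hN⟩ := eLpNorm_cauchy_of_tendsto hp (fun n => (h n).2.1.1) hG.1 hgG _ hpos
    refine ⟨N, fun n hn k hk => ?_⟩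
    refine (hC _ _ ((h n).sub hp (h k))).trans ?_
    calc (C : ℝ≥0∞) * eLpNorm (g n - g k) p (volume.restrict Ω)
        ≤ (C + 1) * (ε / (C + 1)) := by
          gcongr
          · exact le_self_add
          · exact hN n hn k hk
      _ ≤ ε := ENNReal.mul_div_le)
  exact ⟨u, isW0_of_tendsto hp h hu hG hvu hgG⟩

end Poincare

/-! ### The oscillating profile -/

section Profile

/-- A slowly varying smooth profile with values in `[2, 3]`. -/
structure IsSlow (h : ℝ → ℝ) : Prop where
  smooth : ContDiff ℝ (⊤ : ℕ∞) h
  two_le : ∀ t, 2 ≤ h t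
  le_three : ∀ t, h t ≤ 3
  deriv_le : ∀ t, |deriv h t| ≤ 1 / 2
  deriv2_le : ∀ t, |deriv (deriv h) t| ≤ 1 / 2

/-- A slowly varying profile of period `T` that alternates between the plateaus `3` and `2`. -/
structure IsProfile (h : ℝ → ℝ) (T : ℝ) : Prop extends IsSlow h where
  pos : 0 < T
  periodic : Function.Periodic h T
  half : ∀ t, h t + h (t + T / 2) = 5
  three : ∀ t ∈ Icc (T / 12) (5 * T / 12), h t = 3
  two : ∀ t ∈ Icc (7 * T / 12) (11 * T / 12), h t = 2

theorem smoothTransition_add_symm (x : ℝ) :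
    Real.smoothTransition x + Real.smoothTransition (1 - x) = 1 := by
  unfold Real.smoothTransition
  have h := Real.smoothTransition.pos_denom x
  rw [sub_sub_cancel, add_comm (expNegInvGlue (1 - x)), ← add_div, div_self h.ne']

theorem exists_bound_of_periodic {f : ℝ → ℝ} (hf : Continuous f) (hp : Function.Periodic f 1) :
    ∃ M, ∀ t, |f t| ≤ M := by
  obtain ⟨M, hM⟩ := isCompact_Icc.exists_bound_of_continuousOn (s := Icc (0 : ℝ) 1)
    hf.continuousOn
  refine ⟨M, fun t => ?_⟩
  obtain ⟨y, hy, e⟩ := hp.exists_mem_Ico₀ one_pos t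
  rw [e]
  exact hM y (Ico_subset_Icc_self hy)

theorem deriv_periodic {f : ℝ → ℝ} {c : ℝ} (hp : Function.Periodic f c) :
    Function.Periodic (deriv f) c := by
  intro x
  rw [← deriv_comp_add_const]
  congr 1
  ext y
  exact hp y

/-- The model profile of period one. -/
noncomputable def waveProfile (s : ℝ) : ℝ :=
  2 + Real.smoothTransition (1 / 2 + Real.sin (2 * Real.pi * s))

theorem contDiff_waveProfile : ContDiff ℝ (⊤ : ℕ∞) waveProfile := by
  unfold waveProfile
  refine contDiff_const.add (Real.smoothTransition.contDiff.comp ?_)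
  exact contDiff_const.add (Real.contDiff_sin.comp (contDiff_const.mul contDiff_id))

/-- Half a period changes the sign of the sine, hence reflects the argument of the smooth transition
about `1/2`; the transition and its reflection add up to `1`. This symmetry also yields periodicity,
and the plateau `2` from the plateau `3`. -/
theorem waveProfile_half (s : ℝ) : waveProfile s + waveProfile (s + 1 / 2) = 5 := by
  unfold waveProfile
  have e : Real.sin (2 * Real.pi * (s + 1 / 2)) = -Real.sin (2 * Real.pi * s) := by
    rw [← Real.sin_add_pi]
    congr 1
    ring
  have := smoothTransition_add_symm (1 / 2 + Real.sin (2 * Real.pi * s))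
  rw [e]
  have e2 : (1 / 2 + -Real.sin (2 * Real.pi * s))
      = 1 - (1 / 2 + Real.sin (2 * Real.pi * s)) := by ring
  rw [e2]
  linarith

theorem waveProfile_periodic : Function.Periodic waveProfile 1 := by
  intro s
  have h1 := waveProfile_half s
  have h2 := waveProfile_half (s + 1 / 2)
  rw [show s + 1 / 2 + 1 / 2 = s + 1 by ring] at h2
  linarith

theorem waveProfile_three {s : ℝ} (h1 : 1 / 12 ≤ s) (h2 : s ≤ 5 / 12) : waveProfile s = 3 := by
  have hpi := Real.pi_pos
  have hs : 1 / 2 ≤ Real.sin (2 * Real.pi * s) := by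
    rw [← Real.sin_pi_div_six]
    rcases le_total s (1 / 4) with h | h
    · apply Real.sin_le_sin_of_le_of_le_pi_div_two <;> nlinarith
    · rw [← Real.sin_pi_sub (2 * Real.pi * s)]
      apply Real.sin_le_sin_of_le_of_le_pi_div_two <;> nlinarith
  unfold waveProfile
  rw [Real.smoothTransition.one_of_one_le (by linarith)]
  norm_num

/-- Stretching the model profile to period `T` divides its derivatives by `T` and `T²`, so a long
period makes it slow without changing its values. -/
theorem exists_isProfile (T₀ : ℝ) : ∃ T h, T₀ ≤ T ∧ IsProfile h T := by
  have c0 := contDiff_waveProfile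
  have c1 : ContDiff ℝ (⊤ : ℕ∞) (deriv waveProfile) := (contDiff_infty_iff_deriv.1 c0).2
  have c2 : ContDiff ℝ (⊤ : ℕ∞) (deriv (deriv waveProfile)) := (contDiff_infty_iff_deriv.1 c1).2
  have p1 := deriv_periodic waveProfile_periodic
  obtain ⟨M, hM⟩ := exists_bound_of_periodic c1.continuous p1
  obtain ⟨M', hM'⟩ := exists_bound_of_periodic c2.continuous (deriv_periodic p1)
  -- `T ≥ 2M` gives `M/T ≤ 1/2`; `T ≥ 1` together with `T ≥ 2M'` gives `M'/T² ≤ 1/2`.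
  set T := max (max T₀ 1) (max (2 * M) (2 * M')) with hT
  have hT1 : 1 ≤ T := (le_max_right _ _).trans (le_max_left _ _)
  have hT0 : 0 < T := by linarith
  have hTM : 2 * M ≤ T := (le_max_left _ _).trans (le_max_right _ _)
  have hTM' : 2 * M' ≤ T := (le_max_right _ _).trans (le_max_right _ _)
  have d1 : deriv (fun t => waveProfile (T⁻¹ * t)) = fun t => T⁻¹ * deriv waveProfile (T⁻¹ * t) := by
    ext t
    rw [deriv_comp_mul_left, smul_eq_mul]
  have d2 : deriv (deriv (fun t => waveProfile (T⁻¹ * t))) =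
      fun t => T⁻¹ * (T⁻¹ * deriv (deriv waveProfile) (T⁻¹ * t)) := by
    ext t
    rw [d1, deriv_const_mul_field, deriv_comp_mul_left, smul_eq_mul]
  refine ⟨T, fun t => waveProfile (T⁻¹ * t), (le_max_left _ _).trans (le_max_left _ _), ?_⟩
  refine ⟨⟨c0.comp (contDiff_const.mul contDiff_id), ?_, ?_, ?_, ?_⟩, hT0, ?_, ?_, ?_, ?_⟩
  · intro t
    have := Real.smoothTransition.nonneg (1 / 2 + Real.sin (2 * Real.pi * (T⁻¹ * t)))
    simp only [waveProfile]
    linarith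
  · intro t
    have := Real.smoothTransition.le_one (1 / 2 + Real.sin (2 * Real.pi * (T⁻¹ * t)))
    simp only [waveProfile]
    linarith
  · intro t
    rw [d1]
    simp only
    rw [abs_mul, abs_of_pos (inv_pos.2 hT0), inv_mul_le_iff₀ hT0]
    linarith [hM (T⁻¹ * t)]
  · intro t
    rw [d2]
    simp only
    rw [abs_mul, abs_mul, abs_of_pos (inv_pos.2 hT0), inv_mul_le_iff₀ hT0, inv_mul_le_iff₀ hT0]
    nlinarith [hM' (T⁻¹ * t)]
  · intro t
    simp only
    rw [mul_add, inv_mul_cancel₀ hT0.ne', waveProfile_periodic]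
  · intro t
    have := waveProfile_half (T⁻¹ * t)
    rw [← this]
    congr 2
    field_simp
  · intro t ht
    refine waveProfile_three ?_ ?_
    · rw [le_inv_mul_iff₀ hT0]; linarith [ht.1]
    · rw [inv_mul_le_iff₀ hT0]; linarith [ht.2]
  · intro t ht
    have h1 := waveProfile_half (T⁻¹ * t - 1 / 2)
    rw [sub_add_cancel, waveProfile_three] at h1
    · linarith
    · have : 7 / 12 ≤ T⁻¹ * t := by rw [le_inv_mul_iff₀ hT0]; linarith [ht.1]
      linarith
    · have : T⁻¹ * t ≤ 11 / 12 := by rw [inv_mul_le_iff₀ hT0]; linarith [ht.2]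
      linarith

end Profile

/-! ### The scalar density `E² h(log E)` and its strong convexity -/

section Density

variable {h : ℝ → ℝ} {T : ℝ}

/-- The density `E^2 h(log E)`. -/
noncomputable def logDensity (h : ℝ → ℝ) (E : ℝ) : ℝ := E ^ 2 * h (Real.log E)

/-- The coefficient `k = 2 h + h'`, for which `E k(log E)` is the derivative of `logDensity`. -/
noncomputable def logCoef (h : ℝ → ℝ) (t : ℝ) : ℝ := 2 * h t + deriv h t

theorem IsSlow.hasDerivAt (hh : IsSlow h) (t : ℝ) : HasDerivAt h (deriv h t) t :=
  (hh.smooth.differentiable (by simp) t).hasDerivAt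

theorem IsSlow.contDiff_deriv (hh : IsSlow h) : ContDiff ℝ (⊤ : ℕ∞) (deriv h) :=
  (contDiff_infty_iff_deriv.1 hh.smooth).2

theorem IsSlow.contDiff_logCoef (hh : IsSlow h) : ContDiff ℝ (⊤ : ℕ∞) (logCoef h) :=
  (contDiff_const.mul hh.smooth).add hh.contDiff_deriv

theorem IsSlow.logCoef_bounds (hh : IsSlow h) (t : ℝ) : 2 ≤ logCoef h t ∧ logCoef h t ≤ 7 := by
  have h1 := hh.two_le t
  have h2 := hh.le_three t
  have h3 := abs_le.1 (hh.deriv_le t)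
  unfold logCoef
  constructor <;> linarith [h3.1, h3.2]

theorem IsSlow.abs_logCoef_le (hh : IsSlow h) (t : ℝ) : |logCoef h t| ≤ 7 := by
  have := hh.logCoef_bounds t
  rw [abs_le]
  constructor <;> linarith [this.1, this.2]

theorem IsSlow.comp_add_const (hh : IsSlow h) (c : ℝ) : IsSlow (fun t => h (t + c)) := by
  have d1 : deriv (fun t => h (t + c)) = fun t => deriv h (t + c) := by
    ext t; rw [deriv_comp_add_const]
  refine ⟨hh.smooth.comp (contDiff_id.add contDiff_const), fun t => hh.two_le _,
    fun t => hh.le_three _, fun t => ?_, fun t => ?_⟩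
  · rw [d1]; exact hh.deriv_le _
  · rw [d1, deriv_comp_add_const]; exact hh.deriv2_le _

theorem logCoef_comp_add_const (c t : ℝ) :
    logCoef (fun t => h (t + c)) t = logCoef h (t + c) := by
  unfold logCoef
  rw [deriv_comp_add_const]

theorem IsSlow.logDensity_bounds (hh : IsSlow h) (E : ℝ) :
    2 * E ^ 2 ≤ logDensity h E ∧ logDensity h E ≤ 3 * E ^ 2 := by
  unfold logDensity
  have h1 := hh.two_le (Real.log E)
  have h2 := hh.le_three (Real.log E)
  constructor <;> nlinarith [sq_nonneg E]

theorem IsSlow.hasDerivAt_logDensity (hh : IsSlow h) (E : ℝ) :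
    HasDerivAt (logDensity h) (E * logCoef h (Real.log E)) E := by
  rcases eq_or_ne E 0 with rfl | hE
  -- At `E = 0` the formula cannot come from the product rule; the bound `0 ≤ Ψ(E) ≤ 3E²` alone
  -- gives the derivative `0`.
  · rw [zero_mul]
    have : logDensity h =O[𝓝 0] fun E => E ^ 2 := by
      refine Asymptotics.IsBigO.of_bound 3 (Eventually.of_forall fun E => ?_)
      have := hh.logDensity_bounds E
      rw [Real.norm_eq_abs, Real.norm_eq_abs, abs_of_nonneg (by nlinarith [sq_nonneg E]),
        abs_of_nonneg (sq_nonneg E)]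
      exact this.2
    have h0 : logDensity h 0 = 0 := by simp [logDensity]
    rw [hasDerivAt_iff_isLittleO_nhds_zero]
    simp only [zero_add, h0, sub_zero, smul_zero]
    exact this.trans_isLittleO (by
      simpa using Asymptotics.isLittleO_pow_id (𝕜 := ℝ) (n := 2) (by norm_num))
  · have h1 := ((hasDerivAt_id E).pow 2).mul ((hh.hasDerivAt (Real.log E)).comp E
      (Real.hasDerivAt_log hE))
    refine h1.congr_deriv ?_
    simp only [logCoef, id, Function.comp]
    field_simp
    simp
    ring

theorem IsSlow.hasDerivAt_flux (hh : IsSlow h) {E : ℝ} (hE : E ≠ 0) :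
    HasDerivAt (fun E => E * logCoef h (Real.log E))
      (2 * h (Real.log E) + 3 * deriv h (Real.log E) + deriv (deriv h) (Real.log E)) E := by
  have h2 : HasDerivAt (deriv h) (deriv (deriv h) (Real.log E)) (Real.log E) :=
    (hh.contDiff_deriv.differentiable (by simp) _).hasDerivAt
  have h3 : HasDerivAt (logCoef h) (2 * deriv h (Real.log E) + deriv (deriv h) (Real.log E))
      (Real.log E) := ((hh.hasDerivAt _).const_mul 2).add h2
  have h1 := (hasDerivAt_id E).mul (h3.comp E (Real.hasDerivAt_log hE))
  refine h1.congr_deriv ?_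
  simp only [logCoef, id, Function.comp]
  field_simp
  ring

theorem IsSlow.continuous_flux (hh : IsSlow h) :
    Continuous (fun E => E * logCoef h (Real.log E)) := by
  rw [continuous_iff_continuousAt]
  intro E
  rcases eq_or_ne E 0 with rfl | hE
  · unfold ContinuousAt
    simp only [zero_mul]
    refine squeeze_zero_norm (a := fun E => |E| * 7) (fun E => ?_) ?_
    · rw [Real.norm_eq_abs, abs_mul]
      gcongr
      exact hh.abs_logCoef_le _
    · have : Continuous fun E : ℝ => |E| * 7 := by fun_prop
      simpa using this.tendsto 0
  · exact (hh.hasDerivAt_flux hE).continuousAt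

theorem IsSlow.contDiff_logDensity (hh : IsSlow h) : ContDiff ℝ 1 (logDensity h) := by
  rw [contDiff_one_iff_deriv]
  refine ⟨fun E => (hh.hasDerivAt_logDensity E).differentiableAt, ?_⟩
  have : deriv (logDensity h) = fun E => E * logCoef h (Real.log E) :=
    funext fun E => (hh.hasDerivAt_logDensity E).deriv
  rw [this]
  exact hh.continuous_flux

/-- The derivative is `2h + 3h' + h'' - 2 ≥ 4 - 3/2 - 1/2 - 2 = 0`; this is where the bounds `1/2`
on the derivatives of the profile are used up. -/
theorem IsSlow.monotoneOn_flux (hh : IsSlow h) :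
    MonotoneOn (fun E => E * logCoef h (Real.log E) - 2 * E) (Ici 0) := by
  have hd : ∀ E ∈ interior (Ici (0 : ℝ)), HasDerivAt (fun E => E * logCoef h (Real.log E) - 2 * E)
      (2 * h (Real.log E) + 3 * deriv h (Real.log E) + deriv (deriv h) (Real.log E) - 2) E := by
    intro E hE
    rw [interior_Ici] at hE
    have := (hh.hasDerivAt_flux (ne_of_gt hE)).sub ((hasDerivAt_id E).const_mul 2)
    exact this.congr_deriv (by simp)
  refine monotoneOn_of_deriv_nonneg (convex_Ici 0)
    (hh.continuous_flux.sub (continuous_const.mul continuous_id)).continuousOn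
    (fun E hE => (hd E hE).differentiableAt.differentiableWithinAt) fun E hE => ?_
  rw [(hd E hE).deriv]
  have h1 := hh.two_le (Real.log E)
  have h2 := abs_le.1 (hh.deriv_le (Real.log E))
  have h3 := abs_le.1 (hh.deriv2_le (Real.log E))
  linarith [h2.1, h3.1]

theorem IsSlow.convexOn_logDensity_sub (hh : IsSlow h) :
    ConvexOn ℝ (Ici 0) (fun E => logDensity h E - E ^ 2) := by
  have hd : ∀ E, HasDerivAt (fun E => logDensity h E - E ^ 2)
      (E * logCoef h (Real.log E) - 2 * E) E := fun E => by
    have := (hh.hasDerivAt_logDensity E).sub ((hasDerivAt_id E).pow 2)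
    exact this.congr_deriv (by simp)
  have hde : deriv (fun E => logDensity h E - E ^ 2) =
      fun E => E * logCoef h (Real.log E) - 2 * E := funext fun E => (hd E).deriv
  refine MonotoneOn.convexOn_of_deriv (convex_Ici 0)
    (fun E _ => (hd E).continuousAt.continuousWithinAt)
    (fun E _ => (hd E).differentiableAt.differentiableWithinAt) ?_
  rw [hde]
  exact hh.monotoneOn_flux.mono interior_subset

theorem IsSlow.strictConvexOn_logDensity (hh : IsSlow h) :
    StrictConvexOn ℝ (Ici 0) (logDensity h) := by
  have h1 : StrictConvexOn ℝ (Ici (0 : ℝ)) (fun E => E ^ 2) := by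
    have := (Even.strictConvexOn_pow (n := 2) even_two two_ne_zero)
    exact this.subset (subset_univ _) (convex_Ici 0)
  have := hh.convexOn_logDensity_sub.add_strictConvexOn h1
  refine this.congr fun E _ => ?_
  simp

/-- Strong convexity of the density. -/
theorem IsSlow.tangent_le (hh : IsSlow h) {a b : ℝ} (ha : 0 ≤ a) (hb : 0 ≤ b) :
    logDensity h a + a * logCoef h (Real.log a) * (b - a) + (b - a) ^ 2 ≤ logDensity h b := by
  have hd : HasDerivAt (fun E => logDensity h E - E ^ 2)
      (a * logCoef h (Real.log a) - 2 * a) a := by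
    have := (hh.hasDerivAt_logDensity a).sub ((hasDerivAt_id a).pow 2)
    exact this.congr_deriv (by simp)
  have hc := hh.convexOn_logDensity_sub
  rcases lt_trichotomy a b with hab | rfl | hab
  · have := hc.le_slope_of_hasDerivAt ha hb hab hd
    rw [slope_def_field, le_div_iff₀ (by linarith)] at this
    nlinarith
  · simp
  · have := hc.slope_le_of_hasDerivAt hb ha hab hd
    rw [slope_def_field, div_le_iff₀ (by linarith)] at this
    nlinarith

end Density

/-! ### The density as a function of the gradient -/

section VectorDensity

variable {d : ℕ} {h : ℝ → ℝ} {T : ℝ}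

/-- The rescaled density of the gradient, `e^{-2t} Ψ(e^t |ξ|)`. -/
noncomputable def dens (h : ℝ → ℝ) (t : ℝ) (ξ : Euc d) : ℝ := ‖ξ‖ ^ 2 * h (t + Real.log ‖ξ‖)

/-- The derivative of `dens`. -/
noncomputable def flux (h : ℝ → ℝ) (t : ℝ) (ξ : Euc d) : Euc d :=
  logCoef h (t + Real.log ‖ξ‖) • ξ

theorem dens_eq_logDensity (t : ℝ) (ξ : Euc d) :
    dens h t ξ = logDensity (fun s => h (s + t)) ‖ξ‖ := by
  simp [dens, logDensity, add_comm]

/-- The logarithm turns the scaling by `λ` into a translation of the profile by `log λ`. -/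
theorem logDensity_mul {lam : ℝ} (hl : 0 < lam) (ξ : Euc d) :
    logDensity h (lam * ‖ξ‖) = lam ^ 2 * dens h (Real.log lam) ξ := by
  unfold logDensity dens
  rcases eq_or_ne ξ 0 with rfl | hξ
  · simp
  · rw [Real.log_mul hl.ne' (norm_ne_zero_iff.2 hξ)]
    ring

theorem IsSlow.dens_bounds (hh : IsSlow h) (t : ℝ) (ξ : Euc d) :
    2 * ‖ξ‖ ^ 2 ≤ dens h t ξ ∧ dens h t ξ ≤ 3 * ‖ξ‖ ^ 2 := by
  rw [dens_eq_logDensity]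
  exact (hh.comp_add_const t).logDensity_bounds _

theorem IsSlow.dens_nonneg (hh : IsSlow h) (t : ℝ) (ξ : Euc d) : 0 ≤ dens h t ξ :=
  le_trans (by positivity) (hh.dens_bounds t ξ).1

theorem IsSlow.continuous_dens (hh : IsSlow h) (t : ℝ) :
    Continuous (dens h t : Euc d → ℝ) := by
  have : (dens h t : Euc d → ℝ) = fun ξ => logDensity (fun s => h (s + t)) ‖ξ‖ :=
    funext fun ξ => dens_eq_logDensity t ξ
  rw [this]
  exact (hh.comp_add_const t).contDiff_logDensity.continuous.comp continuous_norm

theorem IsSlow.norm_flux_le (hh : IsSlow h) (t : ℝ) (ξ : Euc d) : ‖flux h t ξ‖ ≤ 7 * ‖ξ‖ := by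
  unfold flux
  rw [norm_smul, Real.norm_eq_abs]
  gcongr
  exact hh.abs_logCoef_le _

theorem IsSlow.continuous_vflux (hh : IsSlow h) (t : ℝ) :
    Continuous (flux h t : Euc d → Euc d) := by
  rw [continuous_iff_continuousAt]
  intro ξ
  rcases eq_or_ne ξ 0 with rfl | hξ
  · unfold ContinuousAt
    have h0 : flux h t (0 : Euc d) = 0 := by simp [flux]
    rw [h0]
    refine squeeze_zero_norm (fun ξ => hh.norm_flux_le t ξ) ?_
    have : Continuous fun ξ : Euc d => 7 * ‖ξ‖ := by fun_prop
    simpa using this.tendsto 0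
  · unfold flux
    have h1 : ContinuousAt (fun ξ : Euc d => t + Real.log ‖ξ‖) ξ :=
      continuousAt_const.add (continuous_norm.continuousAt.log (norm_ne_zero_iff.2 hξ))
    have h2 : ContinuousAt (fun ξ : Euc d => logCoef h (t + Real.log ‖ξ‖)) ξ :=
      ContinuousAt.comp (f := fun ξ : Euc d => t + Real.log ‖ξ‖) (g := logCoef h)
        hh.contDiff_logCoef.continuous.continuousAt h1
    exact h2.smul continuousAt_id

/-- Apply the scalar strong convexity to the norms. Passing from norms to vectors costs `(k -
2)(‖ξ‖‖η‖ - ⟪ξ, η⟫)`, which is nonnegative by Cauchy-Schwarz and `k ≥ 2`. -/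
theorem IsSlow.dens_tangent_le (hh : IsSlow h) (t : ℝ) (ξ η : Euc d) :
    dens h t η + inner ℝ (flux h t η) (ξ - η) + ‖ξ - η‖ ^ 2 ≤ dens h t ξ := by
  have key := (hh.comp_add_const t).tangent_le (norm_nonneg η) (norm_nonneg ξ)
  rw [← dens_eq_logDensity, ← dens_eq_logDensity, logCoef_comp_add_const] at key
  have hk := (hh.logCoef_bounds (t + Real.log ‖η‖)).1
  unfold flux
  rw [inner_smul_left, inner_sub_right, real_inner_self_eq_norm_sq, norm_sub_sq_real,
    real_inner_comm]
  rw [add_comm (Real.log ‖η‖)] at key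
  set k := logCoef h (t + Real.log ‖η‖)
  have hcs := real_inner_le_norm ξ η
  simp only [conj_trivial]
  nlinarith

/-- Average of the tangent inequalities at the midpoint towards both ends; the linear terms cancel.
-/
theorem IsSlow.dens_midpoint_le (hh : IsSlow h) (t : ℝ) (ξ η : Euc d) :
    dens h t ((1 / 2 : ℝ) • (ξ + η)) + ‖ξ - η‖ ^ 2 / 4 ≤ (dens h t ξ + dens h t η) / 2 := by
  have h1 := hh.dens_tangent_le t ξ ((1 / 2 : ℝ) • (ξ + η))
  have h2 := hh.dens_tangent_le t η ((1 / 2 : ℝ) • (ξ + η))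
  have e1 : ξ - (1 / 2 : ℝ) • (ξ + η) = (1 / 2 : ℝ) • (ξ - η) := by module
  have e2 : η - (1 / 2 : ℝ) • (ξ + η) = -((1 / 2 : ℝ) • (ξ - η)) := by module
  rw [e1] at h1
  rw [e2, inner_neg_right, norm_neg] at h2
  rw [norm_smul] at h1 h2
  norm_num [mul_pow] at h1 h2 ⊢
  linarith

/-- Two densities of the family add up to a multiple of the Dirichlet density. This is what
identifies a common weak limit as a harmonic gradient. -/
theorem IsProfile.dens_add_half (hh : IsProfile h T) (t : ℝ) (ξ : Euc d) :
    dens h t ξ + dens h (t + T / 2) ξ = 5 * ‖ξ‖ ^ 2 := by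
  have := hh.half (t + Real.log ‖ξ‖)
  unfold dens
  rw [← mul_add, show t + T / 2 + Real.log ‖ξ‖ = t + Real.log ‖ξ‖ + T / 2 by ring, this]
  ring

theorem IsProfile.dens_periodic (hh : IsProfile h T) (t : ℝ) (n : ℕ) (ξ : Euc d) :
    dens h (t + n * T) ξ = dens h t ξ := by
  unfold dens
  rw [show t + n * T + Real.log ‖ξ‖ = t + Real.log ‖ξ‖ + n * T by ring]
  rw [hh.periodic.nat_mul n]

end VectorDensity

/-! ### Uniform convexity of `|·|^q` -/

section PowerConvexity

variable {d : ℕ} {q : ℝ}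

theorem norm_midpoint_rpow_le (hq : 1 < q) (a b : Euc d) :
    ‖(1 / 2 : ℝ) • (a + b)‖ ^ q ≤ (‖a‖ ^ q + ‖b‖ ^ q) / 2 := by
  have h1 : ‖(1 / 2 : ℝ) • (a + b)‖ ≤ (1 / 2) * ‖a‖ + (1 / 2) * ‖b‖ := by
    rw [norm_smul]
    norm_num
    linarith [norm_add_le a b]
  have h2 := (strictConvexOn_rpow hq).convexOn.2 (norm_nonneg a) (norm_nonneg b)
    (show (0 : ℝ) ≤ 1 / 2 by norm_num) (show (0 : ℝ) ≤ 1 / 2 by norm_num) (by norm_num)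
  simp only [smul_eq_mul] at h2
  calc _ ≤ ((1 / 2) * ‖a‖ + (1 / 2) * ‖b‖) ^ q :=
        Real.rpow_le_rpow (norm_nonneg _) h1 (by linarith)
    _ ≤ _ := by linarith

/-- If the norms agree, strictness comes from the strict convexity of the Euclidean ball; otherwise
from that of the power. -/
theorem norm_midpoint_rpow_lt (hq : 1 < q) {a b : Euc d} (hab : a ≠ b) :
    ‖(1 / 2 : ℝ) • (a + b)‖ ^ q < (‖a‖ ^ q + ‖b‖ ^ q) / 2 := by
  have h1 : ‖(1 / 2 : ℝ) • (a + b)‖ ≤ (1 / 2) * ‖a‖ + (1 / 2) * ‖b‖ := by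
    rw [norm_smul]
    norm_num
    linarith [norm_add_le a b]
  rcases eq_or_ne ‖a‖ ‖b‖ with he | hne
  · have h3 : ‖(1 / 2 : ℝ) • (a + b)‖ < ‖a‖ := by
      have h5 : ‖a + b‖ < ‖a‖ + ‖b‖ := by
        refine lt_of_le_of_ne (norm_add_le a b) fun h => ?_
        have := (sameRay_iff_norm_add (x := a) (y := b)).2 h
        exact hab ((sameRay_iff_of_norm_eq he).1 this)
      rw [norm_smul]
      norm_num
      linarith
    have h4 := Real.rpow_lt_rpow (norm_nonneg _) h3 (by linarith : 0 < q)
    rw [← he]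
    linarith
  · have h2 := (strictConvexOn_rpow hq).2 (norm_nonneg a) (norm_nonneg b) hne
      (show (0 : ℝ) < 1 / 2 by norm_num) (show (0 : ℝ) < 1 / 2 by norm_num) (by norm_num)
    simp only [smul_eq_mul] at h2
    calc _ ≤ ((1 / 2) * ‖a‖ + (1 / 2) * ‖b‖) ^ q :=
          Real.rpow_le_rpow (norm_nonneg _) h1 (by linarith)
      _ < _ := by linarith

/-- Uniform convexity of the power `|·|^q`. -/
theorem exists_uniform_convexity (d : ℕ) (hq : 1 < q) {ε : ℝ} (hε : 0 < ε) :
    ∃ C : ℝ, 1 ≤ C ∧ ∀ a b : Euc d, ‖a - b‖ ^ q + C * ‖(1 / 2 : ℝ) • (a + b)‖ ^ q ≤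
      (C / 2 + ε) * (‖a‖ ^ q + ‖b‖ ^ q) := by
  have hq0 : 0 < q := by linarith
  have cont : ∀ f : Euc d × Euc d → Euc d, Continuous f → Continuous fun z => ‖f z‖ ^ q :=
    fun f hf => hf.norm.rpow_const fun _ => Or.inr hq0.le
  have c1 := cont _ continuous_fst
  have c2 := cont _ continuous_snd
  have c3 := cont (fun z => z.1 - z.2) (by fun_prop)
  have c4 := cont (fun z => (1 / 2 : ℝ) • (z.1 + z.2)) (by fun_prop)
  -- Normalized pairs that are not close. On this compact set the midpoint deficit has a positive
  -- minimum, so a large multiple of it dominates the difference.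
  set K : Set (Euc d × Euc d) := {z | ‖z.1‖ ^ q + ‖z.2‖ ^ q = 1 ∧ ε ≤ ‖z.1 - z.2‖ ^ q} with hK
  have hKc : IsCompact K := by
    refine Metric.isCompact_of_isClosed_isBounded ?_ ?_
    · exact (isClosed_eq (c1.add c2) continuous_const).inter (isClosed_le continuous_const c3)
    · refine (Metric.isBounded_closedBall (x := (0 : Euc d × Euc d)) (r := 1)).subset ?_
      rintro ⟨a, b⟩ ⟨h, -⟩
      have ha : 0 ≤ ‖a‖ ^ q := by positivity
      have hb : 0 ≤ ‖b‖ ^ q := by positivity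
      simp only at h
      rw [mem_closedBall_zero_iff, Prod.norm_def, max_le_iff]
      constructor
      · by_contra! hc
        have := Real.one_lt_rpow hc hq0
        linarith
      · by_contra! hc
        have := Real.one_lt_rpow hc hq0
        linarith
  have hC : ∃ C : ℝ, 1 ≤ C ∧ ∀ z ∈ K,
      ‖z.1 - z.2‖ ^ q + C * ‖(1 / 2 : ℝ) • (z.1 + z.2)‖ ^ q ≤ C / 2 := by
    rcases K.eq_empty_or_nonempty with he | hne
    · exact ⟨1, le_rfl, by simp [he]⟩
    obtain ⟨z0, hz0, hmin⟩ := hKc.exists_isMinOn hne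
      (f := fun z => 1 / 2 - ‖(1 / 2 : ℝ) • (z.1 + z.2)‖ ^ q) (continuous_const.sub c4).continuousOn
    obtain ⟨M, hM⟩ := hKc.exists_bound_of_continuousOn c3.continuousOn
    set δ := 1 / 2 - ‖(1 / 2 : ℝ) • (z0.1 + z0.2)‖ ^ q with hδ
    have hδ0 : 0 < δ := by
      have hne : z0.1 ≠ z0.2 := by
        intro he
        have := hz0.2
        rw [he, sub_self, norm_zero, Real.zero_rpow hq0.ne'] at this
        linarith
      have := norm_midpoint_rpow_lt hq hne
      rw [hz0.1] at this
      linarith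
    refine ⟨max 1 (M / δ), le_max_left _ _, fun z hz => ?_⟩
    have h1 : δ ≤ 1 / 2 - ‖(1 / 2 : ℝ) • (z.1 + z.2)‖ ^ q := hmin hz
    have h2 : ‖z.1 - z.2‖ ^ q ≤ M := (le_abs_self _).trans (hM z hz)
    have h3 : M / δ ≤ max 1 (M / δ) := le_max_right _ _
    rw [div_le_iff₀ hδ0] at h3
    have h4 : (0 : ℝ) < max 1 (M / δ) := lt_of_lt_of_le one_pos (le_max_left _ _)
    nlinarith
  obtain ⟨C, hC1, hCK⟩ := hC
  refine ⟨C, hC1, fun a b => ?_⟩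
  have unit : ∀ a b : Euc d, ‖a‖ ^ q + ‖b‖ ^ q = 1 →
      ‖a - b‖ ^ q + C * ‖(1 / 2 : ℝ) • (a + b)‖ ^ q ≤ C / 2 + ε := by
    intro a b hab
    -- Close pairs lie outside `K`: the difference is absorbed by `ε` and plain convexity handles
    -- the midpoint.
    by_cases h : ε ≤ ‖a - b‖ ^ q
    · linarith [hCK (a, b) ⟨hab, h⟩]
    · have := norm_midpoint_rpow_le hq a b
      rw [hab] at this
      push Not at h
      nlinarith
  set S := ‖a‖ ^ q + ‖b‖ ^ q with hS
  have ha : 0 ≤ ‖a‖ ^ q := by positivity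
  have hb : 0 ≤ ‖b‖ ^ q := by positivity
  rcases (add_nonneg ha hb).eq_or_lt with h0 | hpos
  · have ha0 : ‖a‖ ^ q = 0 := by linarith
    have hb0 : ‖b‖ ^ q = 0 := by linarith
    rw [Real.rpow_eq_zero (norm_nonneg _) hq0.ne', norm_eq_zero] at ha0 hb0
    simp [ha0, hb0, Real.zero_rpow hq0.ne', hS]
  -- All terms are homogeneous of degree `q`; the factor `σ` normalizes the pair.
  · set σ := S ^ (-(1 / q)) with hσ
    have hσ0 : 0 < σ := Real.rpow_pos_of_pos hpos _
    have hσq : σ ^ q = S⁻¹ := by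
      rw [hσ, ← Real.rpow_mul hpos.le, show -(1 / q) * q = -1 by field_simp, Real.rpow_neg_one]
    have hn : ∀ x : Euc d, ‖σ • x‖ ^ q = S⁻¹ * ‖x‖ ^ q := fun x => by
      rw [norm_smul, Real.norm_of_nonneg hσ0.le, Real.mul_rpow hσ0.le (norm_nonneg _), hσq]
    have := unit (σ • a) (σ • b) (by rw [hn, hn, ← mul_add]; exact inv_mul_cancel₀ hpos.ne')
    rw [← smul_sub, ← smul_add, smul_comm, hn, hn] at this
    have h2 := mul_le_mul_of_nonneg_left this hpos.le
    have e : S * (S⁻¹ * ‖a - b‖ ^ q + C * (S⁻¹ * ‖(1 / 2 : ℝ) • (a + b)‖ ^ q)) =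
      ‖a - b‖ ^ q + C * ‖(1 / 2 : ℝ) • (a + b)‖ ^ q := by
      have : S ≠ 0 := hpos.ne'
      field_simp
    rw [e] at h2
    linarith

end PowerConvexity

/-! ### `L^s` norms as lower integrals -/

section LpNorms

variable {α E : Type*} [MeasurableSpace α] {μ : Measure α} [NormedAddCommGroup E]

theorem eLpNorm_ofReal_eq {s : ℝ} (hs : 0 < s) (f : α → E) :
    eLpNorm f (ENNReal.ofReal s) μ = (∫⁻ x, ENNReal.ofReal (‖f x‖ ^ s) ∂μ) ^ (1 / s) := by
  rw [eLpNorm_eq_lintegral_rpow_enorm_toReal (by simpa using hs) ENNReal.ofReal_ne_top,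
    ENNReal.toReal_ofReal hs.le]
  congr 2
  ext x
  rw [← ofReal_norm, ENNReal.ofReal_rpow_of_nonneg (norm_nonneg _) hs.le]

theorem memLp_ofReal_iff {s : ℝ} (hs : 0 < s) {f : α → E} (hf : AEStronglyMeasurable f μ) :
    MemLp f (ENNReal.ofReal s) μ ↔ ∫⁻ x, ENNReal.ofReal (‖f x‖ ^ s) ∂μ < ⊤ := by
  unfold MemLp
  rw [eLpNorm_ofReal_eq hs]
  constructor
  · rintro ⟨-, h⟩
    by_contra hc
    rw [not_lt, top_le_iff] at hc
    rw [hc, ENNReal.top_rpow_of_pos (by positivity)] at h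
    exact lt_irrefl _ h
  · intro h
    exact ⟨hf, ENNReal.rpow_lt_top_of_nonneg (by positivity) h.ne⟩

end LpNorms

/-! ### The energy of a gradient field and its quantitative convexity -/

section Energy

variable {h : ℝ → ℝ} {q t κ r : ℝ}

/-- The normalized energy of a gradient field, with weight `κ` on the inner disk. -/
noncomputable def gradEnergy (h : ℝ → ℝ) (q t κ r : ℝ) (G : Euc 2 → Euc 2) : ℝ≥0∞ :=
  (∫⁻ x in annulus r, ENNReal.ofReal (dens h t (G x))) +
    ENNReal.ofReal κ * ∫⁻ x in disk 1, ENNReal.ofReal (‖G x‖ ^ q)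

theorem measurableSet_annulus (r : ℝ) : MeasurableSet (annulus r) :=
  (Metric.isOpen_ball.sdiff isClosed_closure).measurableSet

theorem isOpen_annulus (r : ℝ) : IsOpen (annulus r) := Metric.isOpen_ball.sdiff isClosed_closure

theorem mem_annulus {x : Euc 2} : x ∈ annulus r ↔ 1 < ‖x‖ ∧ ‖x‖ < r := by
  rw [annulus, disk, disk, closure_ball _ one_ne_zero, Set.mem_sdiff, mem_ball_zero_iff,
    mem_closedBall_zero_iff, not_le, and_comm]

/-- The unit circle, which belongs to neither region, is a null set. -/
theorem restrict_disk_eq (hr : 1 < r) :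
    (volume : Measure (Euc 2)).restrict (disk r) =
      volume.restrict (annulus r) + volume.restrict (disk 1) := by
  have hd : Disjoint (annulus r) (disk 1) :=
    disjoint_sdiff_left.mono_right subset_closure
  rw [← Measure.restrict_union hd Metric.isOpen_ball.measurableSet]
  refine Measure.restrict_congr_set ?_
  have hs : (volume : Measure (Euc 2)) (Metric.sphere 0 1) = 0 :=
    Measure.addHaar_sphere volume 0 1
  have : ∀ᵐ x ∂(volume : Measure (Euc 2)), x ∉ Metric.sphere (0 : Euc 2) 1 :=
    measure_eq_zero_iff_ae_notMem.1 hs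
  filter_upwards [this] with x hx
  rw [mem_sphere_zero_iff_norm] at hx
  apply propext
  change x ∈ disk r ↔ x ∈ annulus r ∪ disk 1
  rw [mem_union, mem_annulus, mem_ball_zero_iff, mem_ball_zero_iff]
  constructor
  · intro h
    rcases lt_or_gt_of_ne hx with h1 | h1
    · exact Or.inr h1
    · exact Or.inl ⟨h1, h⟩
  · rintro (h | h)
    · exact h.2
    · linarith

instance isFiniteMeasure_disk (r : ℝ) :
    IsFiniteMeasure ((volume : Measure (Euc 2)).restrict (disk r)) :=
  ⟨by rw [Measure.restrict_apply_univ]; exact measure_ball_lt_top⟩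

theorem annulus_subset (r : ℝ) : annulus r ⊆ disk r := sdiff_subset

theorem disk_one_subset (hr : 1 < r) : disk 1 ⊆ disk r := Metric.ball_subset_ball hr.le

instance isFiniteMeasure_annulus (r : ℝ) :
    IsFiniteMeasure ((volume : Measure (Euc 2)).restrict (annulus r)) :=
  ⟨by rw [Measure.restrict_apply_univ]
      exact (measure_mono (annulus_subset r)).trans_lt measure_ball_lt_top⟩

theorem restrict_annulus_le (r : ℝ) :
    (volume : Measure (Euc 2)).restrict (annulus r) ≤ volume.restrict (disk r) :=
  Measure.restrict_mono (annulus_subset r) le_rfl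

theorem restrict_disk_one_le (hr : 1 < r) :
    (volume : Measure (Euc 2)).restrict (disk 1) ≤ volume.restrict (disk r) :=
  Measure.restrict_mono (disk_one_subset hr) le_rfl

theorem eLpNorm_disk_le (hr : 1 < r) {p : ℝ≥0∞} (hp : 1 ≤ p) {f : Euc 2 → Euc 2}
    (hf : AEStronglyMeasurable f (volume.restrict (disk r))) :
    eLpNorm f p (volume.restrict (disk r)) ≤
      eLpNorm f p (volume.restrict (annulus r)) + eLpNorm f p (volume.restrict (disk 1)) := by
  have h1 : f =ᵐ[volume.restrict (disk r)] (annulus r).indicator f + (disk 1).indicator f := by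
    have hd : Disjoint (annulus r) (disk 1) := disjoint_sdiff_left.mono_right subset_closure
    have hm : ∀ᵐ x ∂(volume.restrict (disk r)), x ∈ annulus r ∪ disk 1 := by
      rw [restrict_disk_eq hr, ae_add_measure_iff]
      exact ⟨(ae_restrict_mem (measurableSet_annulus r)).mono fun x hx => Or.inl hx,
        (ae_restrict_mem Metric.isOpen_ball.measurableSet).mono fun x hx => Or.inr hx⟩
    filter_upwards [hm] with x hx
    exact (indicator_of_mem hx f).symm.trans (congrFun (indicator_union_of_disjoint hd f) x)
  rw [eLpNorm_congr_ae h1]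
  refine (eLpNorm_add_le (hf.indicator (measurableSet_annulus r))
    (hf.indicator Metric.isOpen_ball.measurableSet) hp).trans ?_
  rw [eLpNorm_indicator_eq_eLpNorm_restrict (measurableSet_annulus r),
    eLpNorm_indicator_eq_eLpNorm_restrict Metric.isOpen_ball.measurableSet,
    Measure.restrict_restrict (measurableSet_annulus r),
    Measure.restrict_restrict Metric.isOpen_ball.measurableSet,
    inter_eq_left.2 (annulus_subset r), inter_eq_left.2 (disk_one_subset hr)]

/-- Control of the `L^{min(2,q)}` norm by the `L^2` norm on the annulus and the `L^q` norm on the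
inner disk. -/
theorem exists_eLpNorm_min_le (hr : 1 < r) (hq : 1 < q) :
    ∃ c : ℝ≥0∞, c ≠ ⊤ ∧ ∀ f : Euc 2 → Euc 2,
      AEStronglyMeasurable f (volume.restrict (disk r)) →
      eLpNorm f (ENNReal.ofReal (min 2 q)) (volume.restrict (disk r)) ≤
        c * ((∫⁻ x in annulus r, ENNReal.ofReal (‖f x‖ ^ 2)) ^ (1 / (2 : ℝ)) +
          (∫⁻ x in disk 1, ENNReal.ofReal (‖f x‖ ^ q)) ^ (1 / q)) := by
  have hm0 : 1 < min 2 q := lt_min (by norm_num) hq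
  set c1 : ℝ≥0∞ := (volume.restrict (annulus r)) univ ^
    (1 / (ENNReal.ofReal (min 2 q)).toReal - 1 / (ENNReal.ofReal 2).toReal) with hc1
  set c2 : ℝ≥0∞ := (volume.restrict (disk 1)) univ ^
    (1 / (ENNReal.ofReal (min 2 q)).toReal - 1 / (ENNReal.ofReal q).toReal) with hc2
  have fin : ∀ {s : ℝ}, min 2 q ≤ s →
      0 ≤ 1 / (ENNReal.ofReal (min 2 q)).toReal - 1 / (ENNReal.ofReal s).toReal := by
    intro s hs
    rw [ENNReal.toReal_ofReal (by linarith), ENNReal.toReal_ofReal (by linarith), sub_nonneg]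
    exact one_div_le_one_div_of_le (by linarith) hs
  have h1 : c1 ≠ ⊤ := ENNReal.rpow_ne_top_of_nonneg (fin (min_le_left _ _)) (measure_ne_top _ _)
  have h2 : c2 ≠ ⊤ := ENNReal.rpow_ne_top_of_nonneg (fin (min_le_right _ _)) (measure_ne_top _ _)
  refine ⟨c1 + c2, ENNReal.add_ne_top.2 ⟨h1, h2⟩, fun f hf => ?_⟩
  refine (eLpNorm_disk_le hr (by simpa using ENNReal.ofReal_le_ofReal hm0.le) hf).trans ?_
  have e1 := eLpNorm_le_eLpNorm_mul_rpow_measure_univ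
    (ENNReal.ofReal_le_ofReal (min_le_left 2 q)) (hf.mono_measure (restrict_annulus_le r))
  have e2 := eLpNorm_le_eLpNorm_mul_rpow_measure_univ
    (ENNReal.ofReal_le_ofReal (min_le_right 2 q)) (hf.mono_measure (restrict_disk_one_le hr))
  rw [← hc1, eLpNorm_ofReal_eq (s := 2) (by norm_num)] at e1
  rw [← hc2, eLpNorm_ofReal_eq (s := q) (by linarith)] at e2
  simp only [Real.rpow_two] at e1
  rw [mul_add]
  refine add_le_add (e1.trans ?_) (e2.trans ?_)
  · rw [mul_comm]; gcongr; exact le_self_add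
  · rw [mul_comm]; gcongr; exact le_add_self

theorem gradEnergy_congr (hr : 1 < r) {G G' : Euc 2 → Euc 2}
    (hG : G =ᵐ[volume.restrict (disk r)] G') :
    gradEnergy h q t κ r G = gradEnergy h q t κ r G' := by
  unfold gradEnergy
  have h1 := ae_mono (restrict_annulus_le r) hG
  have h2 := ae_mono (restrict_disk_one_le hr) hG
  congr 1
  · refine lintegral_congr_ae ?_
    filter_upwards [h1] with x hx
    rw [hx]
  · congr 1
    refine lintegral_congr_ae ?_
    filter_upwards [h2] with x hx
    rw [hx]

theorem IsSlow.lintegral_sq_le (hh : IsSlow h) (G : Euc 2 → Euc 2) :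
    ∫⁻ x in annulus r, ENNReal.ofReal (‖G x‖ ^ 2) ≤ gradEnergy h q t κ r G := by
  refine le_trans (lintegral_mono fun x => ENNReal.ofReal_le_ofReal ?_) le_self_add
  nlinarith [(hh.dens_bounds t (G x)).1, sq_nonneg ‖G x‖]

theorem lintegral_rpow_le (hκ : 0 < κ) (G : Euc 2 → Euc 2) :
    ∫⁻ x in disk 1, ENNReal.ofReal (‖G x‖ ^ q) ≤
      ENNReal.ofReal κ⁻¹ * gradEnergy h q t κ r G := by
  refine le_trans ?_ (mul_le_mul_right (le_add_self (a := ENNReal.ofReal κ *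
    ∫⁻ x in disk 1, ENNReal.ofReal (‖G x‖ ^ q))) _)
  rw [← mul_assoc, ← ENNReal.ofReal_mul (inv_nonneg.2 hκ.le), inv_mul_cancel₀ hκ.ne',
    ENNReal.ofReal_one, one_mul]

/-- Quantitative convexity of the energy. -/
theorem gradEnergy_midpoint_le (hh : IsSlow h) (hr : 1 < r) (hκ : 0 < κ) {ε C : ℝ}
    (hε : 0 < ε) (hC : 1 ≤ C)
    (hconv : ∀ a b : Euc 2, ‖a - b‖ ^ q + C * ‖(1 / 2 : ℝ) • (a + b)‖ ^ q ≤
      (C / 2 + ε) * (‖a‖ ^ q + ‖b‖ ^ q))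
    {G G' : Euc 2 → Euc 2} (hG : AEStronglyMeasurable G (volume.restrict (disk r)))
    (hG' : AEStronglyMeasurable G' (volume.restrict (disk r))) :
    gradEnergy h q t κ r (fun x => (1 / 2 : ℝ) • (G x + G' x)) +
      (ENNReal.ofReal (1 / 4) * (∫⁻ x in annulus r, ENNReal.ofReal (‖G x - G' x‖ ^ 2)) +
        ENNReal.ofReal (κ / C) * ∫⁻ x in disk 1, ENNReal.ofReal (‖G x - G' x‖ ^ q)) ≤
      ENNReal.ofReal (1 / 2 + ε / C) * (gradEnergy h q t κ r G + gradEnergy h q t κ r G') := by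
  have hC0 : 0 < C := by linarith
  have mB := hG.mono_measure (restrict_annulus_le r)
  have mB' := hG'.mono_measure (restrict_annulus_le r)
  have mA := hG.mono_measure (restrict_disk_one_le hr)
  have mA' := hG'.mono_measure (restrict_disk_one_le hr)
  have am : ∀ {ν : Measure (Euc 2)} {F : Euc 2 → Euc 2}, AEStronglyMeasurable F ν →
      AEMeasurable (fun x => ENNReal.ofReal (‖F x‖ ^ q)) ν := fun hF =>
    (hF.norm.aemeasurable.pow_const q).ennreal_ofReal
  have am2 : ∀ {ν : Measure (Euc 2)} {F : Euc 2 → Euc 2}, AEStronglyMeasurable F ν →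
      AEMeasurable (fun x => ENNReal.ofReal (‖F x‖ ^ 2)) ν := fun hF =>
    (hF.norm.aemeasurable.pow_const 2).ennreal_ofReal
  have ad : ∀ {ν : Measure (Euc 2)} {F : Euc 2 → Euc 2}, AEStronglyMeasurable F ν →
      AEMeasurable (fun x => ENNReal.ofReal (dens h t (F x))) ν := fun hF =>
    ((hh.continuous_dens t).measurable.comp_aemeasurable hF.aemeasurable).ennreal_ofReal
  have mBd : AEMeasurable (fun x => ENNReal.ofReal (‖G x - G' x‖ ^ 2))
      (volume.restrict (annulus r)) := am2 (mB.sub mB')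
  have mAd : AEMeasurable (fun x => ENNReal.ofReal (‖G x - G' x‖ ^ q))
      (volume.restrict (disk 1)) := am (mA.sub mA')
  have hB : (∫⁻ x in annulus r, ENNReal.ofReal (dens h t ((1 / 2 : ℝ) • (G x + G' x)))) +
      ENNReal.ofReal (1 / 4) * (∫⁻ x in annulus r, ENNReal.ofReal (‖G x - G' x‖ ^ 2)) ≤
      ENNReal.ofReal (1 / 2 + ε / C) * ((∫⁻ x in annulus r, ENNReal.ofReal (dens h t (G x))) +
        ∫⁻ x in annulus r, ENNReal.ofReal (dens h t (G' x))) := by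
    rw [← lintegral_const_mul' _ _ ENNReal.ofReal_ne_top, ← lintegral_add_right'
      _ (mBd.const_mul _), ← lintegral_add_right' _ (ad mB'),
      ← lintegral_const_mul' _ _ ENNReal.ofReal_ne_top]
    refine lintegral_mono fun x => ?_
    have n1 := hh.dens_nonneg t (G x)
    have n2 := hh.dens_nonneg t (G' x)
    have hεC : 0 ≤ ε / C := by positivity
    simp only
    rw [← ENNReal.ofReal_mul (by norm_num), ← ENNReal.ofReal_add (hh.dens_nonneg t _)
      (by positivity), ← ENNReal.ofReal_add n1 n2, ← ENNReal.ofReal_mul (by positivity)]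
    refine ENNReal.ofReal_le_ofReal ?_
    have := hh.dens_midpoint_le t (G x) (G' x)
    nlinarith
  have hA : (∫⁻ x in disk 1, ENNReal.ofReal (‖(1 / 2 : ℝ) • (G x + G' x)‖ ^ q)) +
      ENNReal.ofReal (1 / C) * (∫⁻ x in disk 1, ENNReal.ofReal (‖G x - G' x‖ ^ q)) ≤
      ENNReal.ofReal (1 / 2 + ε / C) * ((∫⁻ x in disk 1, ENNReal.ofReal (‖G x‖ ^ q)) +
        ∫⁻ x in disk 1, ENNReal.ofReal (‖G' x‖ ^ q)) := by
    rw [← lintegral_const_mul' _ _ ENNReal.ofReal_ne_top, ← lintegral_add_right'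
      _ (mAd.const_mul _), ← lintegral_add_right' _ (am mA'),
      ← lintegral_const_mul' _ _ ENNReal.ofReal_ne_top]
    refine lintegral_mono fun x => ?_
    simp only
    rw [← ENNReal.ofReal_mul (by positivity), ← ENNReal.ofReal_add (by positivity)
      (by positivity), ← ENNReal.ofReal_add (by positivity) (by positivity),
      ← ENNReal.ofReal_mul (by positivity)]
    refine ENNReal.ofReal_le_ofReal ?_
    have := hconv (G x) (G' x)
    have h2 := mul_le_mul_of_nonneg_left this (inv_nonneg.2 hC0.le)
    calc _ = C⁻¹ * (‖G x - G' x‖ ^ q + C * ‖(1 / 2 : ℝ) • (G x + G' x)‖ ^ q) := by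
          field_simp; ring
      _ ≤ _ := h2
      _ = _ := by field_simp
  have hA' := mul_le_mul_right hA (ENNReal.ofReal κ)
  refine le_trans (le_of_eq ?_) ((add_le_add hB hA').trans (le_of_eq ?_))
  · unfold gradEnergy
    rw [div_eq_mul_one_div κ C, ENNReal.ofReal_mul hκ.le]
    ring
  · unfold gradEnergy
    ring

/-- Near-minimizers of the energy are close to each other. -/
theorem exists_delta_close (hh : IsSlow h) (hr : 1 < r) (hq : 1 < q) (hκ : 0 < κ) {I : ℝ}
    (hI : 0 ≤ I) {η : ℝ} (hη : 0 < η) : ∃ δ : ℝ, 0 < δ ∧ ∀ G G' : Euc 2 → Euc 2,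
      AEStronglyMeasurable G (volume.restrict (disk r)) →
      AEStronglyMeasurable G' (volume.restrict (disk r)) →
      ENNReal.ofReal I ≤ gradEnergy h q t κ r (fun x => (1 / 2 : ℝ) • (G x + G' x)) →
      gradEnergy h q t κ r G ≤ ENNReal.ofReal (I + δ) →
      gradEnergy h q t κ r G' ≤ ENNReal.ofReal (I + δ) →
      (∫⁻ x in annulus r, ENNReal.ofReal (‖G x - G' x‖ ^ 2)) ≤ ENNReal.ofReal η ∧
      (∫⁻ x in disk 1, ENNReal.ofReal (‖G x - G' x‖ ^ q)) ≤ ENNReal.ofReal η := by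
  -- The convexity inequality will bound the weighted difference by `δ + 2(ε/C)(I + δ)`. Removing
  -- the weights multiplies this by `4` or by `C/κ`; in the second case `C` cancels in the `ε` term.
  -- Hence `ε` can be fixed before `C`, and `δ` after it, each accounting for `η/2`.
  set ε := η / (4 * (I + 1) * (4 + κ⁻¹)) with hεd
  have hκi : 0 < κ⁻¹ := inv_pos.2 hκ
  have hε : 0 < ε := by positivity
  obtain ⟨C, hC, hconv⟩ := exists_uniform_convexity 2 hq hε
  have hC0 : 0 < C := by linarith
  have hCκ : 0 < C * κ⁻¹ := by positivity
  set δ := min 1 (η / (2 * (4 + C * κ⁻¹))) with hδd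
  have hδ : 0 < δ := lt_min one_pos (by positivity)
  have hδ1 : δ ≤ 1 := min_le_left _ _
  have hδ2 : δ * (4 + C * κ⁻¹) ≤ η / 2 := by
    have : δ ≤ η / (2 * (4 + C * κ⁻¹)) := min_le_right _ _
    rw [le_div_iff₀ (by positivity)] at this
    linarith
  have hε2 : 2 * ε * (I + 1) * (4 + κ⁻¹) = η / 2 := by
    rw [hεd]
    field_simp
    norm_num
  refine ⟨δ, hδ, fun G G' hG hG' hI1 h1 h2 => ?_⟩
  set X := ENNReal.ofReal (1 / 4) * (∫⁻ x in annulus r, ENNReal.ofReal (‖G x - G' x‖ ^ 2)) +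
        ENNReal.ofReal (κ / C) * ∫⁻ x in disk 1, ENNReal.ofReal (‖G x - G' x‖ ^ q) with hX
  have key := gradEnergy_midpoint_le (t := t) hh hr hκ hε hC hconv hG hG'
  have hXle : X ≤ ENNReal.ofReal (δ + 2 * (ε / C) * (I + δ)) := by
    have h3 : ENNReal.ofReal I + X ≤
        ENNReal.ofReal I + ENNReal.ofReal (δ + 2 * (ε / C) * (I + δ)) := by
      calc ENNReal.ofReal I + X ≤ _ := add_le_add hI1 le_rfl
        _ ≤ _ := key
        _ ≤ ENNReal.ofReal (1 / 2 + ε / C) * (ENNReal.ofReal (I + δ) + ENNReal.ofReal (I + δ)) :=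
          mul_le_mul_right (add_le_add h1 h2) _
        _ = _ := by
          rw [← ENNReal.ofReal_add (by positivity) (by positivity),
            ← ENNReal.ofReal_mul (by positivity), ← ENNReal.ofReal_add hI (by positivity)]
          congr 1
          ring
    exact (ENNReal.add_le_add_iff_left ENNReal.ofReal_ne_top).1 h3
  have hεC : ε / C ≤ ε := div_le_self hε.le hC
  constructor
  · have h4 : ENNReal.ofReal (1 / 4) * (∫⁻ x in annulus r, ENNReal.ofReal (‖G x - G' x‖ ^ 2)) ≤
        ENNReal.ofReal (δ + 2 * (ε / C) * (I + δ)) := le_self_add.trans hXle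
    have h5 := mul_le_mul_right h4 (ENNReal.ofReal 4)
    rw [← mul_assoc, ← ENNReal.ofReal_mul (by norm_num), ← ENNReal.ofReal_mul (by norm_num),
      show (4 : ℝ) * (1 / 4) = 1 by norm_num, ENNReal.ofReal_one, one_mul] at h5
    refine h5.trans (ENNReal.ofReal_le_ofReal ?_)
    have h6 : ε / C * (I + δ) ≤ ε * (I + 1) := by gcongr
    have h7 : 0 ≤ 2 * ε * (I + 1) * κ⁻¹ := by positivity
    nlinarith
  · have h4 : ENNReal.ofReal (κ / C) * (∫⁻ x in disk 1, ENNReal.ofReal (‖G x - G' x‖ ^ q)) ≤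
        ENNReal.ofReal (δ + 2 * (ε / C) * (I + δ)) := le_add_self.trans hXle
    have h5 := mul_le_mul_right h4 (ENNReal.ofReal (C / κ))
    rw [← mul_assoc, ← ENNReal.ofReal_mul (by positivity), ← ENNReal.ofReal_mul (by positivity),
      show C / κ * (κ / C) = 1 by field_simp, ENNReal.ofReal_one, one_mul] at h5
    refine h5.trans (ENNReal.ofReal_le_ofReal ?_)
    have h6 : C / κ * (δ + 2 * (ε / C) * (I + δ)) =
        δ * (C * κ⁻¹) + 2 * ε * (I + δ) * κ⁻¹ := by
      field_simp
    have h7 : 2 * ε * (I + δ) * κ⁻¹ ≤ 2 * ε * (I + 1) * κ⁻¹ := by gcongr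
    have h8 : 0 ≤ 2 * ε * (I + 1) := by positivity
    nlinarith

end Energy

/-! ### Existence and uniqueness of minimizing gradient fields -/

section Minimizers

variable {h : ℝ → ℝ} {q t κ r : ℝ}

theorem one_le_ofReal_min (hq : 1 < q) : 1 ≤ ENNReal.ofReal (min 2 q) := by
  have hm0 : 1 < min 2 q := lt_min (by norm_num) hq
  simpa using ENNReal.ofReal_le_ofReal hm0.le

theorem ofReal_min_le_two (q : ℝ) : ENNReal.ofReal (min 2 q) ≤ 2 := by
  simp

/-- Closeness in `L^2` on the annulus and in `L^q` on the inner disk gives closeness in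
`L^{min(2,q)}`. -/
theorem exists_eta_eLpNorm_le (hr : 1 < r) (hq : 1 < q) {ε : ℝ≥0∞} (hε : 0 < ε) :
    ∃ η : ℝ, 0 < η ∧ ∀ f : Euc 2 → Euc 2,
      AEStronglyMeasurable f (volume.restrict (disk r)) →
      (∫⁻ x in annulus r, ENNReal.ofReal (‖f x‖ ^ 2)) ≤ ENNReal.ofReal η →
      (∫⁻ x in disk 1, ENNReal.ofReal (‖f x‖ ^ q)) ≤ ENNReal.ofReal η →
      eLpNorm f (ENNReal.ofReal (min 2 q)) (volume.restrict (disk r)) ≤ ε := by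
  obtain ⟨c, hc, hle⟩ := exists_eLpNorm_min_le hr hq
  have hlim : Tendsto (fun η : ℝ => c * (ENNReal.ofReal η ^ (1 / (2 : ℝ)) +
      ENNReal.ofReal η ^ (1 / q))) (𝓝[>] 0) (𝓝 0) := by
    have h1 : Continuous fun η : ℝ => c * (ENNReal.ofReal η ^ (1 / (2 : ℝ)) +
        ENNReal.ofReal η ^ (1 / q)) := by
      refine ENNReal.continuous_const_mul hc |>.comp ?_
      exact ((ENNReal.continuous_rpow_const).comp ENNReal.continuous_ofReal).add
        ((ENNReal.continuous_rpow_const).comp ENNReal.continuous_ofReal)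
    have h2 := h1.tendsto 0
    rw [ENNReal.ofReal_zero, ENNReal.zero_rpow_of_pos (by norm_num),
      ENNReal.zero_rpow_of_pos (by positivity), add_zero, mul_zero] at h2
    exact h2.mono_left nhdsWithin_le_nhds
  obtain ⟨η, hη, hη0⟩ := (((ENNReal.tendsto_nhds_zero.1 hlim) ε hε).and
    self_mem_nhdsWithin).exists
  refine ⟨η, hη0, fun f hf h1 h2 => (hle f hf).trans (le_trans ?_ hη)⟩
  gcongr

/-- `G` minimizes the energy in the class of the gradients `c + ∇u`. -/
def IsGradMinimizer (h : ℝ → ℝ) (q t κ r : ℝ) (c : Euc 2) (u : Euc 2 → ℝ) (G : Euc 2 → Euc 2) :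
    Prop :=
  IsW0 (ENNReal.ofReal (min 2 q)) (disk r) u (fun x => G x - c) ∧
    ∀ u' G', IsW0 (ENNReal.ofReal (min 2 q)) (disk r) u' (fun x => G' x - c) →
      gradEnergy h q t κ r G ≤ gradEnergy h q t κ r G'

theorem aestronglyMeasurable_of_isW0_sub {p : ℝ≥0∞} {c : Euc 2} {u : Euc 2 → ℝ}
    {G : Euc 2 → Euc 2} (h : IsW0 p (disk r) u (fun x => G x - c)) :
    AEStronglyMeasurable G (volume.restrict (disk r)) := by
  have := h.2.1.1.add (aestronglyMeasurable_const (b := c))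
  refine this.congr (Eventually.of_forall fun x => ?_)
  simp

theorem isW0_midpoint {p : ℝ≥0∞} (hp : 1 ≤ p) {c : Euc 2} {u u' : Euc 2 → ℝ}
    {G G' : Euc 2 → Euc 2} (h : IsW0 p (disk r) u (fun x => G x - c))
    (h' : IsW0 p (disk r) u' (fun x => G' x - c)) :
    IsW0 p (disk r) (fun x => (1 / 2) * (u x + u' x))
      (fun x => (1 / 2 : ℝ) • (G x + G' x) - c) := by
  have := (h.add hp h').const_mul (1 / 2)
  convert! this using 2 with x
  module

theorem isW0_zero {p : ℝ≥0∞} : IsW0 p (disk r) (fun _ => 0) (fun _ => 0) := by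
  have : IsTest (disk r) (fun _ => 0) := by
    refine ⟨contDiff_const, HasCompactSupport.zero, ?_⟩
    rw [show tsupport (fun _ : Euc 2 => (0 : ℝ)) = ∅ from tsupport_eq_empty_iff.2 rfl]
    exact empty_subset _
  have h0 : gradient (fun _ : Euc 2 => (0 : ℝ)) = fun _ => 0 := by
    ext1 x
    simp [gradient]
  have := isW0_of_isTest (p := p) this
  rwa [h0] at this

theorem gradEnergy_const_lt_top (c : Euc 2) :
    gradEnergy h q t κ r (fun _ => c) < ⊤ := by
  unfold gradEnergy
  rw [lintegral_const, lintegral_const]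
  refine ENNReal.add_lt_top.2 ⟨ENNReal.mul_lt_top ENNReal.ofReal_lt_top (measure_lt_top _ _),
    ENNReal.mul_lt_top ENNReal.ofReal_lt_top
      (ENNReal.mul_lt_top ENNReal.ofReal_lt_top (measure_lt_top _ _))⟩

theorem liminf_add_liminf_le (f g : ℕ → ℝ≥0∞) :
    liminf f atTop + liminf g atTop ≤ liminf (fun n => f n + g n) atTop := by
  rw [liminf_eq_iSup_iInf_of_nat, liminf_eq_iSup_iInf_of_nat, liminf_eq_iSup_iInf_of_nat,
    ENNReal.iSup_add_iSup_of_monotone]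
  · refine iSup_mono fun n => le_iInf₂ fun i hi => ?_
    exact add_le_add (iInf₂_le i hi) (iInf₂_le i hi)
  · exact fun a b hab => le_iInf₂ fun i hi => iInf₂_le i (hab.trans hi)
  · exact fun a b hab => le_iInf₂ fun i hi => iInf₂_le i (hab.trans hi)

/-- Fatou on each region; almost everywhere convergence suffices because minimizing sequences
converge strongly. -/
theorem gradEnergy_le_liminf (hh : IsSlow h) (hr : 1 < r) (hq : 1 < q)
    {G : ℕ → Euc 2 → Euc 2} {G₀ : Euc 2 → Euc 2}
    (hG : ∀ n, AEStronglyMeasurable (G n) (volume.restrict (disk r)))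
    (hlim : ∀ᵐ x ∂(volume.restrict (disk r)), Tendsto (fun n => G n x) atTop (𝓝 (G₀ x)))
    {M : ℕ → ℝ≥0∞} {I : ℝ≥0∞} (hM : ∀ n, gradEnergy h q t κ r (G n) ≤ M n)
    (hMI : Tendsto M atTop (𝓝 I)) :
    gradEnergy h q t κ r G₀ ≤ I := by
  have hB := ae_mono (restrict_annulus_le r) hlim
  have hA := ae_mono (restrict_disk_one_le hr) hlim
  have mB : ∀ n, AEMeasurable (fun x => ENNReal.ofReal (dens h t (G n x)))
      (volume.restrict (annulus r)) := fun n =>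
    ((hh.continuous_dens t).measurable.comp_aemeasurable
      ((hG n).mono_measure (restrict_annulus_le r)).aemeasurable).ennreal_ofReal
  have mA : ∀ n, AEMeasurable (fun x => ENNReal.ofReal (‖G n x‖ ^ q))
      (volume.restrict (disk 1)) := fun n =>
    ((((hG n).mono_measure (restrict_disk_one_le hr)).norm).aemeasurable.pow_const q).ennreal_ofReal
  have l1 : ∫⁻ x in annulus r, ENNReal.ofReal (dens h t (G₀ x)) ≤
      liminf (fun n => ∫⁻ x in annulus r, ENNReal.ofReal (dens h t (G n x))) atTop := by
    refine le_trans (lintegral_mono_ae ?_) (lintegral_liminf_le' mB)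
    filter_upwards [hB] with x hx
    refine le_of_eq (Tendsto.liminf_eq ?_).symm
    exact (ENNReal.continuous_ofReal.tendsto _).comp (((hh.continuous_dens t).tendsto _).comp hx)
  have l2 : ∫⁻ x in disk 1, ENNReal.ofReal (‖G₀ x‖ ^ q) ≤
      liminf (fun n => ∫⁻ x in disk 1, ENNReal.ofReal (‖G n x‖ ^ q)) atTop := by
    refine le_trans (lintegral_mono_ae ?_) (lintegral_liminf_le' mA)
    filter_upwards [hA] with x hx
    refine le_of_eq (Tendsto.liminf_eq ?_).symm
    refine (ENNReal.continuous_ofReal.tendsto _).comp ?_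
    exact (hx.norm).rpow_const (Or.inr (by linarith))
  have l3 : ENNReal.ofReal κ * ∫⁻ x in disk 1, ENNReal.ofReal (‖G₀ x‖ ^ q) ≤
      liminf (fun n => ENNReal.ofReal κ * ∫⁻ x in disk 1, ENNReal.ofReal (‖G n x‖ ^ q)) atTop := by
    rw [ENNReal.liminf_const_mul_of_ne_top ENNReal.ofReal_ne_top]
    gcongr
  calc gradEnergy h q t κ r G₀ ≤ _ := add_le_add l1 l3
    _ ≤ liminf (fun n => gradEnergy h q t κ r (G n)) atTop :=
        liminf_add_liminf_le _ _
    _ ≤ liminf M atTop := liminf_le_liminf (Eventually.of_forall hM)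
    _ = I := hMI.liminf_eq

/-- Existence of minimizers. -/
theorem exists_isGradMinimizer (hh : IsSlow h) (hr : 1 < r) (hq : 1 < q) (hκ : 0 < κ)
    (c : Euc 2) : ∃ u G, IsGradMinimizer h q t κ r c u G := by
  set p := ENNReal.ofReal (min 2 q) with hp
  have hp1 : 1 ≤ p := one_le_ofReal_min hq
  set S : Set ℝ≥0∞ := {e | ∃ u G, IsW0 p (disk r) u (fun x => G x - c) ∧
    gradEnergy h q t κ r G = e} with hS
  have hmem : gradEnergy h q t κ r (fun _ => c) ∈ S := by
    refine ⟨fun _ => 0, fun _ => c, ?_, rfl⟩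
    simpa using isW0_zero
  set I := sInf S with hI
  have hIt : I ≠ ⊤ := ((sInf_le hmem).trans_lt (gradEnergy_const_lt_top c)).ne
  have hIr : ENNReal.ofReal I.toReal = I := ENNReal.ofReal_toReal hIt
  have hseq : ∀ n : ℕ, ∃ u G, IsW0 p (disk r) u (fun x => G x - c) ∧
      gradEnergy h q t κ r G ≤ ENNReal.ofReal (I.toReal + 1 / (n + 1)) := by
    intro n
    have hlt : I < ENNReal.ofReal (I.toReal + 1 / ((n : ℝ) + 1)) := by
      conv_lhs => rw [← hIr]
      rw [ENNReal.ofReal_lt_ofReal_iff (by positivity)]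
      have : 0 < 1 / ((n : ℝ) + 1) := by positivity
      linarith
    obtain ⟨e, ⟨u, G, hu, rfl⟩, he⟩ := sInf_lt_iff.1 hlt
    exact ⟨u, G, hu, he.le⟩
  choose u G hu hE using hseq
  have hm : ∀ n, AEStronglyMeasurable (G n) (volume.restrict (disk r)) := fun n =>
    aestronglyMeasurable_of_isW0_sub (hu n)
  -- A minimizing sequence is Cauchy: the midpoint of two members is again a competitor, so its
  -- energy is at least the infimum, and near-minimizers with such a midpoint are close.
  have hcau : ∀ ε : ℝ≥0∞, 0 < ε → ∃ N, ∀ n ≥ N, ∀ k ≥ N,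
      eLpNorm ((fun x => G n x - c) - fun x => G k x - c) p (volume.restrict (disk r)) ≤ ε := by
    intro ε hε
    obtain ⟨η, hη, hle⟩ := exists_eta_eLpNorm_le hr hq hε
    obtain ⟨δ, hδ, hclose⟩ := exists_delta_close (t := t) hh hr hq hκ
      (ENNReal.toReal_nonneg (a := I)) hη
    obtain ⟨N, hN⟩ := exists_nat_one_div_lt hδ
    refine ⟨N, fun n hn k hk => ?_⟩
    have hb : ∀ n ≥ N, gradEnergy h q t κ r (G n) ≤ ENNReal.ofReal (I.toReal + δ) := by
      intro n hn
      refine (hE n).trans (ENNReal.ofReal_le_ofReal ?_)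
      have : 1 / ((n : ℝ) + 1) ≤ 1 / ((N : ℝ) + 1) := by
        apply one_div_le_one_div_of_le (by positivity)
        have : (N : ℝ) ≤ n := by exact_mod_cast hn
        linarith
      linarith
    obtain ⟨c1, c2⟩ := hclose (G n) (G k) (hm n) (hm k) (by
      rw [hIr]
      exact sInf_le ⟨_, _, isW0_midpoint hp1 (hu n) (hu k), rfl⟩) (hb n hn) (hb k hk)
    have := hle (fun x => G n x - G k x) ((hm n).sub (hm k)) c1 c2
    refine le_trans (le_of_eq ?_) this
    congr 1
    ext1 x
    simp
  obtain ⟨H, hH, hGH⟩ := exists_tendsto_eLpNorm_of_cauchy hp1 (fun n => (hu n).2.1) hcau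
  -- By the Poincaré inequality the functions converge along with their gradients, so the limit
  -- field is still a gradient with the right boundary values.
  obtain ⟨u₀, hu₀⟩ := IsW0.exists_limit Metric.isBounded_ball hp1 (ofReal_min_le_two q) hu hH hGH
  obtain ⟨ns, hns, hae⟩ := (tendstoInMeasure_of_tendsto_eLpNorm (zero_lt_one.trans_le hp1).ne'
    (fun n => (hu n).2.1.1) hH.1 hGH).exists_seq_tendsto_ae
  have hM : Tendsto (fun n => ENNReal.ofReal (I.toReal + 1 / ((ns n : ℝ) + 1))) atTop (𝓝 I) := by
    have h1 : Tendsto (fun n : ℕ => I.toReal + 1 / ((n : ℝ) + 1)) atTop (𝓝 (I.toReal + 0)) :=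
      tendsto_one_div_add_atTop_nhds_zero_nat.const_add _
    have h2 := ENNReal.tendsto_ofReal h1
    rw [add_zero, hIr] at h2
    exact h2.comp hns.tendsto_atTop
  have hle : gradEnergy h q t κ r (fun x => H x + c) ≤ I := by
    refine gradEnergy_le_liminf hh hr hq (fun n => hm (ns n)) ?_ (fun n => hE (ns n)) hM
    filter_upwards [hae] with x hx
    simpa using hx.add_const c
  refine ⟨u₀, fun x => H x + c, by simp only [add_sub_cancel_right]; exact hu₀, fun u' G' h' => hle.trans ?_⟩
  exact sInf_le ⟨u', G', h', rfl⟩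

/-- Uniqueness of minimizers. -/
theorem IsGradMinimizer.unique (hh : IsSlow h) (hr : 1 < r) (hq : 1 < q) (hκ : 0 < κ)
    {c : Euc 2} {u u' : Euc 2 → ℝ} {G G' : Euc 2 → Euc 2}
    (h1 : IsGradMinimizer h q t κ r c u G) (h2 : IsGradMinimizer h q t κ r c u' G') :
    u =ᵐ[volume.restrict (disk r)] u' := by
  set p := ENNReal.ofReal (min 2 q) with hp
  have hp1 : 1 ≤ p := one_le_ofReal_min hq
  have hm := aestronglyMeasurable_of_isW0_sub h1.1
  have hm' := aestronglyMeasurable_of_isW0_sub h2.1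
  have hEt : gradEnergy h q t κ r G ≠ ⊤ := by
    refine ((h1.2 (fun _ => 0) (fun _ => c) ?_).trans_lt (gradEnergy_const_lt_top c)).ne
    simpa using isW0_zero
  have hEr := ENNReal.ofReal_toReal hEt
  have he : gradEnergy h q t κ r G' = gradEnergy h q t κ r G :=
    le_antisymm (h2.2 _ _ h1.1) (h1.2 _ _ h2.1)
  -- Two exact minimizers are near-minimizers for every `δ`, so their distance is below every `ε`.
  have hz : eLpNorm (fun x => G x - G' x) p (volume.restrict (disk r)) = 0 := by
    rw [← nonpos_iff_eq_zero]
    refine le_of_forall_gt_imp_ge_of_dense fun ε hε => ?_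
    obtain ⟨η, hη, hle⟩ := exists_eta_eLpNorm_le hr hq hε
    obtain ⟨δ, hδ, hclose⟩ := exists_delta_close (t := t) hh hr hq hκ
      (ENNReal.toReal_nonneg (a := gradEnergy h q t κ r G)) hη
    have hb : gradEnergy h q t κ r G ≤
        ENNReal.ofReal ((gradEnergy h q t κ r G).toReal + δ) := by
      conv_lhs => rw [← hEr]
      exact ENNReal.ofReal_le_ofReal (by linarith)
    obtain ⟨c1, c2⟩ := hclose G G' hm hm' (by
      rw [hEr]
      exact h1.2 _ _ (isW0_midpoint hp1 h1.1 h2.1)) hb (he.trans_le hb)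
    exact hle _ (hm.sub hm') c1 c2
  obtain ⟨C, hC⟩ := IsW0.exists_poincare (Ω := disk r) Metric.isBounded_ball hp1
    (ofReal_min_le_two q)
  have hd := h1.1.sub hp1 h2.1
  have h3 := hC _ _ hd
  have e : (fun x => G x - c - (G' x - c)) = fun x => G x - G' x := by
    ext1 x; simp
  rw [e, hz, mul_zero, nonpos_iff_eq_zero, eLpNorm_eq_zero_iff hd.1.1
    (zero_lt_one.trans_le hp1).ne'] at h3
  filter_upwards [h3] with x hx
  exact sub_eq_zero.1 hx

end Minimizers

/-! ### From the normalized problem to gradient fields -/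

section Translation

variable {h : ℝ → ℝ} {q r lam : ℝ}

/-- The slope of the boundary data. -/
noncomputable def slope₀ (r : ℝ) : ℝ := 7 + 12 / r ^ 2

/-- The first coordinate vector. -/
noncomputable def e₀ : Euc 2 := EuclideanSpace.single 0 1

/-- The gradient of the boundary data. -/
noncomputable def bdryGrad (r : ℝ) : Euc 2 := slope₀ r • e₀

theorem inner_e₀ (x : Euc 2) : inner ℝ e₀ x = x 0 := by
  simp [e₀, EuclideanSpace.inner_single_left]

theorem norm_e₀ : ‖e₀‖ = 1 := by simp [e₀]

theorem contDiff_bdryData (r : ℝ) {n : WithTop ℕ∞} : ContDiff ℝ n (bdryData r) := by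
  unfold bdryData
  fun_prop

theorem gradient_bdryData (r : ℝ) : gradient (bdryData r) = fun _ => bdryGrad r := by
  ext1 x
  refine ext_inner_right ℝ fun w => ?_
  rw [inner_gradient]
  have : bdryData r = fun x => slope₀ r * (EuclideanSpace.proj (0 : Fin 2) : Euc 2 →L[ℝ] ℝ) x := rfl
  rw [this, fderiv_const_mul (ContinuousLinearMap.differentiableAt _), ContinuousLinearMap.fderiv,
    bdryGrad, inner_smul_left, inner_e₀]
  simp

theorem hasWeakGrad_of_sub {p : ℝ≥0∞} (hp : 1 ≤ p) {v : Euc 2 → ℝ} {G : Euc 2 → Euc 2}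
    (h : IsW0 p (disk r) (fun x => v x - bdryData r x) (fun x => G x - bdryGrad r)) :
    HasWeakGrad (disk r) v G := by
  have h1 := (h.hasWeakGrad hp).add (hasWeakGrad_gradient (Ω := disk r)
    (contDiff_bdryData r (n := 1)))
  simpa [gradient_bdryData] using h1

theorem weakGrad_ae_eq_of_sub {p : ℝ≥0∞} (hp : 1 ≤ p) {v : Euc 2 → ℝ} {G : Euc 2 → Euc 2}
    (h : IsW0 p (disk r) (fun x => v x - bdryData r x) (fun x => G x - bdryGrad r)) :
    weakGrad (disk r) v =ᵐ[volume.restrict (disk r)] G :=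
  (hasWeakGrad_of_sub hp h).weakGrad_ae_eq Metric.isOpen_ball

theorem memLp_bdryData (r : ℝ) (p : ℝ≥0∞) : MemLp (bdryData r) p (volume.restrict (disk r)) := by
  obtain ⟨C, hC⟩ := (isCompact_closedBall (0 : Euc 2) r).exists_bound_of_continuousOn
    (contDiff_bdryData r (n := 0)).continuous.continuousOn
  refine MemLp.of_bound (contDiff_bdryData r (n := 0)).continuous.aestronglyMeasurable C ?_
  filter_upwards [ae_restrict_mem Metric.isOpen_ball.measurableSet] with x hx
  exact hC x (Metric.ball_subset_closedBall hx)

/-- On a disk of finite measure both alternatives embed in the space of exponent `min 2 q`;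
conversely this exponent is `2` or `q`, which gives the corresponding alternative. The union of two
spaces thus becomes one affine space, where midpoints are available. -/
theorem admissible_iff (hq : 1 < q) (v : Euc 2 → ℝ) :
    Admissible 2 q (disk r) (bdryData r) v ↔
      IsW0 (ENNReal.ofReal (min 2 q)) (disk r) (fun x => v x - bdryData r x)
        (fun x => weakGrad (disk r) v x - bdryGrad r) := by
  have hp := one_le_ofReal_min hq
  constructor
  · rintro ⟨-, hv⟩
    have h0 : IsW0 (ENNReal.ofReal (min 2 q)) (disk r) (fun x => v x - bdryData r x)
        (weakGrad (disk r) fun x => v x - bdryData r x) := by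
      rcases hv with hv | hv
      · exact (hv.isW0 Metric.isOpen_ball).mono_exponent (ENNReal.ofReal_le_ofReal (min_le_left _ _))
      · exact (hv.isW0 Metric.isOpen_ball).mono_exponent
          (ENNReal.ofReal_le_ofReal (min_le_right _ _))
    refine h0.congr_grad ?_
    have h1 : IsW0 (ENNReal.ofReal (min 2 q)) (disk r) (fun x => v x - bdryData r x)
        (fun x => ((weakGrad (disk r) fun x => v x - bdryData r x) x + bdryGrad r)
          - bdryGrad r) := by
      simpa only [add_sub_cancel_right] using h0
    filter_upwards [weakGrad_ae_eq_of_sub hp h1] with x hx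
    rw [hx, add_sub_cancel_right]
  · intro h0
    have key : ∀ s : ℝ, 1 ≤ s →
        IsW0 (ENNReal.ofReal s) (disk r) (fun x => v x - bdryData r x)
        (fun x => weakGrad (disk r) v x - bdryGrad r) →
        MemW s (disk r) v ∧ MemW0 s (disk r) fun x => v x - bdryData r x := by
      intro s hs h1
      have hs' : 1 ≤ ENNReal.ofReal s := by simpa using ENNReal.ofReal_le_ofReal hs
      refine ⟨⟨?_, _, hasWeakGrad_of_sub hs' h1, ?_⟩, h1.memW0 Metric.isOpen_ball hs⟩
      · have := h1.1.add (memLp_bdryData r _)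
        refine this.ae_eq (Eventually.of_forall fun x => ?_)
        simp
      · have := h1.2.1.add (memLp_const (bdryGrad r))
        refine this.ae_eq (Eventually.of_forall fun x => ?_)
        simp
    rcases min_choice 2 q with hm | hm
    · rw [hm] at h0
      have := key 2 (by norm_num) h0
      exact ⟨Or.inl this.1, Or.inl this.2⟩
    · rw [hm] at h0
      have := key q hq.le h0
      exact ⟨Or.inr this.1, Or.inr this.2⟩

/-- After division by `λ²` the outer term keeps only the translation `log λ`, and the inner term
keeps the weight `λ^(q-2)`. -/
theorem energy2_eq (hl : 0 < lam) (v : Euc 2 → ℝ) :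
    energy2 q r (logDensity h) lam v =
      gradEnergy h q (Real.log lam) (lam ^ (q - 2)) r (weakGrad (disk r) v) := by
  have hl2 : lam ^ (2 : ℝ) = lam ^ 2 := Real.rpow_two lam
  unfold energy2 normEnergy gradEnergy outerDensity innerDensity
  rw [mul_add, ← lintegral_const_mul' _ _ ENNReal.ofReal_ne_top,
    ← lintegral_const_mul' _ _ ENNReal.ofReal_ne_top,
    ← lintegral_const_mul' _ _ ENNReal.ofReal_ne_top]
  congr 1
  · refine lintegral_congr fun x => ?_
    rw [← ENNReal.ofReal_mul (by positivity), logDensity_mul hl, hl2]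
    congr 1
    field_simp
  · refine lintegral_congr fun x => ?_
    rw [← ENNReal.ofReal_mul (by positivity), ← ENNReal.ofReal_mul (by positivity),
      Real.mul_rpow hl.le (norm_nonneg _), Real.rpow_sub hl]
    congr 1
    field_simp

/-- In the minimality test a competitor field is matched with the function obtained by adding the
boundary data; its chosen weak gradient agrees with the field almost everywhere, which the energy
does not see. -/
theorem isSolution2_iff (hr : 1 < r) (hq : 1 < q) (hl : 0 < lam) (v : Euc 2 → ℝ) :
    IsSolution2 q r (logDensity h) lam v ↔
      IsGradMinimizer h q (Real.log lam) (lam ^ (q - 2)) r (bdryGrad r)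
        (fun x => v x - bdryData r x) (weakGrad (disk r) v) := by
  have hp := one_le_ofReal_min hq
  have he : ∀ w, normEnergy 2 (disk r) (disk 1) (outerDensity (logDensity h)) (innerDensity q)
      lam w = gradEnergy h q (Real.log lam) (lam ^ (q - 2)) r (weakGrad (disk r) w) :=
    fun w => energy2_eq hl w
  unfold IsSolution2 IsNormSolution IsGradMinimizer
  rw [admissible_iff hq]
  refine and_congr_right fun _ => ?_
  constructor
  · intro hmin u' G' h'
    set w : Euc 2 → ℝ := fun x => u' x + bdryData r x with hw
    have h1 : IsW0 (ENNReal.ofReal (min 2 q)) (disk r) (fun x => w x - bdryData r x)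
        (fun x => G' x - bdryGrad r) := by
      simpa only [hw, add_sub_cancel_right] using h'
    have h2 := weakGrad_ae_eq_of_sub hp h1
    have h3 := hmin w ((admissible_iff hq w).2 (h1.congr_grad (by
      filter_upwards [h2] with x hx
      rw [hx])))
    rw [he, he, gradEnergy_congr hr h2] at h3
    exact h3
  · intro hmin w hw
    rw [he, he]
    exact hmin _ _ ((admissible_iff hq w).1 hw)

theorem exists_isSolution2 (hh : IsSlow h) (hr : 1 < r) (hq : 1 < q) (hl : 0 < lam) :
    ∃ v, IsSolution2 q r (logDensity h) lam v ∧
      ∀ w, IsSolution2 q r (logDensity h) lam w → w =ᵐ[volume.restrict (disk r)] v := by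
  have hp := one_le_ofReal_min hq
  have hκ : 0 < lam ^ (q - 2) := Real.rpow_pos_of_pos hl _
  obtain ⟨u, G, hu⟩ := exists_isGradMinimizer (t := Real.log lam) hh hr hq hκ (bdryGrad r)
  set v : Euc 2 → ℝ := fun x => u x + bdryData r x with hv
  have h1 : IsW0 (ENNReal.ofReal (min 2 q)) (disk r) (fun x => v x - bdryData r x)
      (fun x => G x - bdryGrad r) := by
    simpa only [hv, add_sub_cancel_right] using hu.1
  have h2 := weakGrad_ae_eq_of_sub hp h1
  have hsol : IsSolution2 q r (logDensity h) lam v := by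
    rw [isSolution2_iff hr hq hl]
    refine ⟨h1.congr_grad ?_, fun u' G' h' => ?_⟩
    · filter_upwards [h2] with x hx
      rw [hx]
    · rw [gradEnergy_congr hr h2]
      exact hu.2 u' G' h'
  refine ⟨v, hsol, fun w hw => ?_⟩
  have := IsGradMinimizer.unique hh hr hq hκ ((isSolution2_iff hr hq hl w).1 hw)
    ((isSolution2_iff hr hq hl v).1 hsol)
  filter_upwards [this] with x hx
  linarith

/-- Minimizers are in `W^{1,2}` of the annulus. -/
theorem IsSolution2.memW (hh : IsSlow h) (hr : 1 < r) (hq : 1 < q) (hl : 0 < lam)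
    {v : Euc 2 → ℝ} (hv : IsSolution2 q r (logDensity h) lam v) : MemW 2 (annulus r) v := by
  have hp := one_le_ofReal_min hq
  have hm := (isSolution2_iff hr hq hl v).1 hv
  have hE : gradEnergy h q (Real.log lam) (lam ^ (q - 2)) r (weakGrad (disk r) v) < ⊤ := by
    refine (hm.2 (fun _ => 0) (fun _ => bdryGrad r) ?_).trans_lt (gradEnergy_const_lt_top _)
    simpa using isW0_zero
  have hmeas := aestronglyMeasurable_of_isW0_sub hm.1
  refine ⟨?_, weakGrad (disk r) v, (hasWeakGrad_of_sub hp hm.1).restrict (annulus_subset r), ?_⟩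
  · obtain ⟨C, hC⟩ := IsW0.exists_eLpNorm_two_le (Ω := disk r) Metric.isBounded_ball hp
    have h1 := hC _ _ hm.1
    have h2 : MemLp (fun x => v x - bdryData r x) 2 (volume.restrict (disk r)) := by
      refine ⟨hm.1.1.1, h1.trans_lt (ENNReal.mul_lt_top ENNReal.coe_lt_top ?_)⟩
      exact (hm.1.2.1.mono_exponent hp).2
    have h3 := (h2.add (memLp_bdryData r 2)).mono_measure (restrict_annulus_le r)
    have e2 : ENNReal.ofReal 2 = 2 := by simp
    rw [e2]
    refine h3.ae_eq (Eventually.of_forall fun x => ?_)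
    simp
  · rw [memLp_ofReal_iff (by norm_num) (hmeas.mono_measure (restrict_annulus_le r))]
    simp only [Real.rpow_two]
    exact (hh.lintegral_sq_le _).trans_lt hE

end Translation

/-! ### Explicit radial fields and divergence free rotated gradients -/

section Explicit

variable {r δ : ℝ}

/-- The second coordinate vector. -/
noncomputable def e₁ : Euc 2 := EuclideanSpace.single 1 1

theorem inner_e₁ (x : Euc 2) : inner ℝ e₁ x = x 1 := by
  simp [e₁, EuclideanSpace.inner_single_left]

theorem norm_e₁ : ‖e₁‖ = 1 := by simp [e₁]

/-- The rotation by a right angle. -/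
noncomputable def rot (g : Euc 2) : Euc 2 := g 1 • e₀ - g 0 • e₁

theorem continuous_rot : Continuous rot := by
  unfold rot
  fun_prop

theorem norm_sq_eq (x : Euc 2) : ‖x‖ ^ 2 = x 0 ^ 2 + x 1 ^ 2 := by
  rw [EuclideanSpace.norm_sq_eq]
  simp

theorem abs_coord_le (x : Euc 2) (i : Fin 2) : |x i| ≤ ‖x‖ := PiLp.norm_apply_le x i

theorem norm_rot_le (g : Euc 2) : ‖rot g‖ ≤ 2 * ‖g‖ := by
  unfold rot
  refine (norm_sub_le _ _).trans ?_
  rw [norm_smul, norm_smul, norm_e₀, norm_e₁, Real.norm_eq_abs, Real.norm_eq_abs]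
  linarith [abs_coord_le g 0, abs_coord_le g 1]

theorem inner_rot (g w : Euc 2) : inner ℝ (rot g) w = g 1 * w 0 - g 0 * w 1 := by
  unfold rot
  rw [inner_sub_left, inner_smul_left, inner_smul_left, inner_e₀, inner_e₁]
  simp

theorem gradient_apply (φ : Euc 2 → ℝ) (x : Euc 2) (i : Fin 2) :
    gradient φ x i = fderiv ℝ φ x (EuclideanSpace.single i 1) := by
  rw [← inner_gradient, real_inner_comm, EuclideanSpace.inner_single_left]
  simp

/-- Rotated gradients of `C^2` functions are divergence free. -/
theorem integral_inner_rot_gradient {V φ : Euc 2 → ℝ} (hV : ContDiff ℝ 2 V)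
    (hφ : ContDiff ℝ 1 φ) (hc : HasCompactSupport φ) :
    ∫ x, inner ℝ (rot (gradient V x)) (gradient φ x) = 0 := by
  have hV' : ContDiff ℝ 1 (fderiv ℝ V) := hV.fderiv_right (by norm_num)
  have hW : ∀ w : Euc 2, ContDiff ℝ 1 (fun x => fderiv ℝ V x w) := fun w =>
    hV'.clm_apply contDiff_const
  -- After integration by parts the two terms carry the mixed second derivatives of `V` in the two
  -- orders, and these are equal.
  have ibp : ∀ v w : Euc 2, ∫ x, fderiv ℝ V x w * fderiv ℝ φ x v =
      - ∫ x, fderiv ℝ (fderiv ℝ V) x v w * φ x := by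
    intro v w
    have cφ : Continuous fun x => fderiv ℝ φ x v :=
      (hφ.continuous_fderiv one_ne_zero).clm_apply continuous_const
    have cW : Continuous fun x => fderiv ℝ (fun x => fderiv ℝ V x w) x v :=
      ((hW w).continuous_fderiv one_ne_zero).clm_apply continuous_const
    have hcφ : HasCompactSupport fun x => fderiv ℝ φ x v := by
      refine HasCompactSupport.intro hc fun x hx => ?_
      rw [← inner_gradient, gradient_eq_zero_of_notMem hx, inner_zero_left]
    have := integral_mul_fderiv_eq_neg_fderiv_mul_of_integrable (μ := volume)
      (f := fun x => fderiv ℝ V x w) (g := φ) (v := v)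
      ((cW.mul hφ.continuous).integrable_of_hasCompactSupport hc.mul_left)
      (((hW w).continuous.mul cφ).integrable_of_hasCompactSupport hcφ.mul_left)
      (((hW w).continuous.mul hφ.continuous).integrable_of_hasCompactSupport hc.mul_left)
      (fun x _ => (hW w).differentiable one_ne_zero x)
      (fun x _ => hφ.differentiable one_ne_zero x)
    rw [this]
    congr 1
    refine integral_congr_ae (Eventually.of_forall fun x => ?_)
    simp only
    rw [fderiv_clm_apply (hV'.differentiable one_ne_zero x) (differentiableAt_const _)]
    simp
  have hi : ∀ v w : Euc 2, Integrable fun x => fderiv ℝ V x w * fderiv ℝ φ x v := by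
    intro v w
    have cφ : Continuous fun x => fderiv ℝ φ x v :=
      (hφ.continuous_fderiv one_ne_zero).clm_apply continuous_const
    have hcφ : HasCompactSupport fun x => fderiv ℝ φ x v := by
      refine HasCompactSupport.intro hc fun x hx => ?_
      rw [← inner_gradient, gradient_eq_zero_of_notMem hx, inner_zero_left]
    exact ((hW w).continuous.mul cφ).integrable_of_hasCompactSupport hcφ.mul_left
  simp only [inner_rot, gradient_apply]
  rw [integral_sub (hi _ _) (hi _ _), ibp, ibp, sub_eq_zero]
  congr 1
  refine integral_congr_ae (Eventually.of_forall fun x => ?_)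
  simp only
  have hs : IsSymmSndFDerivAt ℝ V x := hV.contDiffAt.isSymmSndFDerivAt (by simp)
  rw [hs.eq]

/-- The gradient of `x_i β(|x|^2)`, where `β'` is the derivative of `β`. -/
noncomputable def radialGrad (i : Fin 2) (β β' : ℝ → ℝ) (x : Euc 2) : Euc 2 :=
  β (‖x‖ ^ 2) • EuclideanSpace.single i 1 + (2 * x i * β' (‖x‖ ^ 2)) • x

theorem gradient_radial (i : Fin 2) {β β' : ℝ → ℝ} {x : Euc 2}
    (h : HasDerivAt β (β' (‖x‖ ^ 2)) (‖x‖ ^ 2)) :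
    gradient (fun x : Euc 2 => x i * β (‖x‖ ^ 2)) x = radialGrad i β β' x := by
  refine ext_inner_right ℝ fun w => ?_
  rw [inner_gradient]
  have h1 : HasFDerivAt (fun x : Euc 2 => x i)
      (EuclideanSpace.proj i : Euc 2 →L[ℝ] ℝ) x :=
    (EuclideanSpace.proj i : Euc 2 →L[ℝ] ℝ).hasFDerivAt
  have h2 : HasFDerivAt (fun x : Euc 2 => ‖x‖ ^ 2) (2 • (innerSL ℝ x)) x :=
    (hasStrictFDerivAt_norm_sq x).hasFDerivAt
  have h3 := h1.mul (h.comp_hasFDerivAt x h2)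
  rw [show (fun x : Euc 2 => x i * β (‖x‖ ^ 2)) =
    (fun x : Euc 2 => x i) * (β ∘ fun x : Euc 2 => ‖x‖ ^ 2) from rfl, h3.fderiv]
  unfold radialGrad
  simp only [add_apply, smul_apply, innerSL_apply_apply,
    Function.comp, smul_eq_mul, inner_add_left, inner_smul_left, EuclideanSpace.inner_single_left,
    conj_trivial, map_one, one_mul, nsmul_eq_mul]
  rw [show (EuclideanSpace.proj i : Euc 2 →L[ℝ] ℝ) w = w i from rfl]
  push_cast
  ring

theorem norm_radialGrad_le (i : Fin 2) {β β' : ℝ → ℝ} {x : Euc 2} {K K' : ℝ} (hr : 0 ≤ r)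
    (hx : ‖x‖ ≤ r) (hβ : |β (‖x‖ ^ 2)| ≤ K) (hβ' : |β' (‖x‖ ^ 2)| ≤ K') :
    ‖radialGrad i β β' x‖ ≤ K + 2 * r * K' * r := by
  unfold radialGrad
  refine (norm_add_le _ _).trans ?_
  have hs : ‖(EuclideanSpace.single i 1 : Euc 2)‖ = 1 := by simp
  rw [norm_smul, norm_smul, hs, Real.norm_eq_abs, Real.norm_eq_abs, abs_mul, abs_mul]
  have h1 := (abs_coord_le x i).trans hx
  have h0 : 0 ≤ K' := (abs_nonneg _).trans hβ'
  have : |(2 : ℝ)| * |x i| * |β' (‖x‖ ^ 2)| * ‖x‖ ≤ 2 * r * K' * r := by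
    rw [abs_two]
    gcongr
  linarith

/-- A smooth approximation of `max t 1`. -/
noncomputable def smoothMax (δ t : ℝ) : ℝ := (t + 1 + √((t - 1) ^ 2 + δ)) / 2

/-- The derivative of `smoothMax`. -/
noncomputable def smoothMax' (δ t : ℝ) : ℝ := (1 + (t - 1) / √((t - 1) ^ 2 + δ)) / 2

theorem abs_le_sqrt_add (hδ : 0 < δ) (t : ℝ) : |t - 1| ≤ √((t - 1) ^ 2 + δ) := by
  rw [← Real.sqrt_sq_eq_abs]
  exact Real.sqrt_le_sqrt (by linarith)

theorem max_le_smoothMax (hδ : 0 < δ) (t : ℝ) : max t 1 ≤ smoothMax δ t := by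
  have h := abs_le.1 (abs_le_sqrt_add hδ t)
  unfold smoothMax
  refine max_le ?_ ?_ <;> linarith [h.1, h.2, le_abs_self (t - 1), neg_abs_le (t - 1),
    abs_le_sqrt_add hδ t]

theorem smoothMax'_mem (hδ : 0 < δ) (t : ℝ) : |smoothMax' δ t| ≤ 1 := by
  have h := abs_le_sqrt_add hδ t
  have hp : 0 < √((t - 1) ^ 2 + δ) := Real.sqrt_pos.2 (by positivity)
  have h2 : |(t - 1) / √((t - 1) ^ 2 + δ)| ≤ 1 := by
    rw [abs_div, abs_of_pos hp, div_le_one hp]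
    exact h
  have h3 := abs_le.1 h2
  unfold smoothMax'
  rw [abs_le]
  constructor <;> linarith [h3.1, h3.2]

theorem contDiff_smoothMax (hδ : 0 < δ) {n : WithTop ℕ∞} : ContDiff ℝ n (smoothMax δ) := by
  unfold smoothMax
  refine ContDiff.div_const ?_ 2
  refine (contDiff_id.add contDiff_const).add (ContDiff.sqrt ?_ fun t => by positivity)
  fun_prop

theorem hasDerivAt_smoothMax (hδ : 0 < δ) (t : ℝ) :
    HasDerivAt (smoothMax δ) (smoothMax' δ t) t := by
  have h1 : HasDerivAt (fun t : ℝ => (t - 1) ^ 2 + δ) (2 * (t - 1)) t := by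
    have := (((hasDerivAt_id t).sub_const 1).pow 2).add_const δ
    exact this.congr_deriv (by simp)
  have h2 := h1.sqrt (by positivity)
  have h3 := (((hasDerivAt_id t).add_const 1).add h2).div_const 2
  refine h3.congr_deriv ?_
  unfold smoothMax'
  have hp : √((t - 1) ^ 2 + δ) ≠ 0 := (Real.sqrt_pos.2 (by positivity)).ne'
  field_simp

/-- A smooth approximation of `1 / max t 1`. -/
noncomputable def smoothInv (δ t : ℝ) : ℝ := (smoothMax δ t)⁻¹

/-- The derivative of `smoothInv`. -/
noncomputable def smoothInv' (δ t : ℝ) : ℝ := -smoothMax' δ t / smoothMax δ t ^ 2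

/-- The truncated inverse `1 / max t 1`. -/
noncomputable def truncInv (t : ℝ) : ℝ := (max t 1)⁻¹

/-- The derivative of `truncInv`. -/
noncomputable def truncInv' (t : ℝ) : ℝ := if 1 < t then -(t ^ 2)⁻¹ else 0

theorem one_le_smoothMax (hδ : 0 < δ) (t : ℝ) : 1 ≤ smoothMax δ t :=
  (le_max_right _ _).trans (max_le_smoothMax hδ t)

theorem contDiff_smoothInv (hδ : 0 < δ) {n : WithTop ℕ∞} : ContDiff ℝ n (smoothInv δ) :=
  (contDiff_smoothMax hδ).inv fun t => (zero_lt_one.trans_le (one_le_smoothMax hδ t)).ne'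

theorem hasDerivAt_smoothInv (hδ : 0 < δ) (t : ℝ) :
    HasDerivAt (smoothInv δ) (smoothInv' δ t) t :=
  (hasDerivAt_smoothMax hδ t).inv (zero_lt_one.trans_le (one_le_smoothMax hδ t)).ne'

theorem smoothInv_nonneg (hδ : 0 < δ) (t : ℝ) : 0 ≤ smoothInv δ t :=
  inv_nonneg.2 (zero_le_one.trans (one_le_smoothMax hδ t))

theorem smoothInv_le_truncInv (hδ : 0 < δ) (t : ℝ) : smoothInv δ t ≤ truncInv t :=
  inv_anti₀ (zero_lt_one.trans_le (le_max_right _ _)) (max_le_smoothMax hδ t)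

theorem truncInv_nonneg (t : ℝ) : 0 ≤ truncInv t :=
  inv_nonneg.2 (zero_le_one.trans (le_max_right _ _))

theorem truncInv_le_one (t : ℝ) : truncInv t ≤ 1 := inv_le_one_of_one_le₀ (le_max_right _ _)

theorem abs_smoothInv_le (hδ : 0 < δ) (t : ℝ) : |smoothInv δ t| ≤ 1 := by
  rw [abs_of_nonneg (smoothInv_nonneg hδ t)]
  exact (smoothInv_le_truncInv hδ t).trans (truncInv_le_one t)

theorem abs_smoothInv'_le (hδ : 0 < δ) (t : ℝ) : |smoothInv' δ t| ≤ 1 := by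
  unfold smoothInv'
  have h1 := one_le_smoothMax hδ t
  rw [abs_div, abs_neg, abs_of_nonneg (sq_nonneg (smoothMax δ t)), div_le_one (by positivity)]
  exact (smoothMax'_mem hδ t).trans (one_le_pow₀ h1)

theorem abs_truncInv_le (t : ℝ) : |truncInv t| ≤ 1 := by
  rw [abs_of_nonneg (truncInv_nonneg t)]
  exact truncInv_le_one t

theorem abs_truncInv'_le (t : ℝ) : |truncInv' t| ≤ 1 := by
  unfold truncInv'
  split_ifs with h
  · rw [abs_neg, abs_of_nonneg (by positivity)]
    exact inv_le_one_of_one_le₀ (one_le_pow₀ h.le)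
  · simp

theorem measurable_truncInv' : Measurable truncInv' := by
  unfold truncInv'
  exact Measurable.ite measurableSet_Ioi (by fun_prop) measurable_const

theorem continuous_truncInv : Continuous truncInv := by
  unfold truncInv
  exact (continuous_id.max continuous_const).inv₀
    fun t => (zero_lt_one.trans_le (le_max_right _ _)).ne'

theorem tendsto_smoothMax (t : ℝ) : Tendsto (fun δ => smoothMax δ t) (𝓝 0) (𝓝 (max t 1)) := by
  have hc : Continuous fun δ => smoothMax δ t := by unfold smoothMax; fun_prop
  have := hc.tendsto 0
  convert! this using 2
  unfold smoothMax
  rw [add_zero, Real.sqrt_sq_eq_abs, max_def]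
  split_ifs with h
  · rw [abs_of_nonpos (by linarith)]; ring
  · rw [abs_of_pos (by linarith)]; ring

theorem tendsto_smoothMax' {t : ℝ} (ht : t ≠ 1) :
    Tendsto (fun δ => smoothMax' δ t) (𝓝 0) (𝓝 (if 1 < t then 1 else 0)) := by
  have hne : |t - 1| ≠ 0 := abs_ne_zero.2 (sub_ne_zero.2 ht)
  have hc : ContinuousAt (fun δ => smoothMax' δ t) 0 := by
    unfold smoothMax'
    refine ContinuousAt.div_const (continuousAt_const.add (continuousAt_const.div ?_ ?_)) 2
    · fun_prop
    · rw [add_zero, Real.sqrt_sq_eq_abs]; exact hne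
  have := hc.tendsto
  convert! this using 2
  unfold smoothMax'
  rw [add_zero, Real.sqrt_sq_eq_abs]
  split_ifs with h
  · rw [abs_of_pos (by linarith), div_self (by linarith)]; norm_num
  · have : t < 1 := lt_of_le_of_ne (not_lt.1 h) ht
    rw [abs_of_neg (by linarith), div_neg, div_self (by linarith)]; norm_num

theorem tendsto_smoothInv (t : ℝ) : Tendsto (fun δ => smoothInv δ t) (𝓝 0) (𝓝 (truncInv t)) :=
  (tendsto_smoothMax t).inv₀ (zero_lt_one.trans_le (le_max_right _ _)).ne'

theorem tendsto_smoothInv' {t : ℝ} (ht : t ≠ 1) :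
    Tendsto (fun δ => smoothInv' δ t) (𝓝 0) (𝓝 (truncInv' t)) := by
  have hne : max t 1 ^ 2 ≠ 0 := pow_ne_zero 2 (zero_lt_one.trans_le (le_max_right _ _)).ne'
  have := (tendsto_smoothMax' ht).neg.div ((tendsto_smoothMax t).pow 2) hne
  convert! this using 2
  unfold truncInv'
  split_ifs with h
  · rw [max_eq_left h.le, neg_div, one_div]
  · simp

/-- The derivative of the truncated inverse jumps only on the unit circle, so the smooth
approximations of the gradients converge almost everywhere. -/
theorem ae_norm_sq_ne_one : ∀ᵐ x ∂(volume : Measure (Euc 2)), ‖x‖ ^ 2 ≠ 1 := by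
  have hs : (volume : Measure (Euc 2)) (Metric.sphere 0 1) = 0 :=
    Measure.addHaar_sphere volume 0 1
  filter_upwards [measure_eq_zero_iff_ae_notMem.1 hs] with x hx h
  apply hx
  rw [mem_sphere_zero_iff_norm]
  exact (pow_eq_one_iff_of_nonneg (norm_nonneg x) two_ne_zero).1 h

theorem measurable_radialGrad (i : Fin 2) {β β' : ℝ → ℝ} (hβ : Measurable β)
    (hβ' : Measurable β') : Measurable (radialGrad i β β') := by
  unfold radialGrad
  have h1 : Measurable fun x : Euc 2 => β (‖x‖ ^ 2) := hβ.comp (by fun_prop)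
  have h2 : Measurable fun x : Euc 2 => β' (‖x‖ ^ 2) := hβ'.comp (by fun_prop)
  have h3 : Measurable fun x : Euc 2 => x i := by fun_prop
  exact (h1.smul_const _).add (((h3.const_mul 2).mul h2).smul measurable_id)

/-- The gradient of `x_i / max (|x|^2) 1`. -/
noncomputable abbrev truncGrad (i : Fin 2) : Euc 2 → Euc 2 := radialGrad i truncInv truncInv'

theorem measurable_truncGrad (i : Fin 2) : Measurable (truncGrad i) :=
  measurable_radialGrad i continuous_truncInv.measurable measurable_truncInv'

theorem norm_truncGrad_le (i : Fin 2) {x : Euc 2} (hr : 0 ≤ r) (hx : ‖x‖ ≤ r) :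
    ‖truncGrad i x‖ ≤ 1 + 2 * r * 1 * r :=
  norm_radialGrad_le i hr hx (abs_truncInv_le _) (abs_truncInv'_le _)

theorem tendsto_radialGrad (i : Fin 2) {ι : Type*} {l : Filter ι} {β β' : ι → ℝ → ℝ}
    {b b' : ℝ → ℝ} {x : Euc 2}
    (h : Tendsto (fun n => β n (‖x‖ ^ 2)) l (𝓝 (b (‖x‖ ^ 2))))
    (h' : Tendsto (fun n => β' n (‖x‖ ^ 2)) l (𝓝 (b' (‖x‖ ^ 2)))) :
    Tendsto (fun n => radialGrad i (β n) (β' n) x) l (𝓝 (radialGrad i b b' x)) := by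
  unfold radialGrad
  exact (h.smul_const _).add ((h'.const_mul _).smul_const _)

/-- The rotated gradient of `x_1 / max (|x|^2) 1` is divergence free. -/
theorem integral_inner_rot_truncGrad (hr : 0 < r) {φ : Euc 2 → ℝ} (hφ : IsTest (disk r) φ) :
    ∫ x in disk r, inner ℝ (rot (truncGrad 1 x)) (gradient φ x) = 0 := by
  obtain ⟨C, hC⟩ := hφ.gradient_bounded
  have hpos : ∀ n : ℕ, 0 < 1 / ((n : ℝ) + 1) := fun n => by positivity
  have hz : ∀ n : ℕ, ∫ x in disk r, inner ℝ (rot (radialGrad 1 (smoothInv (1 / ((n : ℝ) + 1)))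
      (smoothInv' (1 / ((n : ℝ) + 1))) x)) (gradient φ x) = 0 := by
    intro n
    have hV : ContDiff ℝ 2 (fun x : Euc 2 => x 1 * smoothInv (1 / ((n : ℝ) + 1)) (‖x‖ ^ 2)) := by
      have h1 : ContDiff ℝ 2 (smoothInv (1 / ((n : ℝ) + 1))) := contDiff_smoothInv (hpos n)
      have h2 : ContDiff ℝ 2 fun x : Euc 2 => x 1 := by fun_prop
      exact h2.mul (h1.comp (contDiff_norm_sq ℝ))
    rw [setIntegral_eq_integral_of_forall_compl_eq_zero fun x hx => by
      rw [hφ.gradient_eq_zero hx, inner_zero_right]]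
    rw [← integral_inner_rot_gradient hV hφ.1 hφ.2.1]
    refine integral_congr_ae (Eventually.of_forall fun x => ?_)
    simp only
    rw [gradient_radial 1 (hasDerivAt_smoothInv (hpos n) _)]
  have hlim : Tendsto (fun n : ℕ => ∫ x in disk r, inner ℝ
      (rot (radialGrad 1 (smoothInv (1 / ((n : ℝ) + 1))) (smoothInv' (1 / ((n : ℝ) + 1))) x))
      (gradient φ x)) atTop
      (𝓝 (∫ x in disk r, inner ℝ (rot (truncGrad 1 x)) (gradient φ x))) := by
    refine tendsto_integral_of_dominated_convergence
      (fun _ => 2 * (1 + 2 * r * 1 * r) * C) (fun n => ?_) (integrable_const _) (fun n => ?_) ?_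
    · have h1 : Measurable (smoothInv (1 / ((n : ℝ) + 1))) :=
        (contDiff_smoothInv (hpos n) (n := 0)).continuous.measurable
      have h2 : Measurable (smoothInv' (1 / ((n : ℝ) + 1))) := by
        have : smoothInv' (1 / ((n : ℝ) + 1)) = deriv (smoothInv (1 / ((n : ℝ) + 1))) :=
          funext fun t => (hasDerivAt_smoothInv (hpos n) t).deriv.symm
        rw [this]
        exact measurable_deriv _
      exact ((continuous_rot.measurable.comp (measurable_radialGrad 1 h1 h2)).inner
        (continuous_gradient hφ.1).measurable).aestronglyMeasurable
    · filter_upwards [ae_restrict_mem Metric.isOpen_ball.measurableSet] with x hx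
      refine (norm_inner_le_norm _ _).trans ?_
      gcongr
      · refine (norm_rot_le _).trans ?_
        gcongr
        exact norm_radialGrad_le 1 hr.le (mem_ball_zero_iff.1 hx).le (abs_smoothInv_le (hpos n) _)
          (abs_smoothInv'_le (hpos n) _)
      · exact hC x
    · filter_upwards [ae_restrict_of_ae ae_norm_sq_ne_one] with x hx
      refine Tendsto.inner ?_ tendsto_const_nhds
      refine (continuous_rot.tendsto _).comp ?_
      exact tendsto_radialGrad 1
        ((tendsto_smoothInv _).comp tendsto_one_div_add_atTop_nhds_zero_nat)
        ((tendsto_smoothInv' hx).comp tendsto_one_div_add_atTop_nhds_zero_nat)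
  refine tendsto_nhds_unique hlim ?_
  simp only [hz]
  exact tendsto_const_nhds

/-- The constant field `e₀` is the rotated gradient of the second coordinate. -/
theorem integral_inner_e₀_gradient {φ : Euc 2 → ℝ} (hφ : IsTest (disk r) φ) :
    ∫ x in disk r, inner ℝ e₀ (gradient φ x) = 0 := by
  have hV : ContDiff ℝ 2 (fun x : Euc 2 => x 1 * (fun _ => (1 : ℝ)) (‖x‖ ^ 2)) := by
    fun_prop
  rw [setIntegral_eq_integral_of_forall_compl_eq_zero fun x hx => by
    rw [hφ.gradient_eq_zero hx, inner_zero_right], ← integral_inner_rot_gradient hV hφ.1 hφ.2.1]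
  refine integral_congr_ae (Eventually.of_forall fun x => ?_)
  simp only
  rw [gradient_radial 1 (β := fun _ => 1) (β' := fun _ => 0) (hasDerivAt_const _ _)]
  congr 1
  simp [radialGrad, rot]

end Explicit

/-! ### Approximation of the competitor by test functions -/

section Competitor

variable {r δ : ℝ}

/-- Bounded almost everywhere convergence implies `L^s` convergence on a finite measure space. -/
theorem tendsto_eLpNorm_of_bounded {α E : Type*} [MeasurableSpace α] {μ : Measure α}
    [IsFiniteMeasure μ] [NormedAddCommGroup E] {s : ℝ} (hs : 0 < s) {f : ℕ → α → E} {g : α → E}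
    {C : ℝ} (hf : ∀ n, AEStronglyMeasurable (f n) μ) (hg : AEStronglyMeasurable g μ)
    (hb : ∀ n, ∀ᵐ x ∂μ, ‖f n x‖ ≤ C) (hgb : ∀ᵐ x ∂μ, ‖g x‖ ≤ C)
    (hlim : ∀ᵐ x ∂μ, Tendsto (fun n => f n x) atTop (𝓝 (g x))) :
    Tendsto (fun n => eLpNorm (f n - g) (ENNReal.ofReal s) μ) atTop (𝓝 0) := by
  have h1 : Tendsto (fun n => ∫⁻ x, ENNReal.ofReal (‖(f n - g) x‖ ^ s) ∂μ) atTop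
      (𝓝 (∫⁻ _, 0 ∂μ)) := by
    refine tendsto_lintegral_of_dominated_convergence' (fun _ => ENNReal.ofReal ((C + C) ^ s))
      (fun n => ?_) (fun n => ?_) ?_ ?_
    · exact (((hf n).sub hg).norm.aemeasurable.pow_const s).ennreal_ofReal
    · filter_upwards [hb n, hgb] with x h1 h2
      refine ENNReal.ofReal_le_ofReal ?_
      refine Real.rpow_le_rpow (norm_nonneg _) ?_ hs.le
      exact (norm_sub_le _ _).trans (add_le_add h1 h2)
    · rw [lintegral_const]
      exact (ENNReal.mul_lt_top ENNReal.ofReal_lt_top (measure_lt_top _ _)).ne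
    · filter_upwards [hlim] with x hx
      have h2 : Tendsto (fun n => ‖(f n - g) x‖) atTop (𝓝 0) := by
        have := (hx.sub_const (g x)).norm
        simpa using this
      have h3 := (h2.rpow_const (p := s) (Or.inr hs.le))
      rw [Real.zero_rpow hs.ne'] at h3
      simpa using ENNReal.tendsto_ofReal h3
  rw [lintegral_zero] at h1
  have h2 := h1.ennrpow_const (1 / s)
  rw [ENNReal.zero_rpow_of_pos (by positivity)] at h2
  refine h2.congr fun n => ?_
  rw [eLpNorm_ofReal_eq hs]

/-- A smooth version of the positive part. -/
noncomputable def softPos (s : ℝ) : ℝ := s * Real.smoothTransition s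

theorem contDiff_softPos {n : ℕ∞} : ContDiff ℝ n softPos :=
  contDiff_id.mul Real.smoothTransition.contDiff

theorem softPos_of_nonpos {s : ℝ} (hs : s ≤ 0) : softPos s = 0 := by
  simp [softPos, Real.smoothTransition.zero_of_nonpos hs]

theorem softPos_of_one_le {s : ℝ} (hs : 1 ≤ s) : softPos s = s := by
  simp [softPos, Real.smoothTransition.one_of_one_le hs]

theorem abs_softPos_le (s : ℝ) : |softPos s| ≤ |s| := by
  unfold softPos
  rw [abs_mul, abs_of_nonneg (Real.smoothTransition.nonneg s)]
  exact mul_le_of_le_one_right (abs_nonneg s) (Real.smoothTransition.le_one s)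

theorem deriv_softPos_of_one_lt {s : ℝ} (hs : 1 < s) : deriv softPos s = 1 := by
  have : softPos =ᶠ[𝓝 s] id := by
    filter_upwards [lt_mem_nhds hs] with y hy
    exact softPos_of_one_le hy.le
  rw [this.deriv_eq, deriv_id]

theorem exists_deriv_softPos_le : ∃ K, ∀ s, |deriv softPos s| ≤ K := by
  have hc : Continuous (deriv softPos) := (contDiff_softPos (n := 1)).continuous_deriv le_rfl
  obtain ⟨K, hK⟩ := isCompact_Icc.exists_bound_of_continuousOn (s := Icc (0 : ℝ) 1) hc.continuousOn
  refine ⟨max K 1, fun s => ?_⟩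
  rcases lt_or_ge s 0 with h | h
  · have : softPos =ᶠ[𝓝 s] fun _ => 0 := by
      filter_upwards [gt_mem_nhds h] with y hy
      exact softPos_of_nonpos hy.le
    rw [this.deriv_eq, deriv_const, abs_zero]
    exact zero_le_one.trans (le_max_right _ _)
  · rcases le_or_gt s 1 with h' | h'
    · exact (hK s ⟨h, h'⟩).trans (le_max_left _ _)
    · rw [deriv_softPos_of_one_lt h', abs_one]
      exact le_max_right _ _

/-- A smooth approximation of `1 / max t 1 - c` that vanishes where `1 / t ≤ c + δ`. -/
noncomputable def cutInv (c δ t : ℝ) : ℝ := δ * softPos ((smoothInv δ t - c - δ) / δ)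

/-- The derivative of `cutInv`. -/
noncomputable def cutInv' (c δ t : ℝ) : ℝ :=
  deriv softPos ((smoothInv δ t - c - δ) / δ) * smoothInv' δ t

theorem hasDerivAt_cutInv (c : ℝ) (hδ : 0 < δ) (t : ℝ) :
    HasDerivAt (cutInv c δ) (cutInv' c δ t) t := by
  have h1 := (((hasDerivAt_smoothInv hδ t).sub_const c).sub_const δ).div_const δ
  have h2 : HasDerivAt softPos (deriv softPos ((smoothInv δ t - c - δ) / δ))
      ((smoothInv δ t - c - δ) / δ) :=
    ((contDiff_softPos (n := 1)).differentiable one_ne_zero _).hasDerivAt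
  have h3 := (h2.comp t h1).const_mul δ
  refine h3.congr_deriv ?_
  unfold cutInv'
  field_simp

theorem contDiff_cutInv (c : ℝ) (hδ : 0 < δ) : ContDiff ℝ 1 (cutInv c δ) := by
  have h1 : ContDiff ℝ 1 fun t => (smoothInv δ t - c - δ) / δ :=
    (((contDiff_smoothInv hδ).sub contDiff_const).sub contDiff_const).div_const δ
  exact contDiff_const.mul ((contDiff_softPos (n := 1)).comp h1)

theorem abs_cutInv_le {c : ℝ} (hc : 0 ≤ c) (hδ : 0 < δ) (t : ℝ) :
    |cutInv c δ t| ≤ 1 + c + δ := by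
  unfold cutInv
  rw [abs_mul, abs_of_pos hδ]
  have h1 := abs_softPos_le ((smoothInv δ t - c - δ) / δ)
  rw [abs_div, abs_of_pos hδ, le_div_iff₀ hδ] at h1
  have h2 := abs_smoothInv_le hδ t
  calc _ = |softPos ((smoothInv δ t - c - δ) / δ)| * δ := mul_comm _ _
    _ ≤ _ := h1
    _ ≤ |smoothInv δ t| + |c| + |δ| := by
        refine (abs_sub _ _).trans ?_
        gcongr
        exact abs_sub _ _
    _ ≤ _ := by rw [abs_of_nonneg hc, abs_of_pos hδ]; gcongr

/-- Where the limit is positive the argument of `softPos` eventually exceeds `1`, so `softPos` acts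
as the identity and the cut-off leaves no trace in the limit, neither in values nor in derivatives.
-/
theorem tendsto_smoothInv_sub_div {c t : ℝ} (hct : c < truncInv t) :
    ∀ᶠ δ in 𝓝[>] (0 : ℝ), 1 < (smoothInv δ t - c - δ) / δ := by
  have h1 : Tendsto (fun δ => smoothInv δ t - c - 2 * δ) (𝓝 0) (𝓝 (truncInv t - c - 2 * 0)) :=
    ((tendsto_smoothInv t).sub_const c).sub (tendsto_id.const_mul 2)
  have h2 : 0 < truncInv t - c - 2 * 0 := by linarith
  filter_upwards [nhdsWithin_le_nhds (h1.eventually (lt_mem_nhds h2)), self_mem_nhdsWithin]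
    with δ h3 h4
  rw [lt_div_iff₀ h4]
  linarith

theorem tendsto_cutInv {c t : ℝ} (hct : c < truncInv t) :
    Tendsto (fun δ => cutInv c δ t) (𝓝[>] 0) (𝓝 (truncInv t - c)) := by
  have h1 : Tendsto (fun δ => smoothInv δ t - c - δ) (𝓝 0) (𝓝 (truncInv t - c - 0)) :=
    ((tendsto_smoothInv t).sub_const c).sub tendsto_id
  rw [sub_zero] at h1
  refine (h1.mono_left nhdsWithin_le_nhds).congr' ?_
  filter_upwards [tendsto_smoothInv_sub_div hct, self_mem_nhdsWithin] with δ h3 h4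
  have : δ ≠ 0 := ne_of_gt h4
  unfold cutInv
  rw [softPos_of_one_le h3.le]
  field_simp

theorem tendsto_cutInv' {c t : ℝ} (hct : c < truncInv t) (ht : t ≠ 1) :
    Tendsto (fun δ => cutInv' c δ t) (𝓝[>] 0) (𝓝 (truncInv' t)) := by
  refine ((tendsto_smoothInv' ht).mono_left nhdsWithin_le_nhds).congr' ?_
  filter_upwards [tendsto_smoothInv_sub_div hct] with δ h3
  unfold cutInv'
  rw [deriv_softPos_of_one_lt h3, one_mul]

/-- Subtracting the extra `δ` makes the function vanish in a neighbourhood of the boundary circle,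
since `1/|x|²` is below `1/r² + δ` there. -/
theorem isTest_cutInv (hr : 1 < r) (hδ : 0 < δ) :
    IsTest (disk r) (fun x : Euc 2 => x 0 * cutInv (1 / r ^ 2) δ (‖x‖ ^ 2)) := by
  have hr0 : 0 < r := by linarith
  -- The bounding circle of this set is where `1/|x|² = 1/r² + δ`.
  set K : Set (Euc 2) := {x | ‖x‖ ^ 2 ≤ r ^ 2 / (1 + δ * r ^ 2)} with hK
  have hKc : IsClosed K := isClosed_le (by fun_prop) continuous_const
  have hlt : r ^ 2 / (1 + δ * r ^ 2) < r ^ 2 := by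
    rw [div_lt_iff₀ (by positivity)]
    have : 0 < δ * r ^ 2 := by positivity
    nlinarith
  have hKd : K ⊆ disk r := by
    intro x hx
    rw [mem_ball_zero_iff]
    exact lt_of_pow_lt_pow_left₀ 2 hr0.le (lt_of_le_of_lt hx hlt)
  have hKcomp : IsCompact K :=
    (isCompact_closedBall (0 : Euc 2) r).of_isClosed_subset hKc
      (hKd.trans Metric.ball_subset_closedBall)
  have hsupp : Function.support (fun x : Euc 2 => x 0 * cutInv (1 / r ^ 2) δ (‖x‖ ^ 2)) ⊆ K := by
    intro x hx
    by_contra hxK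
    apply hx
    have h1 : r ^ 2 / (1 + δ * r ^ 2) < ‖x‖ ^ 2 := not_le.1 hxK
    have hx0 : 0 < ‖x‖ ^ 2 := lt_trans (by positivity) h1
    have h2 : smoothInv δ (‖x‖ ^ 2) ≤ 1 / r ^ 2 + δ := by
      calc smoothInv δ (‖x‖ ^ 2) ≤ truncInv (‖x‖ ^ 2) := smoothInv_le_truncInv hδ _
        _ ≤ (‖x‖ ^ 2)⁻¹ := inv_anti₀ hx0 (le_max_left _ _)
        _ ≤ (r ^ 2 / (1 + δ * r ^ 2))⁻¹ := inv_anti₀ (by positivity) h1.le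
        _ = 1 / r ^ 2 + δ := by field_simp
    have : (smoothInv δ (‖x‖ ^ 2) - 1 / r ^ 2 - δ) / δ ≤ 0 :=
      div_nonpos_of_nonpos_of_nonneg (by linarith) hδ.le
    simp only [cutInv, softPos_of_nonpos this, mul_zero]
  have hsm : ContDiff ℝ 1 (fun x : Euc 2 => x 0 * cutInv (1 / r ^ 2) δ (‖x‖ ^ 2)) := by
    have h2 : ContDiff ℝ 1 fun x : Euc 2 => x 0 := by fun_prop
    exact h2.mul ((contDiff_cutInv _ hδ).comp (contDiff_norm_sq ℝ))
  exact ⟨hsm, HasCompactSupport.of_support_subset_isCompact hKcomp hsupp,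
    (closure_minimal hsupp hKc).trans hKd⟩

theorem lt_truncInv {t : ℝ} (hr : 1 < r) (ht : t < r ^ 2) : 1 / r ^ 2 < truncInv t := by
  unfold truncInv
  rw [one_div]
  refine inv_strictAnti₀ (zero_lt_one.trans_le (le_max_right _ _)) (max_lt ht ?_)
  nlinarith

/-- The functions `x₀ · cutInv` and their gradients are bounded uniformly in `δ` and converge almost
everywhere in the disk, so dominated convergence gives convergence in every `L^s`. -/
theorem isW0_truncRadial (hr : 1 < r) {s : ℝ} (hs : 0 < s) :
    IsW0 (ENNReal.ofReal s) (disk r) (fun x => x 0 * (truncInv (‖x‖ ^ 2) - 1 / r ^ 2))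
      (fun x => truncGrad 0 x - (1 / r ^ 2) • e₀) := by
  have hr0 : 0 < r := by linarith
  obtain ⟨K, hK⟩ := exists_deriv_softPos_le
  have hpos : ∀ n : ℕ, 0 < 1 / ((n : ℝ) + 1) := fun n => by positivity
  have hle : ∀ n : ℕ, 1 / ((n : ℝ) + 1) ≤ 1 := fun n => by
    rw [div_le_one (by positivity)]
    linarith [(Nat.cast_nonneg n : (0 : ℝ) ≤ n)]
  have hδ : Tendsto (fun n : ℕ => 1 / ((n : ℝ) + 1)) atTop (𝓝[>] 0) :=
    tendsto_nhdsWithin_iff.2 ⟨tendsto_one_div_add_atTop_nhds_zero_nat,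
      Eventually.of_forall hpos⟩
  have hr1 : 1 / r ^ 2 ≤ 1 := by
    rw [div_le_one (by positivity)]
    nlinarith
  have hr2 : 0 ≤ 1 / r ^ 2 := by positivity
  have hmem : ∀ᵐ x ∂((volume : Measure (Euc 2)).restrict (disk r)), ‖x‖ < r := by
    filter_upwards [ae_restrict_mem Metric.isOpen_ball.measurableSet] with x hx
    exact mem_ball_zero_iff.1 hx
  have hsq : ∀ {x : Euc 2}, ‖x‖ < r → ‖x‖ ^ 2 < r ^ 2 := fun hx =>
    pow_lt_pow_left₀ hx (norm_nonneg _) two_ne_zero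
  have hcut : ∀ (n : ℕ) t, |cutInv (1 / r ^ 2) (1 / ((n : ℝ) + 1)) t| ≤ 3 := fun n t =>
    (abs_cutInv_le hr2 (hpos n) t).trans (by linarith [hle n])
  have hK0 : 0 ≤ K := (abs_nonneg _).trans (hK 0)
  have hcut' : ∀ (n : ℕ) t, |cutInv' (1 / r ^ 2) (1 / ((n : ℝ) + 1)) t| ≤ K + 1 := fun n t => by
    unfold cutInv'
    rw [abs_mul]
    calc _ ≤ K * 1 := mul_le_mul (hK _) (abs_smoothInv'_le (hpos n) t) (abs_nonneg _) hK0
      _ ≤ K + 1 := by linarith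
  have htr : ∀ t, |truncInv t - 1 / r ^ 2| ≤ 3 := fun t => by
    have h1 := truncInv_nonneg t
    have h2 := truncInv_le_one t
    rw [abs_le]
    constructor <;> linarith
  have htr' : ∀ t, |truncInv' t| ≤ K + 1 := fun t => (abs_truncInv'_le t).trans (by linarith)
  have hgr : (fun x => truncGrad 0 x - (1 / r ^ 2) • e₀) =
      radialGrad 0 (fun t => truncInv t - 1 / r ^ 2) truncInv' := by
    ext1 x
    simp only [truncGrad, radialGrad, e₀]
    module
  have hcu : Continuous fun x : Euc 2 => x 0 * (truncInv (‖x‖ ^ 2) - 1 / r ^ 2) := by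
    have h1 : Continuous fun x : Euc 2 => truncInv (‖x‖ ^ 2) :=
      continuous_truncInv.comp (by fun_prop)
    fun_prop
  have hmg : Measurable (radialGrad 0 (fun t => truncInv t - 1 / r ^ 2) truncInv') :=
    measurable_radialGrad 0 (continuous_truncInv.measurable.sub_const _) measurable_truncInv'
  have hub : ∀ᵐ x ∂((volume : Measure (Euc 2)).restrict (disk r)),
      ‖x 0 * (truncInv (‖x‖ ^ 2) - 1 / r ^ 2)‖ ≤ r * 3 := by
    filter_upwards [hmem] with x hx
    rw [norm_mul]
    exact mul_le_mul ((abs_coord_le x 0).trans hx.le) (htr _) (norm_nonneg _) hr0.le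
  have hgb : ∀ᵐ x ∂((volume : Measure (Euc 2)).restrict (disk r)),
      ‖radialGrad 0 (fun t => truncInv t - 1 / r ^ 2) truncInv' x‖ ≤ 3 + 2 * r * (K + 1) * r := by
    filter_upwards [hmem] with x hx
    exact norm_radialGrad_le 0 hr0.le hx.le (htr _) (htr' _)
  have hφ := fun n : ℕ => isTest_cutInv hr (hpos n)
  have hφg : ∀ n : ℕ, gradient
      (fun x : Euc 2 => x 0 * cutInv (1 / r ^ 2) (1 / ((n : ℝ) + 1)) (‖x‖ ^ 2)) =
      radialGrad 0 (cutInv (1 / r ^ 2) (1 / ((n : ℝ) + 1)))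
        (cutInv' (1 / r ^ 2) (1 / ((n : ℝ) + 1))) := fun n => by
    ext1 x
    exact gradient_radial 0 (hasDerivAt_cutInv _ (hpos n) _)
  rw [hgr]
  refine ⟨MemLp.of_bound hcu.aestronglyMeasurable _ hub,
    MemLp.of_bound hmg.aestronglyMeasurable _ hgb, _, hφ, ?_, ?_⟩
  · refine tendsto_eLpNorm_of_bounded hs (C := r * 3)
      (fun n => (hφ n).1.continuous.aestronglyMeasurable) hcu.aestronglyMeasurable (fun n => ?_)
      hub ?_
    · filter_upwards [hmem] with x hx
      rw [norm_mul]
      exact mul_le_mul ((abs_coord_le x 0).trans hx.le) (hcut n _) (norm_nonneg _) hr0.le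
    · filter_upwards [hmem] with x hx
      exact ((tendsto_cutInv (lt_truncInv hr (hsq hx))).comp hδ).const_mul _
  · refine tendsto_eLpNorm_of_bounded hs (C := 3 + 2 * r * (K + 1) * r)
      (fun n => (continuous_gradient (hφ n).1).aestronglyMeasurable) hmg.aestronglyMeasurable
      (fun n => ?_) hgb ?_
    · filter_upwards [hmem] with x hx
      rw [hφg]
      exact norm_radialGrad_le 0 hr0.le hx.le (hcut n _) (hcut' n _)
    · filter_upwards [hmem, ae_restrict_of_ae ae_norm_sq_ne_one] with x hx hx1
      simp only [hφg]
      exact tendsto_radialGrad 0 ((tendsto_cutInv (lt_truncInv hr (hsq hx))).comp hδ)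
        ((tendsto_cutInv' (lt_truncInv hr (hsq hx)) hx1).comp hδ)

end Competitor

/-! ### The harmonic competitors and their divergence free extensions -/

section Fields

variable {r : ℝ}

/-- The gradient of the harmonic competitor `a (x_0 + ε x_0 / max(|x|^2, 1))`. -/
noncomputable def compGrad (ε a : ℝ) (x : Euc 2) : Euc 2 := a • (e₀ + ε • truncGrad 0 x)

/-- The divergence free field that extends `compGrad` from the annulus. -/
noncomputable def fluxField (ε a : ℝ) (x : Euc 2) : Euc 2 :=
  a • (e₀ - ε • rot (truncGrad 1 x))

theorem measurable_fluxField (ε a : ℝ) : Measurable (fluxField ε a) :=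
  (((continuous_rot.measurable.comp (measurable_truncGrad 1)).const_smul ε).const_sub
    e₀).const_smul a

theorem exists_norm_fluxField_le (ε a : ℝ) (hr : 0 < r) :
    ∃ C, ∀ᵐ x ∂((volume : Measure (Euc 2)).restrict (disk r)), ‖fluxField ε a x‖ ≤ C := by
  refine ⟨|a| * (1 + |ε| * (2 * (1 + 2 * r * 1 * r))), ?_⟩
  filter_upwards [ae_restrict_mem Metric.isOpen_ball.measurableSet] with x hx
  unfold fluxField
  rw [norm_smul, Real.norm_eq_abs]
  gcongr
  refine (norm_sub_le _ _).trans ?_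
  rw [norm_e₀, norm_smul, Real.norm_eq_abs]
  gcongr
  refine (norm_rot_le _).trans ?_
  gcongr
  exact norm_truncGrad_le 1 hr.le (mem_ball_zero_iff.1 hx).le

theorem isW0_compGrad (hr : 1 < r) {s : ℝ} (hs : 0 < s) {ε a : ℝ}
    (ha : slope₀ r = a * (1 + ε / r ^ 2)) :
    IsW0 (ENNReal.ofReal s) (disk r) (fun x => ε * a * (x 0 * (truncInv (‖x‖ ^ 2) - 1 / r ^ 2)))
      (fun x => compGrad ε a x - bdryGrad r) := by
  have := (isW0_truncRadial hr hs).const_mul (ε * a)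
  convert! this using 2 with x
  unfold compGrad bdryGrad
  rw [ha]
  module

/-- The field is orthogonal to gradients of functions vanishing on the boundary. -/
theorem integral_inner_fluxField (hr : 1 < r) {p : ℝ≥0∞} (hp : 1 ≤ p) (ε a : ℝ)
    {u : Euc 2 → ℝ} {G : Euc 2 → Euc 2} (h : IsW0 p (disk r) u G) :
    ∫ x in disk r, inner ℝ (fluxField ε a x) (G x) = 0 := by
  have hr0 : 0 < r := by linarith
  obtain ⟨C, hC⟩ := exists_norm_fluxField_le ε a hr0
  refine h.integral_inner_eq_zero hp (measurable_fluxField ε a).aestronglyMeasurable hC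
    fun φ hφ => ?_
  have i1 : Integrable (fun x => inner ℝ e₀ (gradient φ x)) (volume.restrict (disk r)) :=
    ((hφ.memLp_gradient 1).integrable le_rfl).const_inner e₀
  have i2 : Integrable (fun x => inner ℝ (rot (truncGrad 1 x)) (gradient φ x))
      (volume.restrict (disk r)) := by
    obtain ⟨C', hC'⟩ := hφ.gradient_bounded
    refine Integrable.of_bound ((continuous_rot.measurable.comp (measurable_truncGrad 1)).inner
      (continuous_gradient hφ.1).measurable).aestronglyMeasurable
      (2 * (1 + 2 * r * 1 * r) * C') ?_
    filter_upwards [ae_restrict_mem Metric.isOpen_ball.measurableSet] with x hx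
    refine (norm_inner_le_norm _ _).trans ?_
    gcongr
    · refine (norm_rot_le _).trans ?_
      gcongr
      exact norm_truncGrad_le 1 hr0.le (mem_ball_zero_iff.1 hx).le
    · exact hC' x
  have e : ∀ x, inner ℝ (fluxField ε a x) (gradient φ x) =
      a * (inner ℝ e₀ (gradient φ x) - ε * inner ℝ (rot (truncGrad 1 x)) (gradient φ x)) := by
    intro x
    unfold fluxField
    rw [inner_smul_left, inner_sub_left, inner_smul_left]
    simp
  simp only [e]
  rw [integral_const_mul, integral_sub i1 (i2.const_mul ε), integral_const_mul,
    integral_inner_e₀_gradient hφ, integral_inner_rot_truncGrad hr0 hφ]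
  simp

theorem truncInv_of_one_lt {t : ℝ} (ht : 1 < t) : truncInv t = t⁻¹ := by
  rw [truncInv, max_eq_left ht.le]

theorem truncInv'_of_one_lt {t : ℝ} (ht : 1 < t) : truncInv' t = -(t ^ 2)⁻¹ := if_pos ht

theorem truncGrad_of_one_lt {x : Euc 2} (hx : 1 < ‖x‖) (i : Fin 2) :
    truncGrad i x = (‖x‖ ^ 2)⁻¹ • EuclideanSpace.single i 1 -
      (2 * x i * ((‖x‖ ^ 2) ^ 2)⁻¹) • x := by
  have h1 : 1 < ‖x‖ ^ 2 := one_lt_pow₀ hx two_ne_zero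
  unfold truncGrad radialGrad
  rw [truncInv_of_one_lt h1, truncInv'_of_one_lt h1]
  module

theorem truncGrad_of_lt_one {x : Euc 2} (hx : ‖x‖ < 1) (i : Fin 2) :
    truncGrad i x = EuclideanSpace.single i 1 := by
  have h1 : ‖x‖ ^ 2 < 1 := pow_lt_one₀ (norm_nonneg _) hx two_ne_zero
  unfold truncGrad radialGrad
  rw [truncInv, max_eq_right h1.le, truncInv', if_neg (not_lt.2 h1.le)]
  simp

/-- Outside the unit disk `x₁/|x|²` is, up to sign, the harmonic conjugate of `x₀/|x|²`, so rotating
its gradient gives minus the gradient of the latter. The two constructions differ only in how they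
extend into the disk: one as a gradient, the other as a divergence free field. -/
theorem compGrad_eq_fluxField {x : Euc 2} (hx : 1 < ‖x‖) (ε a : ℝ) :
    compGrad ε a x = fluxField ε a x := by
  unfold compGrad fluxField
  have hx0 : ‖x‖ ^ 2 ≠ 0 := by positivity
  have hn := norm_sq_eq x
  have key : rot (truncGrad 1 x) = - truncGrad 0 x := by
    rw [truncGrad_of_one_lt hx, truncGrad_of_one_lt hx]
    unfold rot
    ext i
    fin_cases i
    · simp [e₀, e₁]
      field_simp
      rw [hn]
      ring
    · simp [e₀, e₁]
      ring
  rw [key]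
  module

/-- For `ε = -1` this vanishes: the competitor is constant on the inner disk and pays nothing there,
whatever the weight. -/
theorem compGrad_of_lt_one {x : Euc 2} (hx : ‖x‖ < 1) (ε a : ℝ) :
    compGrad ε a x = (a * (1 + ε)) • e₀ := by
  unfold compGrad
  rw [truncGrad_of_lt_one hx, ← e₀]
  module

/-- For `ε = 1` this vanishes: no flux crosses the unit circle, so testing with this field ignores
the values of a competitor in the inner disk. -/
theorem fluxField_of_lt_one {x : Euc 2} (hx : ‖x‖ < 1) (ε a : ℝ) :
    fluxField ε a x = (a * (1 - ε)) • e₀ := by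
  unfold fluxField
  rw [truncGrad_of_lt_one hx]
  have : rot (EuclideanSpace.single 1 1) = e₀ := by
    simp [rot]
  rw [this]
  module

theorem norm_truncGrad_of_one_lt {x : Euc 2} (hx : 1 < ‖x‖) : ‖truncGrad 0 x‖ = 1 / ‖x‖ ^ 2 := by
  have hx0 : 0 < ‖x‖ ^ 2 := by positivity
  rw [← sq_eq_sq₀ (norm_nonneg _) (by positivity), truncGrad_of_one_lt hx, norm_sub_sq_real]
  simp only [norm_smul, mul_pow, inner_smul_left, inner_smul_right,
    EuclideanSpace.inner_single_left, Real.norm_eq_abs, sq_abs]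
  simp
  field_simp
  ring

end Fields

/-! ### Energy bounds on the two plateaus -/

section EnergyBounds

variable {h : ℝ → ℝ} {q t κ r c : ℝ}

/-- The profile is equal to `c` on the window `(t, t + log 10)`. -/
def IsPlateau (h : ℝ → ℝ) (t c : ℝ) : Prop := ∀ s ∈ Ioo (0 : ℝ) (Real.log 10), h (t + s) = c

/-- Norms in `(1, 10)` have logarithms in the window on which the profile is constant. -/
theorem IsPlateau.dens_eq (hp : IsPlateau h t c) {ξ : Euc 2} (h1 : 1 < ‖ξ‖) (h2 : ‖ξ‖ < 10) :
    dens h t ξ = c * ‖ξ‖ ^ 2 := by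
  unfold dens
  rw [hp _ ⟨Real.log_pos h1, Real.log_lt_log (by linarith) h2⟩, mul_comm]

theorem IsPlateau.flux_eq (hp : IsPlateau h t c) {ξ : Euc 2} (h1 : 1 < ‖ξ‖) (h2 : ‖ξ‖ < 10) :
    flux h t ξ = (2 * c) • ξ := by
  have hm : Real.log ‖ξ‖ ∈ Ioo (0 : ℝ) (Real.log 10) :=
    ⟨Real.log_pos h1, Real.log_lt_log (by linarith) h2⟩
  have he : h =ᶠ[𝓝 (t + Real.log ‖ξ‖)] fun _ => c := by
    have : Ioo t (t + Real.log 10) ∈ 𝓝 (t + Real.log ‖ξ‖) :=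
      Ioo_mem_nhds (by linarith [hm.1]) (by linarith [hm.2])
    filter_upwards [this] with y hy
    have := hp (y - t) ⟨by linarith [hy.1], by linarith [hy.2]⟩
    rwa [add_sub_cancel] at this
  unfold flux logCoef
  rw [he.deriv_eq, he.eq_of_nhds, deriv_const, add_zero]

theorem volume_disk (hr : 0 ≤ r) : (volume : Measure (Euc 2)) (disk r) =
    ENNReal.ofReal (Real.pi * r ^ 2) := by
  rw [disk, EuclideanSpace.volume_ball_fin_two, ENNReal.ofReal_mul Real.pi_pos.le,
    ENNReal.ofReal_pow hr, mul_comm]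

theorem measureReal_disk (hr : 0 ≤ r) :
    (volume : Measure (Euc 2)).real (disk r) = Real.pi * r ^ 2 := by
  rw [Measure.real, volume_disk hr, ENNReal.toReal_ofReal (by positivity)]

theorem measureReal_annulus (hr : 1 < r) :
    (volume : Measure (Euc 2)).real (annulus r) = Real.pi * r ^ 2 - Real.pi := by
  have h1 := congrArg (fun μ => μ univ) (restrict_disk_eq hr)
  simp only [Measure.add_apply, Measure.restrict_apply_univ] at h1
  have h2 : (volume : Measure (Euc 2)).real (disk r) =
      (volume : Measure (Euc 2)).real (annulus r) + (volume : Measure (Euc 2)).real (disk 1) := by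
    unfold Measure.real
    rw [h1, ENNReal.toReal_add]
    · exact ((measure_mono (annulus_subset r)).trans_lt measure_ball_lt_top).ne
    · exact measure_ball_lt_top.ne
  rw [measureReal_disk (by linarith), measureReal_disk zero_le_one] at h2
  linarith

/-- A slope near `7` leaves room on both sides in `(1, 10)` for the perturbation by the inner disk.
-/
theorem slope₀_bounds (hr : 100 ≤ r) : 7 ≤ slope₀ r ∧ slope₀ r ≤ 7.1 := by
  unfold slope₀
  have h1 : 10000 ≤ r ^ 2 := by nlinarith
  have h2 : 12 / r ^ 2 ≤ 0.1 := by
    rw [div_le_iff₀ (by positivity)]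
    nlinarith
  have h3 : 0 ≤ 12 / r ^ 2 := by positivity
  constructor <;> linarith

theorem norm_compGrad_le {ε a : ℝ} (hε : |ε| = 1) {x : Euc 2} (hx : 1 < ‖x‖) :
    ‖compGrad ε a x‖ ≤ |a| * (1 + 1 / ‖x‖ ^ 2) := by
  unfold compGrad
  rw [norm_smul, Real.norm_eq_abs]
  gcongr
  refine (norm_add_le _ _).trans ?_
  rw [norm_e₀, norm_smul, Real.norm_eq_abs, hε, one_mul, norm_truncGrad_of_one_lt hx]

theorem le_norm_compGrad {ε a : ℝ} (hε : |ε| = 1) {x : Euc 2} (hx : 1 < ‖x‖) :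
    |a| * (1 - 1 / ‖x‖ ^ 2) ≤ ‖compGrad ε a x‖ := by
  unfold compGrad
  rw [norm_smul, Real.norm_eq_abs]
  gcongr
  have := norm_sub_le (e₀ + ε • truncGrad 0 x) (ε • truncGrad 0 x)
  rw [add_sub_cancel_right, norm_e₀, norm_smul, Real.norm_eq_abs, hε, one_mul,
    norm_truncGrad_of_one_lt hx] at this
  linarith

theorem one_div_sq_le {x : Euc 2} (hx : 10 ≤ ‖x‖) : 1 / ‖x‖ ^ 2 ≤ 0.01 := by
  rw [div_le_iff₀ (by positivity)]
  nlinarith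

theorem one_div_sq_le_one {x : Euc 2} (hx : 1 < ‖x‖) : 1 / ‖x‖ ^ 2 ≤ 1 := by
  rw [div_le_one (by positivity)]
  nlinarith

/-- The slope of the competitor that is constant on the inner disk. -/
noncomputable def outerSlope (r : ℝ) : ℝ := slope₀ r / (1 + (-1) / r ^ 2)

theorem outerSlope_spec (hr : 1 < r) : slope₀ r = outerSlope r * (1 + (-1) / r ^ 2) := by
  unfold outerSlope
  have : 1 + (-1) / r ^ 2 ≠ 0 := by
    have h1 : 1 < r ^ 2 := one_lt_pow₀ hr two_ne_zero
    have h2 : 1 / r ^ 2 < 1 := by rw [div_lt_one (by positivity)]; exact h1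
    rw [neg_div]
    linarith
  exact (div_mul_cancel₀ _ this).symm

theorem outerSlope_bounds (hr : 100 ≤ r) :
    7 ≤ outerSlope r ∧ outerSlope r ≤ 7.2 ∧ outerSlope r ^ 2 ≤ 1.001 * slope₀ r ^ 2 := by
  obtain ⟨s1, s2⟩ := slope₀_bounds hr
  have hs := outerSlope_spec (r := r) (by linarith)
  have h1 : 10000 ≤ r ^ 2 := by nlinarith
  have h2 : 1 / r ^ 2 ≤ 0.0001 := by
    rw [div_le_iff₀ (by positivity)]
    nlinarith
  have h3 : 0 ≤ 1 / r ^ 2 := by positivity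
  rw [neg_div] at hs
  set y := 1 / r ^ 2
  set a := outerSlope r
  have ha : 0 < a := by
    by_contra! hc
    nlinarith
  have ha1 : slope₀ r ≤ a := by nlinarith
  have ha2 : a * 0.9999 ≤ slope₀ r := by nlinarith
  refine ⟨by linarith, by linarith, ?_⟩
  nlinarith

/-- The competitor has no energy on the inner disk. -/
theorem setLIntegral_compGrad_disk_one (hq : 0 < q) (a : ℝ) :
    ∫⁻ x in disk 1, ENNReal.ofReal (‖compGrad (-1) a x‖ ^ q) = 0 := by
  rw [← lintegral_zero (μ := (volume : Measure (Euc 2)).restrict (disk 1))]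
  refine setLIntegral_congr_fun Metric.isOpen_ball.measurableSet fun x hx => ?_
  rw [compGrad_of_lt_one (mem_ball_zero_iff.1 hx)]
  simp [Real.zero_rpow hq.ne']

/-- The bound is uniform in `t` and `κ`: nothing is paid in the inner disk, and `‖compGrad‖ ≤ 2|a|`
with a density of at most `3|ξ|²` gives `12 a²`. -/
theorem gradEnergy_compGrad_lt_top (hh : IsSlow h) (hq : 0 < q) (a : ℝ) :
    gradEnergy h q t κ r (compGrad (-1) a) ≤
      ENNReal.ofReal (12 * a ^ 2) * volume (disk r) := by
  unfold gradEnergy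
  rw [setLIntegral_compGrad_disk_one hq, mul_zero, add_zero]
  have : ∫⁻ x in annulus r, ENNReal.ofReal (dens h t (compGrad (-1) a x)) ≤
      ∫⁻ _ in annulus r, ENNReal.ofReal (12 * a ^ 2) := by
    refine setLIntegral_mono' (measurableSet_annulus r) fun x hx => ENNReal.ofReal_le_ofReal ?_
    have hx1 := (mem_annulus.1 hx).1
    refine (hh.dens_bounds t _).2.trans ?_
    have h1 := norm_compGrad_le (ε := -1) (a := a) (by simp) hx1
    have h2 := one_div_sq_le_one hx1
    have h3 : ‖compGrad (-1) a x‖ ≤ 2 * |a| := by nlinarith [abs_nonneg a]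
    have h4 := pow_le_pow_left₀ (norm_nonneg _) h3 2
    rw [mul_pow, sq_abs] at h4
    linarith
  refine this.trans ?_
  rw [setLIntegral_const]
  gcongr
  exact annulus_subset r

/-- The upper bound for the energy on the plateau `2`. -/
theorem gradEnergy_compGrad_le (hh : IsSlow h) (hp : IsPlateau h t 2) (hq : 0 < q)
    (hr : 100 ≤ r) : gradEnergy h q t κ r (compGrad (-1) (outerSlope r)) ≤
      ENNReal.ofReal (2.3 * slope₀ r ^ 2 * (Real.pi * r ^ 2)) := by
  obtain ⟨a1, a2, a3⟩ := outerSlope_bounds hr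
  set a := outerSlope r
  have hpi := Real.pi_pos
  unfold gradEnergy
  rw [setLIntegral_compGrad_disk_one hq, mul_zero, add_zero]
  -- In `|x| < 10` only the crude bound `3 (2a)² = 12a²` is available. Beyond, the norm lies between
  -- `0.99 a` and `1.01 a`, inside the window, and the density is at most `2 · 1.01² a² = 2.0402
  -- a²`.
  have h1 : ∫⁻ x in annulus r, ENNReal.ofReal (dens h t (compGrad (-1) a x)) ≤
      ∫⁻ x in disk r, ((disk 10).indicator (fun _ => ENNReal.ofReal (12 * a ^ 2)) x +
        ENNReal.ofReal (2.0402 * a ^ 2)) := by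
    refine le_trans (setLIntegral_mono' (measurableSet_annulus r) fun x hx => ?_)
      (lintegral_mono' (restrict_annulus_le r) le_rfl)
    have hx1 := (mem_annulus.1 hx).1
    have h1 := norm_compGrad_le (ε := -1) (a := a) (by simp) hx1
    have h2 := le_norm_compGrad (ε := -1) (a := a) (by simp) hx1
    rw [abs_of_pos (by linarith)] at h1 h2
    by_cases hx2 : ‖x‖ < 10
    · rw [indicator_of_mem (mem_ball_zero_iff.2 hx2)]
      refine le_trans (ENNReal.ofReal_le_ofReal ?_) le_self_add
      have h3 := one_div_sq_le_one hx1
      have h4 : ‖compGrad (-1) a x‖ ≤ 2 * a := by nlinarith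
      have h5 := pow_le_pow_left₀ (norm_nonneg _) h4 2
      linarith [(hh.dens_bounds t (compGrad (-1) a x)).2]
    · refine le_trans (ENNReal.ofReal_le_ofReal ?_) le_add_self
      have h3 := one_div_sq_le (not_lt.1 hx2)
      rw [hp.dens_eq (by nlinarith) (by nlinarith)]
      have h4 : ‖compGrad (-1) a x‖ ≤ 1.01 * a := by nlinarith
      have h5 := pow_le_pow_left₀ (norm_nonneg _) h4 2
      linarith
  refine h1.trans ?_
  rw [lintegral_add_right _ measurable_const, lintegral_indicator Metric.isOpen_ball.measurableSet,
    Measure.restrict_restrict Metric.isOpen_ball.measurableSet,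
    inter_eq_left.2 (Metric.ball_subset_ball (by linarith)), setLIntegral_const, setLIntegral_const,
    volume_disk (by norm_num), volume_disk (by linarith), ← ENNReal.ofReal_mul (by positivity),
    ← ENNReal.ofReal_mul (by positivity), ← ENNReal.ofReal_add (by positivity) (by positivity)]
  refine ENNReal.ofReal_le_ofReal ?_
  have hr2 : 10000 ≤ r ^ 2 := by nlinarith
  -- As `r ≥ 100`, the core costs at most `1200 ≤ 0.12 r²`; the margin up to `2.3` pays for
  -- replacing `a²` by `1.001 γ²`.
  have e1 : 12 * a ^ 2 * (Real.pi * 10 ^ 2) + 2.0402 * a ^ 2 * (Real.pi * r ^ 2) ≤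
      2.1602 * a ^ 2 * (Real.pi * r ^ 2) := by
    have : 0 ≤ a ^ 2 * Real.pi := by positivity
    nlinarith
  refine e1.trans (mul_le_mul_of_nonneg_right ?_ (by positivity))
  linarith [sq_nonneg (slope₀ r)]

/-- No sign is assumed: the calibrated lower bound for the energy may be negative at some points. -/
theorem ofReal_integral_le_lintegral {α : Type*} [MeasurableSpace α] {μ : Measure α} {f : α → ℝ}
    (hf : Integrable f μ) : ENNReal.ofReal (∫ x, f x ∂μ) ≤ ∫⁻ x, ENNReal.ofReal (f x) ∂μ := by
  refine (ENNReal.ofReal_le_ofReal ?_).trans ENNReal.ofReal_toReal_le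
  rw [integral_eq_lintegral_pos_part_sub_lintegral_neg_part hf]
  linarith [ENNReal.toReal_nonneg (a := ∫⁻ a, ENNReal.ofReal (-f a) ∂μ)]

theorem setIntegral_disk_eq {E : Type*} [NormedAddCommGroup E] [NormedSpace ℝ E] (hr : 1 < r)
    {f : Euc 2 → E} (hf : IntegrableOn f (disk r)) :
    ∫ x in disk r, f x = (∫ x in annulus r, f x) + ∫ x in disk 1, f x := by
  rw [restrict_disk_eq hr]
  exact integral_add_measure (hf.mono_set (annulus_subset r)) (hf.mono_set (disk_one_subset hr))

theorem integrableOn_inner_fluxField (hr : 0 < r) {p : ℝ≥0∞} (hp : 1 ≤ p) (ε a : ℝ)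
    {G : Euc 2 → Euc 2} (hG : MemLp G p (volume.restrict (disk r))) :
    IntegrableOn (fun x => inner ℝ (fluxField ε a x) (G x)) (disk r) := by
  obtain ⟨C, hC⟩ := exists_norm_fluxField_le ε a hr
  have h1 : Integrable (fun x => |C| * ‖G x‖) (volume.restrict (disk r)) :=
    ((hG.integrable hp).norm).const_mul _
  refine h1.mono' ((measurable_fluxField ε a).aestronglyMeasurable.inner hG.1) ?_
  filter_upwards [hC] with x hx
  refine (norm_inner_le_norm _ _).trans ?_
  gcongr
  exact hx.trans (le_abs_self C)

/-- The lower bound for the energy on the plateau `3`. -/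
theorem le_gradEnergy (hh : IsSlow h) (hp : IsPlateau h t 3) (hr : 100 ≤ r) {p : ℝ≥0∞}
    (hp1 : 1 ≤ p) {u : Euc 2 → ℝ} {G : Euc 2 → Euc 2}
    (hG : IsW0 p (disk r) u (fun x => G x - bdryGrad r)) :
    ENNReal.ofReal (2.5 * slope₀ r ^ 2 * (Real.pi * r ^ 2)) ≤ gradEnergy h q t κ r G := by
  obtain ⟨s1, s2⟩ := slope₀_bounds hr
  have hr1 : 1 < r := by linarith
  have hr0 : 0 < r := by linarith
  set γ := slope₀ r with hγ
  have hpi := Real.pi_pos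
  -- The calibration. This field vanishes on the inner disk and is orthogonal to `G - ∇(γ x₀)` on
  -- the large disk, hence on the annulus alone.
  set F := fluxField 1 γ with hF
  have hz := integral_inner_fluxField hr1 hp1 1 γ hG
  have hint := integrableOn_inner_fluxField hr0 hp1 1 γ hG.2.1
  rw [setIntegral_disk_eq hr1 hint] at hz
  have hz1 : ∫ x in disk 1, inner ℝ (fluxField 1 γ x) (G x - bdryGrad r) = 0 := by
    refine setIntegral_eq_zero_of_forall_eq_zero fun x hx => ?_
    rw [fluxField_of_lt_one (mem_ball_zero_iff.1 hx)]
    simp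
  rw [hz1, add_zero] at hz
  set D : Set (Euc 2) := disk 10
  have hD : MeasurableSet D := Metric.isOpen_ball.measurableSet
  -- For `|x| ≥ 10` the tangent inequality at `F`, with density `3|F|²` and flux `6F`, leaves `6γ⟪F,
  -- e₀⟫ - 3|F|² ≥ (5.94 - 3.0603) γ²`. For `|x| < 10` one has only `2|G|² ≥ 6|F||G| - (9/2)|F|²`,
  -- with `(9/2)|F|² ≤ 18γ²`, below the `18.2γ²` that the indicator leaves to be subtracted.
  have key : ∀ x ∈ annulus r, 6 * inner ℝ (F x) (G x - bdryGrad r) +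
      (2.8 * γ ^ 2 - D.indicator (fun _ => 21 * γ ^ 2) x) ≤ dens h t (G x) := by
    intro x hx
    have hx1 := (mem_annulus.1 hx).1
    have hFx : F x = compGrad 1 γ x := (compGrad_eq_fluxField hx1 1 γ).symm
    have h1 := norm_compGrad_le (ε := 1) (a := γ) (by simp) hx1
    have h2 := le_norm_compGrad (ε := 1) (a := γ) (by simp) hx1
    rw [abs_of_pos (by linarith), ← hFx] at h1 h2
    have h3 : γ * (1 - 1 / ‖x‖ ^ 2) ≤ inner ℝ (F x) e₀ := by
      rw [hFx]
      unfold compGrad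
      rw [inner_smul_left, inner_add_left, inner_smul_left, real_inner_self_eq_norm_sq, norm_e₀]
      have := abs_le.1 (abs_real_inner_le_norm (truncGrad 0 x) e₀)
      rw [norm_e₀, mul_one, norm_truncGrad_of_one_lt hx1] at this
      simp only [conj_trivial]
      have h0 : 0 ≤ γ := by linarith
      gcongr
      linarith [this.1]
    have hb : inner ℝ (F x) (bdryGrad r) = γ * inner ℝ (F x) e₀ := by
      rw [bdryGrad, inner_smul_right]
    rw [inner_sub_right, hb]
    by_cases hx2 : ‖x‖ < 10
    · rw [indicator_of_mem (mem_ball_zero_iff.2 hx2)]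
      have h4 := one_div_sq_le_one hx1
      have h5 : ‖F x‖ ≤ 2 * γ := by nlinarith
      have h6 := (hh.dens_bounds t (G x)).1
      have h7 := real_inner_le_norm (F x) (G x)
      have h8 : 0 ≤ inner ℝ (F x) e₀ := by
        refine le_trans ?_ h3
        have h0 : 0 ≤ γ := by linarith
        exact mul_nonneg h0 (by linarith)
      have h9 := pow_le_pow_left₀ (norm_nonneg _) h5 2
      have h10 : 0 ≤ γ * inner ℝ (F x) e₀ := mul_nonneg (by linarith) h8
      nlinarith [sq_nonneg (3 * ‖F x‖ - 2 * ‖G x‖)]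
    · rw [indicator_of_notMem (fun hm => hx2 (mem_ball_zero_iff.1 hm))]
      have h4 := one_div_sq_le (not_lt.1 hx2)
      have h5 : ‖F x‖ ≤ 1.01 * γ := by nlinarith
      have h6 : 0.99 * γ ≤ ‖F x‖ := by nlinarith
      have h7 := hh.dens_tangent_le t (G x) (F x)
      rw [hp.dens_eq (by linarith) (by linarith), hp.flux_eq (by linarith) (by linarith),
        inner_smul_left, inner_sub_right, real_inner_self_eq_norm_sq] at h7
      simp only [conj_trivial] at h7
      have h8 := pow_le_pow_left₀ (norm_nonneg _) h5 2
      have h9 : 0.99 * γ ≤ inner ℝ (F x) e₀ := by nlinarith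
      have h10 : γ * (0.99 * γ) ≤ γ * inner ℝ (F x) e₀ := by
        have h0 : 0 ≤ γ := by linarith
        gcongr
      nlinarith [sq_nonneg ‖G x - F x‖]
  have i1 : Integrable (fun x => 6 * inner ℝ (F x) (G x - bdryGrad r))
      (volume.restrict (annulus r)) := (hint.mono_set (annulus_subset r)).const_mul 6
  have i2 : Integrable (fun x => D.indicator (fun _ => 21 * γ ^ 2) x)
      (volume.restrict (annulus r)) := (integrable_const _).indicator hD
  have i3 : Integrable (fun _ : Euc 2 => 2.8 * γ ^ 2) (volume.restrict (annulus r)) :=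
    integrable_const _
  -- The pairing with `F` integrates to zero, and the loss `2.8π + 2100π` near the inner disk is
  -- less than `0.3πr²` for `r ≥ 100`.
  have hI : 2.5 * γ ^ 2 * (Real.pi * r ^ 2) ≤ ∫ x in annulus r,
      (6 * inner ℝ (F x) (G x - bdryGrad r) +
      (2.8 * γ ^ 2 - D.indicator (fun _ => 21 * γ ^ 2) x)) := by
    have i4 : Integrable (fun x => 2.8 * γ ^ 2 - D.indicator (fun _ => 21 * γ ^ 2) x)
        (volume.restrict (annulus r)) := i3.sub i2
    rw [integral_add i1 i4, integral_const_mul, hz, integral_sub i3 i2,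
      integral_indicator hD, setIntegral_const, Measure.restrict_restrict hD, setIntegral_const,
      measureReal_annulus hr1, smul_eq_mul, smul_eq_mul]
    have hm : (volume : Measure (Euc 2)).real (D ∩ annulus r) ≤ Real.pi * 10 ^ 2 := by
      rw [← measureReal_disk (by norm_num : (0 : ℝ) ≤ 10)]
      exact measureReal_mono inter_subset_left measure_ball_lt_top.ne
    have hr2 : 10000 ≤ r ^ 2 := by nlinarith
    have h1 : (volume : Measure (Euc 2)).real (D ∩ annulus r) * (21 * γ ^ 2) ≤
        Real.pi * 10 ^ 2 * (21 * γ ^ 2) := by gcongr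
    have h2 : 0 ≤ γ ^ 2 * Real.pi := by positivity
    have h3 : 0 ≤ γ ^ 2 * Real.pi * (r ^ 2 - 10000) := mul_nonneg h2 (by linarith)
    linarith
  calc _ ≤ ENNReal.ofReal (∫ x in annulus r, (6 * inner ℝ (F x) (G x - bdryGrad r) +
      (2.8 * γ ^ 2 - D.indicator (fun _ => 21 * γ ^ 2) x))) := ENNReal.ofReal_le_ofReal hI
    _ ≤ ∫⁻ x in annulus r, ENNReal.ofReal (6 * inner ℝ (F x) (G x - bdryGrad r) +
      (2.8 * γ ^ 2 - D.indicator (fun _ => 21 * γ ^ 2) x)) :=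
        ofReal_integral_le_lintegral (i1.add (i3.sub i2))
    _ ≤ ∫⁻ x in annulus r, ENNReal.ofReal (dens h t (G x)) :=
        setLIntegral_mono' (measurableSet_annulus r) fun x hx => ENNReal.ofReal_le_ofReal (key x hx)
    _ ≤ _ := le_self_add

end EnergyBounds

/-! ### Lower semicontinuity and the Euler-Lagrange inequality -/

section WeakLimits

variable {d : ℕ} {μ : Measure (Euc d)} {h : ℝ → ℝ} {T : ℝ} {f g : Euc d → Euc d}

theorem IsSlow.integrable_dens (hh : IsSlow h) (t : ℝ) (hg : MemLp g 2 μ) :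
    Integrable (fun x => dens h t (g x)) μ := by
  have h1 : Integrable (fun x => 3 * ‖g x‖ ^ 2) μ :=
    (hg.integrable_norm_pow two_ne_zero).const_mul 3
  refine h1.mono' ((hh.continuous_dens t).comp_aestronglyMeasurable hg.1)
    (Eventually.of_forall fun x => ?_)
  rw [Real.norm_of_nonneg (hh.dens_nonneg t _)]
  exact (hh.dens_bounds t _).2

theorem IsSlow.memLp_flux (hh : IsSlow h) (t : ℝ) (hg : MemLp g 2 μ) :
    MemLp (fun x => flux h t (g x)) 2 μ :=
  hg.of_le_mul (c := 7) ((hh.continuous_vflux t).comp_aestronglyMeasurable hg.1)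
    (Eventually.of_forall fun x => hh.norm_flux_le t (g x))

theorem integrable_inner (hf : MemLp f 2 μ) (hg : MemLp g 2 μ) :
    Integrable (fun x => inner ℝ (f x) (g x)) μ :=
  (hf.norm.integrable_mul hg.norm).mono' (hf.1.inner hg.1)
    (Eventually.of_forall fun _ => norm_inner_le_norm _ _)

theorem lintegral_dens_eq (hh : IsSlow h) (t : ℝ) (hg : MemLp g 2 μ) :
    ∫⁻ x, ENNReal.ofReal (dens h t (g x)) ∂μ = ENNReal.ofReal (∫ x, dens h t (g x) ∂μ) :=
  (ofReal_integral_eq_lintegral_ofReal (hh.integrable_dens t hg)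
    (Eventually.of_forall fun _ => hh.dens_nonneg t _)).symm

/-- Weak lower semicontinuity. -/
theorem integral_dens_le_of_weak (hh : IsSlow h) (t : ℝ) (hg : MemLp g 2 μ)
    {G : ℕ → Euc d → Euc d} (hG : ∀ n, MemLp (G n) 2 μ)
    (hweak : ∀ k : Euc d → Euc d, MemLp k 2 μ →
      Tendsto (fun n => ∫ x, inner ℝ (G n x) (k x) ∂μ) atTop (𝓝 (∫ x, inner ℝ (g x) (k x) ∂μ)))
    {c : ℝ} {δ : ℕ → ℝ} (hδ : Tendsto δ atTop (𝓝 0))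
    (hle : ∀ n, ∫ x, dens h t (G n x) ∂μ ≤ c + δ n) :
    ∫ x, dens h t (g x) ∂μ ≤ c := by
  have hk := hh.memLp_flux t hg
  -- The tangent inequality is taken at the limit `g`, so that only linear terms in `G n` remain,
  -- and `flux (g)` is an admissible test field.
  have h1 : ∀ n, ∫ x, dens h t (g x) ∂μ + (∫ x, inner ℝ (G n x) (flux h t (g x)) ∂μ -
      ∫ x, inner ℝ (g x) (flux h t (g x)) ∂μ) ≤ c + δ n := by
    intro n
    refine le_trans ?_ (hle n)
    have i1 : Integrable (fun x => inner ℝ (G n x) (flux h t (g x)) -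
        inner ℝ (g x) (flux h t (g x))) μ :=
      (integrable_inner (hG n) hk).sub (integrable_inner hg hk)
    rw [← integral_sub (integrable_inner (hG n) hk) (integrable_inner hg hk),
      ← integral_add (hh.integrable_dens t hg) i1]
    refine integral_mono ((hh.integrable_dens t hg).add i1) (hh.integrable_dens t (hG n))
      fun x => ?_
    have := hh.dens_tangent_le t (G n x) (g x)
    rw [inner_sub_right, real_inner_comm (G n x), real_inner_comm (g x)] at this
    linarith [sq_nonneg ‖G n x - g x‖]
  have h2 := ((hweak _ hk).sub_const (∫ x, inner ℝ (g x) (flux h t (g x)) ∂μ)).const_add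
    (∫ x, dens h t (g x) ∂μ)
  rw [sub_self, add_zero] at h2
  have h3 := hδ.const_add c
  rw [add_zero] at h3
  exact le_of_tendsto_of_tendsto' h2 h3 h1

/-- A field of smaller energy with the same pairing is equal to the reference field. -/
theorem ae_eq_of_integral_norm_sq_le (hf : MemLp f 2 μ) (hg : MemLp g 2 μ)
    (hle : ∫ x, ‖g x‖ ^ 2 ∂μ ≤ ∫ x, ‖f x‖ ^ 2 ∂μ)
    (horth : ∫ x, inner ℝ (f x) (g x) ∂μ = ∫ x, ‖f x‖ ^ 2 ∂μ) : g =ᵐ[μ] f := by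
  have i1 := hf.integrable_norm_pow two_ne_zero
  have i2 := hg.integrable_norm_pow two_ne_zero
  have i3 := integrable_inner hf hg
  have e : ∀ x, ‖g x - f x‖ ^ 2 = ‖g x‖ ^ 2 + ‖f x‖ ^ 2 - 2 * inner ℝ (f x) (g x) := fun x => by
    rw [norm_sub_sq_real, real_inner_comm]
    ring
  have i4 : Integrable (fun x => ‖g x - f x‖ ^ 2) μ := by
    simp only [e]
    exact (i2.add i1).sub (i3.const_mul 2)
  have i5 : Integrable (fun x => ‖g x‖ ^ 2 + ‖f x‖ ^ 2) μ := i2.add i1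
  have h0 : ∫ x, ‖g x - f x‖ ^ 2 ∂μ = 0 := by
    refine le_antisymm ?_ (integral_nonneg fun x => sq_nonneg _)
    simp only [e]
    rw [integral_sub i5 (i3.const_mul 2), integral_add i2 i1, integral_const_mul, horth]
    linarith
  rw [integral_eq_zero_iff_of_nonneg (fun x => sq_nonneg _) i4] at h0
  filter_upwards [h0] with x hx
  exact sub_eq_zero.1 (norm_eq_zero.1 (pow_eq_zero_iff two_ne_zero |>.1 hx))

/-- The Euler-Lagrange inequality. -/
theorem integral_inner_flux_nonneg (hh : IsSlow h) (t : ℝ) (hf : MemLp f 2 μ) (hg : MemLp g 2 μ)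
    (hmin : ∀ s : ℝ, ∫ x, dens h t (f x) ∂μ ≤ ∫ x, dens h t (f x + s • g x) ∂μ) :
    0 ≤ ∫ x, inner ℝ (flux h t (f x)) (g x) ∂μ := by
  have hmem : ∀ s : ℝ, MemLp (fun x => f x + s • g x) 2 μ := fun s => hf.add (hg.const_smul s)
  -- Convexity with the tangent at the perturbed point `f + s g` gives the sign for each `s > 0`,
  -- without differentiating under the integral; it remains to let `s` tend to `0` by dominated
  -- convergence.
  have h1 : ∀ s : ℝ, 0 < s → 0 ≤ ∫ x, inner ℝ (flux h t (f x + s • g x)) (g x) ∂μ := by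
    intro s hs
    have i1 := hh.integrable_dens t (hmem s)
    have i2 := (integrable_inner (hh.memLp_flux t (hmem s)) hg).const_mul s
    have h2 : ∫ x, dens h t (f x + s • g x) ∂μ -
        ∫ x, s * inner ℝ (flux h t (f x + s • g x)) (g x) ∂μ ≤ ∫ x, dens h t (f x) ∂μ := by
      rw [← integral_sub i1 i2]
      refine integral_mono (i1.sub i2) (hh.integrable_dens t hf) fun x => ?_
      have := hh.dens_tangent_le t (f x) (f x + s • g x)
      rw [show f x - (f x + s • g x) = (-s) • g x by module, inner_smul_right] at this
      linarith [sq_nonneg ‖(-s) • g x‖]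
    rw [integral_const_mul] at h2
    have h3 := hmin s
    by_contra! hc
    nlinarith
  have hlim : Tendsto (fun s : ℝ => ∫ x, inner ℝ (flux h t (f x + s • g x)) (g x) ∂μ) (𝓝[>] 0)
      (𝓝 (∫ x, inner ℝ (flux h t (f x)) (g x) ∂μ)) := by
    refine tendsto_integral_filter_of_dominated_convergence
      (fun x => 7 * (‖f x‖ * ‖g x‖ + ‖g x‖ ^ 2)) ?_ ?_ ?_ ?_
    · exact Eventually.of_forall fun s => (integrable_inner (hh.memLp_flux t (hmem s)) hg).1
    · have hm : Iio (1 : ℝ) ∈ 𝓝[>] (0 : ℝ) := nhdsWithin_le_nhds (Iio_mem_nhds one_pos)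
      filter_upwards [self_mem_nhdsWithin, hm] with s hs0 hs1
      refine Eventually.of_forall fun x => (norm_inner_le_norm _ _).trans ?_
      have h2 := hh.norm_flux_le t (f x + s • g x)
      have h3 : ‖f x + s • g x‖ ≤ ‖f x‖ + ‖g x‖ := by
        refine (norm_add_le _ _).trans ?_
        gcongr
        rw [norm_smul, Real.norm_of_nonneg (le_of_lt hs0)]
        exact mul_le_of_le_one_left (norm_nonneg _) (le_of_lt hs1)
      calc _ ≤ 7 * (‖f x‖ + ‖g x‖) * ‖g x‖ := by gcongr; linarith
        _ = _ := by ring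
    · have i1 : Integrable (fun x => ‖f x‖ * ‖g x‖) μ := hf.norm.integrable_mul hg.norm
      exact (i1.add (hg.integrable_norm_pow two_ne_zero)).const_mul 7
    · refine Eventually.of_forall fun x => ?_
      have hc : Continuous fun s : ℝ => inner ℝ (flux h t (f x + s • g x)) (g x) :=
        ((hh.continuous_vflux t).comp (by fun_prop)).inner continuous_const
      have := hc.tendsto 0
      rw [zero_smul, add_zero] at this
      exact this.mono_left nhdsWithin_le_nhds
  refine ge_of_tendsto hlim ?_
  filter_upwards [self_mem_nhdsWithin] with s hs
  exact h1 s hs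

end WeakLimits

/-! ### Identification of a weak limit of minimizers -/

section LimitField

variable {h : ℝ → ℝ} {T q r : ℝ} {u : ℝ → Euc 2 → ℝ} {G : ℝ → Euc 2 → Euc 2} {g : Euc 2 → Euc 2}

theorem memLp_two_of_gradEnergy_lt_top (hh : IsSlow h) {t κ : ℝ} {G : Euc 2 → Euc 2}
    (hG : AEStronglyMeasurable G (volume.restrict (annulus r)))
    (hE : gradEnergy h q t κ r G < ⊤) : MemLp G 2 (volume.restrict (annulus r)) := by
  have := (memLp_ofReal_iff two_pos hG).2 (by
    simp only [Real.rpow_two]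
    exact (hh.lintegral_sq_le _).trans_lt hE)
  simpa only [ENNReal.ofReal_ofNat] using this

/-- A family of minimizers, indexed by `s = log λ`, whose fields converge weakly in `L^2` of the
annulus to `g`. -/
structure IsWeakFamily (h : ℝ → ℝ) (q r : ℝ) (u : ℝ → Euc 2 → ℝ) (G : ℝ → Euc 2 → Euc 2)
    (g : Euc 2 → Euc 2) : Prop where
  minimizer : ∀ s, IsGradMinimizer h q s (Real.exp ((q - 2) * s)) r (bdryGrad r) (u s) (G s)
  memLp : MemLp g 2 (volume.restrict (annulus r))
  weak : ∀ k : Euc 2 → Euc 2, MemLp k 2 (volume.restrict (annulus r)) →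
    Tendsto (fun s => ∫ x in annulus r, inner ℝ (G s x) (k x)) atTop
      (𝓝 (∫ x in annulus r, inner ℝ (g x) (k x)))

theorem IsWeakFamily.gradEnergy_lt_top (hf : IsWeakFamily h q r u G g) (s : ℝ) :
    gradEnergy h q s (Real.exp ((q - 2) * s)) r (G s) < ⊤ := by
  refine ((hf.minimizer s).2 (fun _ => 0) (fun _ => bdryGrad r) ?_).trans_lt
    (gradEnergy_const_lt_top _)
  simpa using isW0_zero

theorem IsWeakFamily.memLp_annulus (hf : IsWeakFamily h q r u G g) (hh : IsSlow h) (s : ℝ) :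
    MemLp (G s) 2 (volume.restrict (annulus r)) :=
  memLp_two_of_gradEnergy_lt_top hh ((aestronglyMeasurable_of_isW0_sub
    (hf.minimizer s).1).mono_measure (restrict_annulus_le r)) (hf.gradEnergy_lt_top s)

/-- The weak limit has, for every density of the family, less energy on the annulus than every
competitor whose energy on the inner disk is negligible. -/
theorem IsWeakFamily.integral_dens_le (hf : IsWeakFamily h q r u G g) (hh : IsProfile h T)
    {w : Euc 2 → ℝ} {W : Euc 2 → Euc 2}
    (hW : IsW0 (ENNReal.ofReal (min 2 q)) (disk r) w (fun x => W x - bdryGrad r))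
    (hW2 : MemLp W 2 (volume.restrict (annulus r))) {I : ℝ} (hI0 : 0 ≤ I)
    (hI : ∫⁻ x in disk 1, ENNReal.ofReal (‖W x‖ ^ q) ≤ ENNReal.ofReal I)
    (hlim : Tendsto (fun s => Real.exp ((q - 2) * s) * I) atTop (𝓝 0)) (t : ℝ) :
    ∫ x in annulus r, dens h t (g x) ≤ ∫ x in annulus r, dens h t (W x) := by
  have hs := hh.toIsSlow
  -- Along `log λ = t + n T` periodicity keeps the outer density equal to `dens h t`, while only the
  -- weight of the inner disk moves.
  have hseq : Tendsto (fun n : ℕ => t + n * T) atTop atTop :=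
    tendsto_atTop_add_const_left _ _ (tendsto_natCast_atTop_atTop.atTop_mul_const hh.pos)
  refine integral_dens_le_of_weak hs t hf.memLp (fun n => hf.memLp_annulus hs (t + n * T))
    (fun k hk => (hf.weak k hk).comp hseq) (hlim.comp hseq) fun n => ?_
  simp only [Function.comp_apply]
  set κ := Real.exp ((q - 2) * (t + n * T)) with hκ
  have hκ0 : 0 < κ := Real.exp_pos _
  have hW0 : 0 ≤ ∫ x in annulus r, dens h t (W x) := integral_nonneg fun x => hs.dens_nonneg t _
  have h1 := (hf.minimizer (t + n * T)).2 _ _ hW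
  rw [← ENNReal.ofReal_le_ofReal_iff (by positivity)]
  unfold gradEnergy at h1
  simp only [hh.dens_periodic] at h1
  rw [lintegral_dens_eq hs t (hf.memLp_annulus hs _), lintegral_dens_eq hs t hW2] at h1
  rw [ENNReal.ofReal_add hW0 (by positivity), ENNReal.ofReal_mul hκ0.le]
  refine (le_self_add.trans h1).trans ?_
  gcongr

theorem memLp_compGrad (hr : 1 < r) {ε a : ℝ} (ha : slope₀ r = a * (1 + ε / r ^ 2)) :
    MemLp (compGrad ε a) 2 (volume.restrict (annulus r)) := by
  have h1 := (isW0_compGrad hr two_pos ha).2.1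
  simp only [ENNReal.ofReal_ofNat] at h1
  have h2 := (h1.add (memLp_const (bdryGrad r))).mono_measure (restrict_annulus_le r)
  refine h2.ae_eq (Eventually.of_forall fun x => ?_)
  simp

theorem IsTest.mono {d : ℕ} {Ω U : Set (Euc d)} {φ : Euc d → ℝ} (h : IsTest U φ) (hU : U ⊆ Ω) :
    IsTest Ω φ :=
  ⟨h.1, h.2.1, h.2.2.trans hU⟩

theorem gradient_eq_zero_of_lt_one {φ : Euc 2 → ℝ} (hφ : IsTest (annulus r) φ) {x : Euc 2}
    (hx : ‖x‖ < 1) : gradient φ x = 0 :=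
  hφ.gradient_eq_zero fun hm => by linarith [(mem_annulus.1 hm).1]

/-- The limit field beats the perturbations of the competitor inside the annulus. -/
theorem IsWeakFamily.integral_dens_le_compGrad (hf : IsWeakFamily h q r u G g)
    (hh : IsProfile h T) (hr : 1 < r) (hq : 1 < q) {ε a : ℝ}
    (ha : slope₀ r = a * (1 + ε / r ^ 2))
    (hlim : Tendsto (fun s => Real.exp ((q - 2) * s) * (|a * (1 + ε)| ^ q * Real.pi)) atTop (𝓝 0))
    {φ : Euc 2 → ℝ} (hφ : IsTest (annulus r) φ) (s t : ℝ) :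
    ∫ x in annulus r, dens h t (g x) ≤
      ∫ x in annulus r, dens h t (compGrad ε a x + s • gradient φ x) := by
  have hp := one_le_ofReal_min hq
  have hW := (isW0_compGrad (s := min 2 q) hr (lt_min two_pos (by linarith)) ha).add hp
    ((isW0_of_isTest (hφ.mono (annulus_subset r))).const_mul s)
  refine hf.integral_dens_le hh (W := fun x => compGrad ε a x + s • gradient φ x)
    (by simpa only [add_sub_right_comm] using hW)
    ((memLp_compGrad hr ha).add ((hφ.memLp_gradient 2).const_smul s))
    (I := |a * (1 + ε)| ^ q * Real.pi) (by have := Real.pi_pos; positivity) ?_ hlim t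
  have h1 : ∫⁻ x in disk 1, ENNReal.ofReal (‖compGrad ε a x + s • gradient φ x‖ ^ q) =
      ∫⁻ _ in disk 1, ENNReal.ofReal (|a * (1 + ε)| ^ q) := by
    refine setLIntegral_congr_fun Metric.isOpen_ball.measurableSet fun x hx => ?_
    have hx1 := mem_ball_zero_iff.1 hx
    simp only [compGrad_of_lt_one hx1, gradient_eq_zero_of_lt_one hφ hx1, smul_zero, add_zero,
      norm_smul, norm_e₀, mul_one, Real.norm_eq_abs]
  rw [h1, setLIntegral_const, volume_disk zero_le_one, ← ENNReal.ofReal_mul (by positivity),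
    one_pow, mul_one]

/-- The limit field is the competitor. -/
theorem IsWeakFamily.ae_eq_compGrad (hf : IsWeakFamily h q r u G g)
    (hh : IsProfile h T) (hr : 1 < r) (hq : 1 < q) {ε a : ℝ}
    (ha : slope₀ r = a * (1 + ε / r ^ 2))
    (hlim : Tendsto (fun s => Real.exp ((q - 2) * s) * (|a * (1 + ε)| ^ q * Real.pi)) atTop (𝓝 0))
    (hdisk : Tendsto (fun s => ∫ x in disk 1, inner ℝ (fluxField ε a x) (G s x - compGrad ε a x))
      atTop (𝓝 0)) :
    g =ᵐ[volume.restrict (annulus r)] compGrad ε a := by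
  have hs := hh.toIsSlow
  have hp := one_le_ofReal_min hq
  have hc := memLp_compGrad hr ha
  have hφ : IsTest (annulus r) (fun _ => 0) := by
    refine ⟨contDiff_const, HasCompactSupport.zero, ?_⟩
    rw [show tsupport (fun _ : Euc 2 => (0 : ℝ)) = ∅ from tsupport_eq_empty_iff.2 rfl]
    exact empty_subset _
  have hle : ∀ t, ∫ x in annulus r, dens h t (g x) ≤
      ∫ x in annulus r, dens h t (compGrad ε a x) := fun t => by
    simpa using hf.integral_dens_le_compGrad hh hr hq ha hlim hφ 0 t
  -- Adding the energy inequalities for `0` and `T/2` yields the inequality between Dirichlet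
  -- energies.
  have hsum : ∀ k : Euc 2 → Euc 2, MemLp k 2 (volume.restrict (annulus r)) →
      (∫ x in annulus r, dens h 0 (k x)) + ∫ x in annulus r, dens h (0 + T / 2) (k x) =
        5 * ∫ x in annulus r, ‖k x‖ ^ 2 := fun k hk => by
    rw [← integral_add (hs.integrable_dens _ hk) (hs.integrable_dens _ hk), ← integral_const_mul]
    simp only [hh.dens_add_half]
  refine ae_eq_of_integral_norm_sq_le hc hf.memLp ?_ ?_
  · linarith [hsum g hf.memLp, hsum _ hc, hle 0, hle (0 + T / 2)]
  -- The pairing of the minimizers with the competitor: on the annulus the competitor is the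
  -- divergence free field, orthogonal to `G s - compGrad` on the whole disk, so only the inner disk
  -- contributes, and this contribution tends to zero by `hdisk`.
  · have hz : ∀ s, ∫ x in annulus r, inner ℝ (G s x) (compGrad ε a x) =
        (∫ x in annulus r, ‖compGrad ε a x‖ ^ 2) -
          ∫ x in disk 1, inner ℝ (fluxField ε a x) (G s x - compGrad ε a x) := by
      intro s
      have h1 := (hf.minimizer s).1.sub hp
        (isW0_compGrad (s := min 2 q) hr (lt_min two_pos (by linarith)) ha)
      simp only [sub_sub_sub_cancel_right] at h1
      have h2 := integral_inner_fluxField hr hp ε a h1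
      rw [setIntegral_disk_eq hr (integrableOn_inner_fluxField (by linarith) hp ε a h1.2.1)] at h2
      have h3 : ∫ x in annulus r, inner ℝ (fluxField ε a x) (G s x - compGrad ε a x) =
          ∫ x in annulus r, (inner ℝ (G s x) (compGrad ε a x) - ‖compGrad ε a x‖ ^ 2) := by
        refine setIntegral_congr_fun (measurableSet_annulus r) fun x hx => ?_
        rw [← compGrad_eq_fluxField (mem_annulus.1 hx).1, inner_sub_right,
          real_inner_self_eq_norm_sq, real_inner_comm]
      rw [h3, integral_sub (integrable_inner (hf.memLp_annulus hs s) hc)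
        (hc.integrable_norm_pow two_ne_zero)] at h2
      linarith
    have h4 := hf.weak _ hc
    simp only [hz] at h4
    have h5 := tendsto_nhds_unique h4 (hdisk.const_sub _)
    rw [sub_zero] at h5
    rw [← h5]
    simp only [real_inner_comm]

/-- The limit field solves all the equations of the family. -/
theorem IsWeakFamily.integral_inner_flux_compGrad (hf : IsWeakFamily h q r u G g)
    (hh : IsProfile h T) (hr : 1 < r) (hq : 1 < q) {ε a : ℝ}
    (ha : slope₀ r = a * (1 + ε / r ^ 2))
    (hlim : Tendsto (fun s => Real.exp ((q - 2) * s) * (|a * (1 + ε)| ^ q * Real.pi)) atTop (𝓝 0))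
    (hdisk : Tendsto (fun s => ∫ x in disk 1, inner ℝ (fluxField ε a x) (G s x - compGrad ε a x))
      atTop (𝓝 0)) {φ : Euc 2 → ℝ} (hφ : IsTest (annulus r) φ) (t : ℝ) :
    ∫ x in annulus r, inner ℝ (flux h t (compGrad ε a x)) (gradient φ x) = 0 := by
  have hae := hf.ae_eq_compGrad hh hr hq ha hlim hdisk
  -- Since the limit equals the competitor, the competitor itself minimizes each energy among its
  -- perturbations inside the annulus; applying the inequality to `φ` and `-φ` gives the equation.
  have key : ∀ {ψ : Euc 2 → ℝ}, IsTest (annulus r) ψ →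
      0 ≤ ∫ x in annulus r, inner ℝ (flux h t (compGrad ε a x)) (gradient ψ x) := by
    intro ψ hψ
    refine integral_inner_flux_nonneg hh.toIsSlow t (memLp_compGrad hr ha) (hψ.memLp_gradient 2)
      fun s => ?_
    rw [← integral_congr_ae (g := fun x => dens h t (compGrad ε a x)) (hae.fun_comp (dens h t))]
    exact hf.integral_dens_le_compGrad hh hr hq ha hlim hψ s t
  refine le_antisymm ?_ (key hφ)
  have h1 := key (hφ.const_mul (-1))
  have h2 : gradient (fun x => -1 * φ x) = fun x => (-1 : ℝ) • gradient φ x :=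
    funext fun x => gradient_const_mul' _ (hφ.1.differentiable one_ne_zero x)
  rw [h2] at h1
  simp only [inner_smul_right, integral_const_mul] at h1
  linarith

end LimitField

/-! ### No harmonic field solves all the equations -/

section Rigidity

variable {h : ℝ → ℝ} {T q r t ε a : ℝ}

theorem contDiffAt_compGrad {x : Euc 2} (hx : 1 < ‖x‖) (ε a : ℝ) :
    ContDiffAt ℝ 2 (compGrad ε a) x := by
  have he : compGrad ε a =ᶠ[𝓝 x] fun y => a • (e₀ + ε • ((‖y‖ ^ 2)⁻¹ • EuclideanSpace.single 0 1 -
      (2 * y 0 * ((‖y‖ ^ 2) ^ 2)⁻¹) • y)) := by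
    filter_upwards [(continuous_norm.tendsto x).eventually (lt_mem_nhds hx)] with y hy
    rw [compGrad, truncGrad_of_one_lt hy]
  refine ContDiffAt.congr_of_eventuallyEq ?_ he
  have h1 : ContDiffAt ℝ 2 (fun y : Euc 2 => (‖y‖ ^ 2)⁻¹) x :=
    (contDiff_norm_sq ℝ).contDiffAt.inv (by positivity)
  have h2 : ContDiffAt ℝ 2 (fun y : Euc 2 => ((‖y‖ ^ 2) ^ 2)⁻¹) x :=
    ((contDiff_norm_sq ℝ).pow 2).contDiffAt.inv (by positivity)
  have h3 : ContDiffAt ℝ 2 (fun y : Euc 2 => y 0) x := by fun_prop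
  have h4 : ContDiffAt ℝ 2 (fun y : Euc 2 => (2 * y 0 * ((‖y‖ ^ 2) ^ 2)⁻¹) • y) x :=
    ((contDiffAt_const.mul h3).mul h2).smul contDiffAt_id
  have h5 : ContDiffAt ℝ 2 (fun y : Euc 2 => (‖y‖ ^ 2)⁻¹ • (EuclideanSpace.single 0 1 : Euc 2)) x :=
    h1.smul contDiffAt_const
  have h6 := (h5.sub h4).const_smul ε
  exact (contDiffAt_const.add h6).const_smul a

/-- Nonvanishing outside the closed unit disk makes `log ‖compGrad‖`, and with it the coefficient of
the flux, differentiable there. -/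
theorem compGrad_ne_zero (hε : |ε| = 1) (ha : a ≠ 0) {x : Euc 2} (hx : 1 < ‖x‖) :
    compGrad ε a x ≠ 0 := by
  have h1 := le_norm_compGrad (a := a) hε hx
  have h2 : 1 / ‖x‖ ^ 2 < 1 := by
    rw [div_lt_one (by positivity)]
    exact one_lt_pow₀ hx two_ne_zero
  have h3 : 0 < |a| * (1 - 1 / ‖x‖ ^ 2) := mul_pos (abs_pos.2 ha) (by linarith)
  exact norm_pos_iff.1 (h3.trans_le h1)

/-- The coefficient of the flux of `compGrad`. -/
noncomputable def fluxCoef (h : ℝ → ℝ) (ε a t : ℝ) (x : Euc 2) : ℝ :=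
  logCoef h (t + Real.log ‖compGrad ε a x‖)

theorem contDiffAt_fluxCoef (hh : IsSlow h) (hε : |ε| = 1) (ha : a ≠ 0) {x : Euc 2}
    (hx : 1 < ‖x‖) : ContDiffAt ℝ 2 (fluxCoef h ε a t) x := by
  have h0 := compGrad_ne_zero hε ha hx
  have h1 : ContDiffAt ℝ 2 (fun y => ‖compGrad ε a y‖) x :=
    (contDiffAt_compGrad hx ε a).norm ℝ h0
  have h2 : ContDiffAt ℝ 2 (fun y => t + Real.log ‖compGrad ε a y‖) x :=
    contDiffAt_const.add (h1.log (norm_ne_zero_iff.2 h0))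
  have h3 : ContDiff ℝ 2 (logCoef h) := (contDiff_infty.1 hh.contDiff_logCoef) 2
  exact h3.contDiffAt.comp x h2

/-- Smoothness is needed only on the support of `φ`, where the coefficient is regular. The product
serves as a test function for the divergence free field. -/
theorem isTest_mul_fluxCoef (hh : IsSlow h) (hε : |ε| = 1) (ha : a ≠ 0) {φ : Euc 2 → ℝ}
    (hφ : IsTest (annulus r) φ) : IsTest (annulus r) (fun x => φ x * fluxCoef h ε a t x) := by
  have hs : tsupport (fun x => φ x * fluxCoef h ε a t x) ⊆ tsupport φ :=
    tsupport_mul_subset_left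
  refine ⟨contDiff_iff_contDiffAt.2 fun x => ?_, hφ.2.1.mul_right, hs.trans hφ.2.2⟩
  by_cases hx : x ∉ tsupport fun x => φ x * fluxCoef h ε a t x
  · exact contDiffAt_const.congr_of_eventuallyEq (notMem_tsupport_iff_eventuallyEq.1 hx)
  rw [not_not] at hx
  exact hφ.1.contDiffAt.mul ((contDiffAt_fluxCoef hh hε ha
    (mem_annulus.1 (hφ.2.2 (hs hx))).1).of_le (by norm_num))

theorem gradient_mul' {d : ℕ} {φ ψ : Euc d → ℝ} {x : Euc d} (h : DifferentiableAt ℝ φ x)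
    (h' : DifferentiableAt ℝ ψ x) :
    gradient (fun x => φ x * ψ x) x = φ x • gradient ψ x + ψ x • gradient φ x := by
  simp [gradient, fderiv_fun_mul h h']

/-- If the competitor solves the equation, then the coefficient of the flux is constant along the
flow lines of the competitor. -/
theorem fderiv_fluxCoef_eq_zero (hh : IsSlow h) (hr : 1 < r) (hε : |ε| = 1) (ha : a ≠ 0)
    (hs₀ : slope₀ r = a * (1 + ε / r ^ 2)) (heq : ∀ φ, IsTest (annulus r) φ →
      ∫ x in annulus r, inner ℝ (flux h t (compGrad ε a x)) (gradient φ x) = 0)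
    {x : Euc 2} (hx : x ∈ annulus r) : fderiv ℝ (fluxCoef h ε a t) x (compGrad ε a x) = 0 := by
  set f : Euc 2 → ℝ := fun x => fderiv ℝ (fluxCoef h ε a t) x (compGrad ε a x) with hf
  have hfc : ContinuousOn f (annulus r) := fun y hy => by
    have hy1 := (mem_annulus.1 hy).1
    have h1 := ((contDiffAt_fluxCoef (t := t) hh hε ha hy1).fderiv_right (m := 1)
      (by norm_num)).continuousAt
    exact (h1.clm_apply (contDiffAt_compGrad hy1 ε a).continuousAt).continuousWithinAt
  have hB := isOpen_annulus r
  have hae : ∀ᵐ x ∂volume, x ∈ annulus r → f x = 0 := by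
    refine hB.ae_eq_zero_of_integral_contDiff_smul_eq_zero
      (hfc.locallyIntegrableOn hB.measurableSet) fun φ hφ hc hs => ?_
    have hφ1 : IsTest (annulus r) φ := ⟨hφ.of_le (by exact_mod_cast le_top), hc, hs⟩
    have hψ := isTest_mul_fluxCoef (t := t) hh hε ha hφ1
    have z1 := integral_inner_fluxField hr (p := 1) le_rfl ε a
      (isW0_of_isTest (hψ.mono (annulus_subset r)))
    have z2 : ∫ x in annulus r, inner ℝ (compGrad ε a x)
        (gradient (fun x => φ x * fluxCoef h ε a t x) x) = 0 := by
      rw [← z1]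
      rw [setIntegral_eq_of_subset_of_forall_sdiff_eq_zero Metric.isOpen_ball.measurableSet
        (annulus_subset r)]
      · refine setIntegral_congr_fun (measurableSet_annulus r) fun x hx => ?_
        rw [compGrad_eq_fluxField (mem_annulus.1 hx).1]
      · intro x hx
        rw [hψ.gradient_eq_zero hx.2, inner_zero_right]
    have z3 := heq φ hφ1
    rw [← setIntegral_smul_eq hs]
    have hm := memLp_compGrad hr hs₀
    -- With `V` the field and `k` the coefficient, `φ ⟪V, ∇k⟫ = ⟪V, ∇(φ k)⟫ - ⟪k V, ∇φ⟫`. The first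
    -- term integrates to zero because `V` is divergence free, the second because `k V` is.
    have z4 : ∫ x in annulus r, φ x • f x = ∫ x in annulus r,
        (inner ℝ (compGrad ε a x) (gradient (fun x => φ x * fluxCoef h ε a t x) x) -
          inner ℝ (flux h t (compGrad ε a x)) (gradient φ x)) := by
      refine setIntegral_congr_fun (measurableSet_annulus r) fun x hx => ?_
      have hx1 := (mem_annulus.1 hx).1
      have hd := (contDiffAt_fluxCoef (t := t) hh hε ha hx1).differentiableAt two_ne_zero
      have e1 : inner ℝ (compGrad ε a x) (gradient (fluxCoef h ε a t) x) = f x := by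
        rw [real_inner_comm, inner_gradient]
      have e2 : flux h t (compGrad ε a x) = fluxCoef h ε a t x • compGrad ε a x := rfl
      simp only [gradient_mul' (hφ1.1.differentiable one_ne_zero x) hd, inner_add_right,
        inner_smul_right, e1, e2, real_inner_smul_left, smul_eq_mul, add_sub_cancel_right]
    rw [z4, integral_sub (integrable_inner hm (hψ.memLp_gradient 2))
      (integrable_inner (hh.memLp_flux t hm) (hφ1.memLp_gradient 2)), z2, z3, sub_zero]
  have := Measure.eqOn_open_of_ae_eq (μ := (volume : Measure (Euc 2))) (f := f) (g := fun _ => 0)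
    ((ae_restrict_iff' hB.measurableSet).2 hae) hB hfc continuousOn_const
  exact this hx

/-- The axis is a flow line, and the norm of the field varies along it: this is where constancy of
the coefficient becomes a condition on the profile. -/
theorem compGrad_axis {y : ℝ} (hy : 1 < y) (ε a : ℝ) :
    compGrad ε a (y • e₀) = (a * (1 - ε / y ^ 2)) • e₀ := by
  have hy0 : 0 < y := by linarith
  have hn : ‖y • e₀‖ = y := by rw [norm_smul, norm_e₀, mul_one, Real.norm_of_nonneg hy0.le]
  have hc : (y • e₀) 0 = y := by simp [e₀]
  rw [compGrad, truncGrad_of_one_lt (by rw [hn]; exact hy), hn, hc, ← e₀, smul_smul, ← sub_smul,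
    smul_smul]
  conv_lhs => rw [← one_smul ℝ e₀]
  rw [smul_smul, mul_one, ← add_smul, smul_smul]
  congr 2
  field_simp
  ring

/-- The competitor does not solve all the equations of the family. -/
theorem not_forall_integral_inner_flux (hh : IsProfile h T) (hr : 2 < r) (hε : |ε| = 1)
    (ha : 0 < a) (hs₀ : slope₀ r = a * (1 + ε / r ^ 2)) :
    ¬ ∀ t φ, IsTest (annulus r) φ →
      ∫ x in annulus r, inner ℝ (flux h t (compGrad ε a x)) (gradient φ x) = 0 := by
  intro heq
  have hs := hh.toIsSlow
  have hε1 := abs_le.1 hε.le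
  have hpos : 0 < 1 - ε / 2 ^ 2 := by linarith [hε1.2]
  have hd : ∀ s, deriv (logCoef h) s = 0 := by
    intro s
    -- The translation is chosen so that the coefficient at the point `2 e₀` is evaluated at the
    -- prescribed argument `s`.
    set t := s - Real.log (a * (1 - ε / 2 ^ 2)) with ht
    have hx1 : ‖(2 : ℝ) • e₀‖ = 2 := by rw [norm_smul, norm_e₀]; norm_num
    have hx : (2 : ℝ) • e₀ ∈ annulus r := by
      rw [mem_annulus, hx1]
      exact ⟨by norm_num, hr⟩
    have h1 := fderiv_fluxCoef_eq_zero hs (by linarith) hε ha.ne' hs₀ (heq t) hx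
    rw [compGrad_axis (by norm_num), map_smul, smul_eq_mul, mul_eq_zero] at h1
    have h2 := h1.resolve_left (mul_pos ha hpos).ne'
    have hdiff := (contDiffAt_fluxCoef (t := t) hs hε ha.ne'
      (mem_annulus.1 hx).1).differentiableAt two_ne_zero
    have h3 : HasDerivAt (fun y : ℝ => fluxCoef h ε a t (y • e₀)) 0 2 := by
      have hl : HasDerivAt (fun y : ℝ => y • e₀) e₀ 2 := by
        simpa using (hasDerivAt_id (2 : ℝ)).smul_const e₀
      have := hdiff.hasFDerivAt.comp_hasDerivAt (2 : ℝ) hl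
      rwa [h2] at this
    have h4 : HasDerivAt (fun y : ℝ => a * (1 - ε / y ^ 2)) (a * (ε / 4)) 2 := by
      have h5 := (((hasDerivAt_pow 2 (2 : ℝ)).inv (by norm_num)).const_mul ε).const_sub 1
      have h6 := h5.const_mul a
      refine h6.congr_deriv ?_
      norm_num
      left
      ring
    have h7 := (h4.log (mul_pos ha hpos).ne').const_add t
    have h8 : HasDerivAt (logCoef h) (deriv (logCoef h) s)
        (t + Real.log (a * (1 - ε / 2 ^ 2))) := by
      rw [ht, sub_add_cancel]
      exact ((hs.contDiff_logCoef.differentiable (by simp)) s).hasDerivAt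
    have h9 := h8.comp (2 : ℝ) h7
    have h10 : (fun y : ℝ => fluxCoef h ε a t (y • e₀)) =ᶠ[𝓝 2]
        logCoef h ∘ fun y => t + Real.log (a * (1 - ε / y ^ 2)) := by
      filter_upwards [lt_mem_nhds (by norm_num : (1 : ℝ) < 2)] with y hy
      have hy2 : ε / y ^ 2 < 1 := by
        rw [div_lt_one (by positivity)]
        nlinarith [hε1.2]
      rw [Function.comp_apply, fluxCoef, compGrad_axis hy, norm_smul, norm_e₀, mul_one,
        Real.norm_of_nonneg (mul_nonneg ha.le (by linarith))]
    -- By the chain rule `k'(s)` times the logarithmic derivative of the norm along the axis is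
    -- zero, and the latter factor is nonzero.
    have h11 := (h9.congr_of_eventuallyEq h10).unique h3
    have hε0 : ε ≠ 0 := by
      rintro rfl
      simp at hε
    rw [mul_eq_zero] at h11
    exact h11.resolve_right (div_ne_zero (mul_ne_zero ha.ne' (by positivity))
      (mul_pos ha hpos).ne')
  -- The points `T/4` and `3T/4` are the midpoints of the two plateaus, where the coefficient is `6`
  -- and `4`.
  have hconst := is_const_of_deriv_eq_zero (hs.contDiff_logCoef.differentiable (by simp)) hd
    (T / 4) (3 * T / 4)
  have hT := hh.pos
  have hval : ∀ {s α β c : ℝ}, α < s → s < β → (∀ y ∈ Icc α β, h y = c) →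
      logCoef h s = 2 * c := by
    intro s α β c h1 h2 h3
    have he : h =ᶠ[𝓝 s] fun _ => c := by
      filter_upwards [Icc_mem_nhds h1 h2] with y hy
      exact h3 y hy
    rw [logCoef, he.deriv_eq, he.eq_of_nhds, deriv_const, add_zero]
  rw [hval (by linarith) (by linarith) hh.three, hval (by linarith) (by linarith) hh.two] at hconst
  norm_num at hconst

end Rigidity

/-! ### Absence of weak limits for `q ≠ 2` -/

section NoWeakLimit

variable {h : ℝ → ℝ} {T q r : ℝ} {u : ℝ → Euc 2 → ℝ} {G : ℝ → Euc 2 → Euc 2} {g : Euc 2 → Euc 2}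

/-- For `q > 2` the fields vanish asymptotically on the inner disk. -/
theorem IsWeakFamily.tendsto_integral_disk_one (hf : IsWeakFamily h q r u G g)
    (hh : IsProfile h T) (hr : 100 ≤ r) (hq : 2 < q) (a : ℝ) :
    Tendsto (fun s => ∫ x in disk 1, inner ℝ (fluxField (-1) a x) (G s x - compGrad (-1) a x))
      atTop (𝓝 0) := by
  have hr1 : 1 < r := by linarith
  have hq0 : 0 < q := by linarith
  set C := ENNReal.ofReal (12 * outerSlope r ^ 2) * volume (disk r) with hC
  have hCt : C ≠ ⊤ := ENNReal.mul_ne_top ENNReal.ofReal_ne_top measure_ball_lt_top.ne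
  -- The energies are bounded uniformly in `s`, so the inner term is at most a constant divided by
  -- the weight, which tends to infinity.
  have hb : ∀ s, ∫⁻ x in disk 1, ENNReal.ofReal (‖G s x‖ ^ q) ≤
      ENNReal.ofReal (Real.exp (-((q - 2) * s))) * C := by
    intro s
    refine (lintegral_rpow_le (h := h) (t := s) (r := r)
      (Real.exp_pos ((q - 2) * s)) (G s)).trans ?_
    rw [← Real.exp_neg]
    gcongr
    exact ((hf.minimizer s).2 _ _ (isW0_compGrad hr1 (lt_min two_pos hq0)
      (outerSlope_spec hr1))).trans (gradEnergy_compGrad_lt_top hh.toIsSlow hq0 _)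
  have hmeas : ∀ s, AEStronglyMeasurable (G s) (volume.restrict (disk 1)) := fun s =>
    (aestronglyMeasurable_of_isW0_sub (hf.minimizer s).1).mono_measure (restrict_disk_one_le hr1)
  have hmem : ∀ s, MemLp (G s) (ENNReal.ofReal q) (volume.restrict (disk 1)) := fun s =>
    (memLp_ofReal_iff hq0 (hmeas s)).2
      ((hb s).trans_lt (ENNReal.mul_lt_top ENNReal.ofReal_lt_top hCt.lt_top))
  have hexp : Tendsto (fun s => ENNReal.ofReal (Real.exp (-((q - 2) * s))) * C) atTop (𝓝 0) := by
    have h1 : Tendsto (fun s => Real.exp (-((q - 2) * s))) atTop (𝓝 0) :=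
      Real.tendsto_exp_neg_atTop_nhds_zero.comp (tendsto_id.const_mul_atTop (by linarith))
    have h2 := ENNReal.Tendsto.mul_const (b := C) (ENNReal.tendsto_ofReal h1) (Or.inr hCt)
    rwa [ENNReal.ofReal_zero, zero_mul] at h2
  have hnorm : Tendsto (fun s => eLpNorm (G s - fun _ => (0 : Euc 2)) (ENNReal.ofReal q)
      (volume.restrict (disk 1))) atTop (𝓝 0) := by
    have h1 : Tendsto (fun s => (∫⁻ x in disk 1, ENNReal.ofReal (‖G s x‖ ^ q)) ^ (1 / q)) atTop
        (𝓝 0) := by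
      have h2 := tendsto_of_tendsto_of_tendsto_of_le_of_le tendsto_const_nhds hexp
        (fun _ => zero_le) hb
      have h3 := ((ENNReal.continuous_rpow_const (y := 1 / q)).tendsto 0).comp h2
      rwa [ENNReal.zero_rpow_of_pos (by positivity)] at h3
    refine h1.congr fun s => ?_
    rw [← eLpNorm_ofReal_eq hq0]
    congr 1
    ext1 x
    simp
  obtain ⟨K, hK⟩ := exists_norm_fluxField_le (-1) a (r := r) (by linarith)
  have hp : 1 ≤ ENNReal.ofReal q := by
    simpa using ENNReal.ofReal_le_ofReal (by linarith : (1 : ℝ) ≤ q)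
  have hlim : Tendsto (fun s => ∫ x in disk 1, inner ℝ (fluxField (-1) a x) (G s x)) atTop
      (𝓝 (∫ x in disk 1, inner ℝ (fluxField (-1) a x) (0 : Euc 2))) :=
    tendsto_integral_bilin hp (innerSL ℝ (E := Euc 2))
    (measurable_fluxField (-1) a).aestronglyMeasurable
    (ae_mono (restrict_disk_one_le hr1) hK) hmem (memLp_const 0) hnorm
  simp only [inner_zero_right, integral_zero] at hlim
  refine hlim.congr fun s => setIntegral_congr_fun Metric.isOpen_ball.measurableSet fun x hx => ?_
  rw [compGrad_of_lt_one (mem_ball_zero_iff.1 hx)]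
  simp

/-- The sign of `q - 2` decides which harmonic field is the only possible limit; in both cases it
would have to solve the equations of all translations, which is impossible. -/
theorem not_isWeakFamily (hh : IsProfile h T) (hr : 100 ≤ r) (hq : 1 < q) (hq2 : q ≠ 2) :
    ¬ IsWeakFamily h q r u G g := by
  intro hf
  have hr1 : 1 < r := by linarith
  have hq0 : 0 < q := by linarith
  rcases lt_or_gt_of_ne hq2 with hlt | hgt
  -- Here `ε = 1`: the weight tends to zero, so the inner energy of the competitor is negligible,
  -- and the flux field vanishes on the inner disk.
  · have hden : 0 < 1 + 1 / r ^ 2 := by positivity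
    set a := slope₀ r / (1 + 1 / r ^ 2) with ha
    have hs₀ : slope₀ r = a * (1 + 1 / r ^ 2) := (div_mul_cancel₀ _ hden.ne').symm
    have ha0 : 0 < a := div_pos (by linarith [(slope₀_bounds hr).1]) hden
    have h1 : Tendsto (fun s => Real.exp ((q - 2) * s)) atTop (𝓝 0) :=
      Real.tendsto_exp_atBot.comp (tendsto_id.const_mul_atTop_of_neg (by linarith))
    have h2 := h1.mul_const (|a * (1 + 1)| ^ q * Real.pi)
    rw [zero_mul] at h2
    refine not_forall_integral_inner_flux hh (by linarith) (by simp) ha0 hs₀ fun t φ hφ =>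
      hf.integral_inner_flux_compGrad hh hr1 hq hs₀ h2 ?_ hφ t
    refine tendsto_const_nhds.congr fun s => ?_
    symm
    refine setIntegral_eq_zero_of_forall_eq_zero fun x hx => ?_
    rw [fluxField_of_lt_one (mem_ball_zero_iff.1 hx)]
    simp
  -- Here `ε = -1`: the competitor has no inner energy at all, and the minimizers flatten in the
  -- inner disk.
  · have hs₀ := outerSlope_spec hr1
    refine not_forall_integral_inner_flux hh (by linarith) (by simp)
      (by linarith [(outerSlope_bounds hr).1]) hs₀ fun t φ hφ =>
      hf.integral_inner_flux_compGrad hh hr1 hq hs₀ ?_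
        (hf.tendsto_integral_disk_one hh hr hgt _) hφ t
    simp [Real.zero_rpow hq0.ne']

end NoWeakLimit

/-! ### Solutions along geometric sequences -/

section Solutions

variable {h : ℝ → ℝ} {T q r L : ℝ}

/-- Reparametrization by `s = log λ`. On the annulus the weak gradient taken there and the one taken
in the whole disk agree almost everywhere. -/
theorem IsSolution2.isWeakFamily (hr : 1 < r) (hq : 1 < q) {v : ℝ → Euc 2 → ℝ}
    (hv : ∀ lam, 0 < lam → IsSolution2 q r (logDensity h) lam (v lam)) {u : Euc 2 → ℝ}
    (hu : WeaklyConvergesW 2 (annulus r) v u) :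
    IsWeakFamily h q r (fun s x => v (Real.exp s) x - bdryData r x)
      (fun s => weakGrad (disk r) (v (Real.exp s))) (weakGrad (annulus r) u) := by
  have hmin : ∀ s, IsGradMinimizer h q s (Real.exp ((q - 2) * s)) r (bdryGrad r)
      (fun x => v (Real.exp s) x - bdryData r x) (weakGrad (disk r) (v (Real.exp s))) := by
    intro s
    have := (isSolution2_iff hr hq (Real.exp_pos s) _).1 (hv _ (Real.exp_pos s))
    rwa [Real.log_exp, ← Real.exp_mul, mul_comm] at this
  obtain ⟨-, h2, -, h4⟩ := hu
  have e2 : (2 : ℝ) / (2 - 1) = 2 := by norm_num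
  simp only [e2, ENNReal.ofReal_ofNat] at h4
  have h5 := h2.memLp_weakGrad (isOpen_annulus r)
  simp only [ENNReal.ofReal_ofNat] at h5
  refine ⟨hmin, h5, fun k hk => ((h4 k hk).comp Real.tendsto_exp_atTop).congr fun s => ?_⟩
  have h6 := ((hasWeakGrad_of_sub (one_le_ofReal_min hq) (hmin s).1).restrict
    (annulus_subset r)).weakGrad_ae_eq (isOpen_annulus r)
  refine integral_congr_ae ?_
  filter_upwards [h6] with x hx
  rw [hx]

theorem IsSolution2.energy2_lt_top (hh : IsSlow h) (hr : 1 < r) (hq : 1 < q) {lam : ℝ}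
    (hl : 0 < lam) {v : Euc 2 → ℝ} (hv : IsSolution2 q r (logDensity h) lam v) :
    energy2 q r (logDensity h) lam v ≤
      ENNReal.ofReal (12 * outerSlope r ^ 2) * volume (disk r) := by
  rw [energy2_eq hl]
  exact (((isSolution2_iff hr hq hl v).1 hv).2 _ _ (isW0_compGrad hr
    (lt_min two_pos (by linarith)) (outerSlope_spec hr))).trans
    (gradEnergy_compGrad_lt_top hh (by linarith) _)

theorem IsSolution2.energy2_le (hh : IsSlow h) (hr : 100 ≤ r) (hq : 1 < q) {lam : ℝ}
    (hl : 0 < lam) (hp : IsPlateau h (Real.log lam) 2) {v : Euc 2 → ℝ}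
    (hv : IsSolution2 q r (logDensity h) lam v) :
    energy2 q r (logDensity h) lam v ≤
      ENNReal.ofReal (2.3 * slope₀ r ^ 2 * (Real.pi * r ^ 2)) := by
  have hr1 : 1 < r := by linarith
  rw [energy2_eq hl]
  exact (((isSolution2_iff hr1 hq hl v).1 hv).2 _ _ (isW0_compGrad hr1
    (lt_min two_pos (by linarith)) (outerSlope_spec hr1))).trans
    (gradEnergy_compGrad_le hh hp (by linarith) hr)

theorem IsSolution2.le_energy2 (hh : IsSlow h) (hr : 100 ≤ r) (hq : 1 < q) {lam : ℝ}
    (hl : 0 < lam) (hp : IsPlateau h (Real.log lam) 3) {v : Euc 2 → ℝ}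
    (hv : IsSolution2 q r (logDensity h) lam v) :
    ENNReal.ofReal (2.5 * slope₀ r ^ 2 * (Real.pi * r ^ 2)) ≤
      energy2 q r (logDensity h) lam v := by
  rw [energy2_eq hl]
  exact le_gradEnergy hh hp hr (one_le_ofReal_min hq)
    ((isSolution2_iff (by linarith) hq hl v).1 hv).1

/-- The geometric sequence with logarithms `t + n T`. -/
noncomputable def geomSeq (T t : ℝ) (n : ℕ) : ℝ := Real.exp (t + n * T)

theorem geomSeq_pos (T t : ℝ) (n : ℕ) : 0 < geomSeq T t n := Real.exp_pos _

theorem log_geomSeq (T t : ℝ) (n : ℕ) : Real.log (geomSeq T t n) = t + n * T := Real.log_exp _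

theorem geomSeq_succ (T t : ℝ) (n : ℕ) : geomSeq T t (n + 1) = Real.exp T * geomSeq T t n := by
  unfold geomSeq
  rw [← Real.exp_add]
  congr 1
  push_cast
  ring

theorem strictMono_geomSeq (hT : 0 < T) (t : ℝ) : StrictMono (geomSeq T t) := by
  refine strictMono_nat_of_lt_succ fun n => ?_
  rw [geomSeq_succ]
  exact lt_mul_of_one_lt_left (geomSeq_pos T t n) (Real.one_lt_exp_iff.2 hT)

theorem tendsto_geomSeq (hT : 0 < T) (t : ℝ) : Tendsto (geomSeq T t) atTop atTop :=
  Real.tendsto_exp_atTop.comp (tendsto_atTop_add_const_left _ _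
    (tendsto_natCast_atTop_atTop.atTop_mul_const hT))

/-- The minimal energies converge along the geometric sequences of ratio `exp T`. -/
theorem exists_tendsto_energy2 (hh : IsProfile h T) (hr : 1 < r) (hq : 1 < q) (t : ℝ)
    {v : ℝ → Euc 2 → ℝ} (hv : ∀ lam, 0 < lam → IsSolution2 q r (logDensity h) lam (v lam)) :
    ∃ a : ℝ≥0, Tendsto (fun n => energy2 q r (logDensity h) (geomSeq T t n) (v (geomSeq T t n)))
      atTop (𝓝 (a : ℝ≥0∞)) := by
  set e : ℕ → ℝ≥0∞ := fun n => energy2 q r (logDensity h) (geomSeq T t n) (v (geomSeq T t n))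
    with he
  set κ : ℕ → ℝ := fun n => geomSeq T t n ^ (q - 2) with hκ
  set G : ℕ → Euc 2 → Euc 2 := fun n => weakGrad (disk r) (v (geomSeq T t n)) with hG
  have hper : ∀ (n : ℕ) (κ' : ℝ) (W : Euc 2 → Euc 2),
      gradEnergy h q (t + n * T) κ' r W = gradEnergy h q t κ' r W := fun n κ' W => by
    simp only [gradEnergy, hh.dens_periodic]
  have e1 : ∀ n, e n = gradEnergy h q t (κ n) r (G n) := fun n => by
    simp only [he]
    rw [energy2_eq (geomSeq_pos T t n), log_geomSeq, hper]
  -- The minimizer of index `m` is a competitor for index `n`: the outer densities coincide and only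
  -- the weights differ. Hence the minimal energy is a monotone function of the weight.
  have e2 : ∀ n m, e n ≤ gradEnergy h q t (κ n) r (G m) := fun n m => by
    have h1 := (isSolution2_iff hr hq (geomSeq_pos T t n) _).1 (hv _ (geomSeq_pos T t n))
    have h2 := (isSolution2_iff hr hq (geomSeq_pos T t m) _).1 (hv _ (geomSeq_pos T t m))
    have h3 := h1.2 _ _ h2.1
    rw [log_geomSeq, hper, hper] at h3
    rw [e1]
    exact h3
  have hmono : ∀ {κ₁ κ₂ : ℝ} (W : Euc 2 → Euc 2), κ₁ ≤ κ₂ →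
      gradEnergy h q t κ₁ r W ≤ gradEnergy h q t κ₂ r W := fun W hle => by
    unfold gradEnergy
    gcongr
  have hb : ∀ n, e n ≤ ENNReal.ofReal (12 * outerSlope r ^ 2) * volume (disk r) := fun n =>
    (hv _ (geomSeq_pos T t n)).energy2_lt_top hh.toIsSlow hr hq (geomSeq_pos T t n)
  have hC : ENNReal.ofReal (12 * outerSlope r ^ 2) * volume (disk r) < ⊤ :=
    ENNReal.mul_lt_top ENNReal.ofReal_lt_top measure_ball_lt_top
  have hlim : ∃ l, Tendsto e atTop (𝓝 l) := by
    have hsm := (strictMono_geomSeq hh.pos t).monotone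
    -- The weights `λ^(q-2)` increase for `q ≥ 2` and decrease for `q ≤ 2`; the uniform bound keeps
    -- the limit finite.
    rcases le_total 2 q with h2 | h2
    · refine ⟨_, tendsto_atTop_iSup fun n m hnm => ?_⟩
      refine (e2 n m).trans ((hmono _ ?_).trans (e1 m).ge)
      exact Real.rpow_le_rpow (geomSeq_pos T t n).le (hsm hnm) (by linarith)
    · refine ⟨_, tendsto_atTop_iInf fun n m hnm => ?_⟩
      refine (e2 m n).trans ((hmono _ ?_).trans (e1 n).ge)
      exact Real.rpow_le_rpow_of_nonpos (geomSeq_pos T t n) (hsm hnm) (by linarith)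
  obtain ⟨l, hl⟩ := hlim
  have hlt : l ≠ ⊤ := ((le_of_tendsto' hl hb).trans_lt hC).ne
  exact ⟨l.toNNReal, by rwa [ENNReal.coe_toNNReal hlt]⟩

/-- A profile that is constant on a window of length at least `log L` gives a density that is
quadratic on `[λ, L λ]` along a geometric sequence. -/
theorem IsProfile.logDensity_eq (hh : IsProfile h T) {t c : ℝ}
    (hc : ∀ s ∈ Icc t (t + T / 3), h s = c) (hL : 1 < L) (hLT : Real.log L ≤ T / 3) (n : ℕ) {E : ℝ}
    (hE : E ∈ Icc (geomSeq T t n) (L * geomSeq T t n)) : logDensity h E = c * E ^ 2 := by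
  have h0 := geomSeq_pos T t n
  have hE0 : 0 < E := h0.trans_le hE.1
  have h1 := Real.log_le_log h0 hE.1
  have h2 := Real.log_le_log hE0 hE.2
  rw [Real.log_mul (by linarith) h0.ne'] at h2
  rw [log_geomSeq] at h1 h2
  have h3 := hc (Real.log E - n * T) ⟨by linarith, by linarith⟩
  rw [hh.periodic.sub_nat_mul_eq] at h3
  rw [logDensity, h3, mul_comm]

theorem IsProfile.isPlateau (hh : IsProfile h T) {t c : ℝ}
    (hc : ∀ s ∈ Icc t (t + T / 3), h s = c) (hT : Real.log 10 ≤ T / 3) (n : ℕ) :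
    IsPlateau h (Real.log (geomSeq T t n)) c := by
  intro s hs
  rw [log_geomSeq, show t + n * T + s = t + s + n * T by ring, hh.periodic.nat_mul n]
  exact hc _ ⟨by linarith [hs.1], by linarith [hs.2]⟩

theorem mul_geomSeq_lt {s t : ℝ} {m n : ℕ} (hL : 1 < L)
    (hlt : Real.log L + (s + m * T) < t + n * T) : L * geomSeq T s m < geomSeq T t n := by
  unfold geomSeq
  conv_lhs => rw [← Real.exp_log (by linarith : 0 < L)]
  rw [← Real.exp_add]
  exact Real.exp_lt_exp.2 hlt

end Solutions

/-! ### Verification of the structural conditions -/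

section Densities

variable {h : ℝ → ℝ} {q r : ℝ}

theorem IsSlow.condA1 (hh : IsSlow h) (hq : 1 < q) (r : ℝ) :
    CondA1 (disk r) (disk 1) (outerDensity (logDensity h)) (innerDensity q) :=
  ⟨⟨fun _ _ => aemeasurable_const, Eventually.of_forall fun _ =>
      hh.contDiff_logDensity.continuous.continuousOn⟩,
    ⟨fun _ _ => aemeasurable_const, Eventually.of_forall fun _ =>
      (Real.continuous_rpow_const (by linarith)).continuousOn⟩⟩

theorem IsSlow.logDensity_pos (hh : IsSlow h) {E : ℝ} (hE : 0 < E) : 0 < logDensity h E :=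
  lt_of_lt_of_le (by positivity) (hh.logDensity_bounds E).1

theorem IsSlow.condA2 (hh : IsSlow h) (hq : 1 < q) (r : ℝ) :
    CondA2 (disk r) (disk 1) (outerDensity (logDensity h)) (innerDensity q) := by
  refine ⟨Eventually.of_forall fun _ => ⟨fun E hE => hh.logDensity_pos hE,
    hh.contDiff_logDensity.contDiffOn, hh.strictConvexOn_logDensity, ?_⟩,
    Eventually.of_forall fun _ => ⟨fun E hE => Real.rpow_pos_of_pos hE q, ?_,
      strictConvexOn_rpow hq, Real.zero_rpow (by linarith)⟩⟩
  · simp [outerDensity, logDensity]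
  · exact (Real.contDiff_rpow_const_of_le (n := 1) (by exact_mod_cast hq.le)).contDiffOn

theorem IsSlow.condA3 (hh : IsSlow h) (q r : ℝ) :
    CondA3 2 q (disk r) (disk 1) (outerDensity (logDensity h)) (innerDensity q) := by
  refine ⟨1, 3, 1, one_pos, by norm_num, one_pos, Eventually.of_forall fun _ E hE => ?_,
    Eventually.of_forall fun _ E hE => ?_⟩
  · have := hh.logDensity_bounds E
    unfold outerDensity
    rw [div_one, Real.rpow_two]
    constructor <;> nlinarith [sq_nonneg E]
  · have := Real.rpow_nonneg hE q
    unfold innerDensity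
    rw [div_one]
    constructor <;> linarith

/-- The annulus has positive measure, so an almost everywhere limit exists at some point; the
density does not depend on the point. -/
theorem not_condA4 {Ψ : ℝ → ℝ} (hr : 1 < r)
    (hΨ : ¬ ∃ b : ℝ, Tendsto (fun E => Ψ E / E ^ 2) atTop (𝓝 b)) :
    ¬ CondA4 2 (disk r) (disk 1) (outerDensity Ψ) := by
  rintro ⟨β, hβ⟩
  have hne : (volume : Measure (Euc 2)) (annulus r) ≠ 0 := by
    refine ((isOpen_annulus r).measure_pos volume ⟨((1 + r) / 2) • e₀, ?_⟩).ne'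
    rw [mem_annulus, norm_smul, norm_e₀, mul_one, Real.norm_of_nonneg (by linarith)]
    constructor <;> linarith
  have := ae_restrict_neBot.2 hne
  obtain ⟨x, hx⟩ := hβ.exists
  refine hΨ ⟨β x, ?_⟩
  simpa only [outerDensity, Real.rpow_two] using hx

end Densities

end LargeData

/-! ### The main theorem -/

open LargeData

theorem mainTheorem7 :
    ∃ r₀ : ℝ, 10 ≤ r₀ ∧ ∃ l₁ l₂ : ℝ → ℝ≥0, (∀ r, r₀ ≤ r → l₁ r < l₂ r) ∧
    ∀ L : ℝ, 1 < L →
    ∃ (lam' lam'' : ℕ → ℝ) (Ψ : ℝ → ℝ),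
      -- the two sequences
      StrictMono lam' ∧ StrictMono lam'' ∧
      Tendsto lam' atTop atTop ∧ Tendsto lam'' atTop atTop ∧
      (∀ n, 0 < lam'' n ∧ L * lam'' n < lam' n ∧ L * lam' n < lam'' (n + 1)) ∧
      (∃ ρ : ℝ, 1 < ρ ∧ ∀ n, lam' (n + 1) = ρ * lam' n ∧ lam'' (n + 1) = ρ * lam'' n) ∧
      -- the density
      (∀ E, 0 ≤ E → 0 ≤ Ψ E) ∧ StrictConvexOn ℝ (Ici 0) Ψ ∧
      (∀ n, ∀ E ∈ Icc (lam' n) (L * lam' n), Ψ E = 2 * E ^ 2) ∧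
      (∀ n, ∀ E ∈ Icc (lam'' n) (L * lam'' n), Ψ E = 3 * E ^ 2) ∧
      (¬ ∃ b : ℝ, Tendsto (fun E => Ψ E / E ^ 2) atTop (𝓝 b)) ∧
      -- (A1), (A2), (A3) hold and (A4) fails
      (∀ q : ℝ, 1 < q → ∀ r : ℝ, 1 < r →
        CondA1 (disk r) (disk 1) (outerDensity Ψ) (innerDensity q) ∧
        CondA2 (disk r) (disk 1) (outerDensity Ψ) (innerDensity q) ∧
        CondA3 2 q (disk r) (disk 1) (outerDensity Ψ) (innerDensity q) ∧
        ¬ CondA4 2 (disk r) (disk 1) (outerDensity Ψ)) ∧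
      -- the counterexample
      (10 < L → ∀ q : ℝ, 1 < q → ∀ r : ℝ, r₀ ≤ r →
        (∀ lam : ℝ, 0 < lam → ∃ v, IsSolution2 q r Ψ lam v ∧
          ∀ w, IsSolution2 q r Ψ lam w → w =ᵐ[volume.restrict (disk r)] v) ∧
        ∀ v : ℝ → Euc 2 → ℝ, (∀ lam : ℝ, 0 < lam → IsSolution2 q r Ψ lam (v lam)) →
          (∃ a b : ℝ≥0,
            Tendsto (fun n => energy2 q r Ψ (lam' n) (v (lam' n))) atTop (𝓝 (a : ℝ≥0∞)) ∧
            Tendsto (fun n => energy2 q r Ψ (lam'' n) (v (lam'' n))) atTop (𝓝 (b : ℝ≥0∞)) ∧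
            a ≤ l₁ r ∧ l₂ r ≤ b) ∧
          (¬ ∃ l : ℝ≥0∞, Tendsto (fun lam => energy2 q r Ψ lam (v lam)) atTop (𝓝 l)) ∧
          -- the conclusion of the convergence theorems fails, whatever the limit
          (q ≠ 2 → (∀ lam : ℝ, 0 < lam → MemW 2 (annulus r) (v lam)) ∧
            ¬ ∃ u : Euc 2 → ℝ, WeaklyConvergesW 2 (annulus r) v u)) := by
  refine ⟨100, by norm_num, fun r => (2.3 * slope₀ r ^ 2 * (Real.pi * r ^ 2)).toNNReal,
    fun r => (2.5 * slope₀ r ^ 2 * (Real.pi * r ^ 2)).toNNReal, ?_, fun L hL => ?_⟩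
  · intro r hr
    have h1 : 0 < slope₀ r := by linarith [(slope₀_bounds hr).1]
    have h2 : 0 < slope₀ r ^ 2 * (Real.pi * r ^ 2) := by
      have := Real.pi_pos
      positivity
    rw [Real.toNNReal_lt_toNNReal_iff (by linarith)]
    linarith
  -- Each plateau has length `T/3`, which must be at least `log L` to cover `[λ, L λ]` in
  -- logarithmic scale.
  obtain ⟨T, h, hT, hh⟩ := exists_isProfile (3 * Real.log L)
  have hs := hh.toIsSlow
  have hT0 := hh.pos
  have hLT : Real.log L ≤ T / 3 := by linarith
  have h2 : ∀ s ∈ Icc (7 * T / 12) (7 * T / 12 + T / 3), h s = 2 := fun s hm =>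
    hh.two s ⟨hm.1, by linarith [hm.2]⟩
  have h3 : ∀ s ∈ Icc (T / 12) (T / 12 + T / 3), h s = 3 := fun s hm =>
    hh.three s ⟨hm.1, by linarith [hm.2]⟩
  have d2 : ∀ n, ∀ E ∈ Icc (geomSeq T (7 * T / 12) n) (L * geomSeq T (7 * T / 12) n),
      logDensity h E = 2 * E ^ 2 := fun n E hE => hh.logDensity_eq h2 hL hLT n hE
  have d3 : ∀ n, ∀ E ∈ Icc (geomSeq T (T / 12) n) (L * geomSeq T (T / 12) n),
      logDensity h E = 3 * E ^ 2 := fun n E hE => hh.logDensity_eq h3 hL hLT n hE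
  have hnolim : ¬ ∃ b : ℝ, Tendsto (fun E => logDensity h E / E ^ 2) atTop (𝓝 b) := by
    rintro ⟨b, hb⟩
    have key : ∀ {t c : ℝ}, (∀ n, ∀ E ∈ Icc (geomSeq T t n) (L * geomSeq T t n),
        logDensity h E = c * E ^ 2) → b = c := by
      intro t c hd
      refine tendsto_nhds_unique (hb.comp (tendsto_geomSeq hT0 t))
        (tendsto_const_nhds.congr fun n => ?_)
      have h0 := geomSeq_pos T t n
      rw [Function.comp_apply, hd n _ ⟨le_rfl, le_mul_of_one_le_left h0.le hL.le⟩,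
        mul_div_cancel_right₀ _ (by positivity)]
    linarith [key d2, key d3]
  -- The sequences start at the left ends of the plateaus `2` and `3`. Consecutive starting points
  -- are `T/2` apart, more than `T/3 ≥ log L`, which gives the interlacing.
  refine ⟨geomSeq T (7 * T / 12), geomSeq T (T / 12), logDensity h, strictMono_geomSeq hT0 _,
    strictMono_geomSeq hT0 _, tendsto_geomSeq hT0 _, tendsto_geomSeq hT0 _,
    fun n => ⟨geomSeq_pos _ _ n, mul_geomSeq_lt hL (by linarith),
      mul_geomSeq_lt hL (by push_cast; linarith)⟩,
    ⟨Real.exp T, Real.one_lt_exp_iff.2 hT0, fun n => ⟨geomSeq_succ _ _ n, geomSeq_succ _ _ n⟩⟩,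
    fun E _ => le_trans (by positivity) (hs.logDensity_bounds E).1, hs.strictConvexOn_logDensity,
    d2, d3, hnolim,
    fun q hq r hr => ⟨hs.condA1 hq r, hs.condA2 hq r, hs.condA3 q r, not_condA4 hr hnolim⟩,
    fun hL10 q hq r hr => ?_⟩
  have hr1 : 1 < r := by linarith
  -- `L > 10` makes the plateaus longer than the window `(1, 10)` of gradient norms used in the
  -- energy bounds.
  have hT10 : Real.log 10 ≤ T / 3 := (Real.log_le_log (by norm_num) hL10.le).trans hLT
  refine ⟨fun lam hl => exists_isSolution2 hs hr1 hq hl, fun v hv => ?_⟩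
  obtain ⟨a, ha⟩ := exists_tendsto_energy2 hh hr1 hq (7 * T / 12) hv
  obtain ⟨b, hb⟩ := exists_tendsto_energy2 hh hr1 hq (T / 12) hv
  have hal : a ≤ (2.3 * slope₀ r ^ 2 * (Real.pi * r ^ 2)).toNNReal := by
    rw [← ENNReal.coe_le_coe]
    exact le_of_tendsto' ha fun n => (hv _ (geomSeq_pos _ _ n)).energy2_le hs hr hq
      (geomSeq_pos _ _ n) (hh.isPlateau h2 hT10 n)
  have hbl : (2.5 * slope₀ r ^ 2 * (Real.pi * r ^ 2)).toNNReal ≤ b := by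
    rw [← ENNReal.coe_le_coe]
    exact ge_of_tendsto' hb fun n => (hv _ (geomSeq_pos _ _ n)).le_energy2 hs hr hq
      (geomSeq_pos _ _ n) (hh.isPlateau h3 hT10 n)
  refine ⟨⟨a, b, ha, hb, hal, hbl⟩, ?_, fun hq2 => ⟨fun lam hl => (hv lam hl).memW hs hr1 hq hl, ?_⟩⟩
  · rintro ⟨l, hl⟩
    have e1 := tendsto_nhds_unique ha (hl.comp (tendsto_geomSeq hT0 _))
    have e2 := tendsto_nhds_unique hb (hl.comp (tendsto_geomSeq hT0 _))
    have e3 : a = b := by rw [← ENNReal.coe_inj, e1, e2]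
    have h1 : 0 < slope₀ r := by linarith [(slope₀_bounds hr).1]
    have h4 : 0 < slope₀ r ^ 2 * (Real.pi * r ^ 2) := by
      have := Real.pi_pos
      positivity
    have h5 := hbl.trans (e3 ▸ hal)
    rw [Real.toNNReal_le_toNNReal_iff (by linarith)] at h5
    linarith
  · rintro ⟨u, hu⟩
    exact not_isWeakFamily hh hr hq hq2 (IsSolution2.isWeakFamily hr1 hq hv hu)
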